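/- **Setting.** Let $\mathcal V\subset\mathbb R^n$ be open and convex, let $f\in C^2(\mathcal V;\mathbb R^n)$, $\eta,q\in C^2(\mathcal V)$ with $\nabla^2\eta$ positive definite on $\mathcal V$ and $\nabla q=\nabla\eta\,\nabla f$, and consider $\partial_tu+\partial_xf(u)=0$. Let $\lambda_1(u)\le\dots\le\lambda_n(u)$ be the eigenvalues of $\nabla f(u)$ and assume $\lambda_1(u)<\lambda_n(u)$ for all $u\in\mathcal V$. Put $$\eta(u|v)=\eta(u)-\eta(v)-\nabla\eta(v)\cdot(u-v),\qquad q(u;v)=q(u)-q(v)-\nabla\eta(v)\cdot(f(u)-f(v)).$$ A triple $(u_L,u_R,\sigma)$ with $u_L\ne u_R$ in $\mathcal V$ (left state, right state, speed) is an *entropic Rankine–Hugoniot discontinuity* if $f(u_R)-f(u_L)=\sigma(u_R-u_L)$ and $q(u_R)-q(u_L)\le\sigma(\eta(u_R)-\eta(u_L))$. *Hypotheses $(\mathcal H)$ at $v_L$.* There is $r_0>0$ such that from every $u\in D:=B_{r_0}(v_L)\cap\mathcal V$ there issues a curve $S^1_u:[0,s_u)\to\mathcal V$, $0<s_u\le\infty$,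 parametrized by arc length, with $S^1_u(0)=u$ and $f(S^1_u(s))-f(u)=\sigma^1_u(s)(S^1_u(s)-u)$; $u\mapsto s_u$ is Lipschitz on $D$ (or $s_u=\infty$ throughout $D$); $(s,u)\mapsto S^1_u(s),\ \sigma^1_u(s)$ are $C^1$ on $\{u\in D,\ 0\le s<s_u\}$; $\sigma^1_u(0)=\lambda_1(u)$ and, for $s>0$, $\frac{d}{ds}\sigma^1_u(s)<0$ and $\frac{d}{ds}\eta(u|S^1_u(s))>0$; for each $R>0$ there is $\tilde S>0$ such that every point $S^1_u(s)$ with $|u|,|S^1_u(s)|\le R$ is of the form $S^1_{u'}(s')$ with $|u'|\le R$, $s'\le\tilde S$. Every entropic Rankine–Hugoniot discontinuity satisfies $\sigma>\lambda_1(u_R)$; if moreover $u_L\in D$ and $\sigma\le\lambda_1(u_L)$, then $u_R=S^1_{u_L}(s)$ for some $s\in[0,s_{u_L})$. *Hypotheses $(\mathcal H)^*$ at $v_R$.* The same for curves $S^n_u$ with speeds $\sigma^n_u$ issuing from $u\in D^*:=B_{r_0^*}(v_R)\cap\mathcal V$, with $\sigma^n_u(0)=\lambda_n(u)$ and $\frac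 d{ds}\sigma^n_u(s)>0$; every entropic Rankine–Hugoniot discontinuity satisfies $\sigma<\lambda_n(u_L)$; if moreover $u_R\in D^*$ and $\sigma\ge\lambda_n(u_R)$, then $u_L=S^n_{u_R}(s)$ for some $s\in[0,s_{u_R})$. $(u_L,u_R,\sigma)$ is a *1-shock* if $u_L\in D$, $u_R=S^1_{u_L}(s)$, $\sigma=\sigma^1_{u_L}(s)$ for some $s\in[0,s_{u_L})$; it is an *n-shock* if $u_R\in D^*$, $u_L=S^n_{u_R}(s)$, $\sigma=\sigma^n_{u_R}(s)$ for some $s\in[0,s_{u_R})$. The case $s=0$, i.e. $u_L=u_R$ and $\sigma=\lambda_1(u_L)$ (resp. $\lambda_n(u_R)$), is allowed. A *weak solution entropic for $\eta$* on $\mathbb R\times[0,T)$, $0<T\le\infty$, is a bounded measurable $\mathcal V$-valued $u$ satisfying the system (with bounded measurable $\mathcal V$-valued initial data) and $\partial_t\eta(u)+\partial_xq(u)\le0$ in the sense of distributions, tested against compactly supported Lipschitz functions on $\mathbb R\times[0,T)$. It *has strong traces* if for each Lipschitz $h:[0,T)\to\mathbb R$ there are measurable $u_\pm=u(h(t)\pm,t)$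 with $$\lim_{m\to\infty}\int_0^{t_0}\operatorname*{ess\,sup}_{0<y<1/m}|u(h(t)\pm y,t)-u_\pm(t)|\,dt=0\qquad\text{for all }t_0\in(0,T).$$ **Proposition (existence of the shift functions).** Let $K\subset\mathcal V$ be compact. Let $(u_{L,1},u_{R,1},\sigma^1)$ be a 1-shock with $(\mathcal H)$ holding at $u_{L,1}$, and let $(u_{L,n},u_{R,n},\sigma^n)$ be an n-shock with $(\mathcal H)^*$ holding at $u_{R,n}$. Let $u_{R,1}=S^1_{u_{L,1}}(r_1)$ and $u_{L,n}=S^n_{u_{R,n}}(r_n)$, with speeds $\sigma^1=\sigma^1_{u_{L,1}}(r_1)$, $\sigma^n=\sigma^n_{u_{R,n}}(r_n)$, and suppose $r_1,r_n>\rho>0$. Then there are $a_{1,*},a_{n,*}>0$, such that for all $a_1\in(0,a_{1,*})$ and $a_n\in(0,a_{n,*})$ there are $c_1,c_n>0$ with the following property. For given system and $K$, the number $a_{i,*}$ depends only on the $i$-shock and its family of curves, and $c_i$ only on these, $\rho$ and $a_i$. For every $T\in(0,\infty]$ and every weak solution $u$ on $\mathbb R\times[0,T)$ that is entropic for $\eta$,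 has strong traces and satisfies $u\in K$ a.e., there are Lipschitz functions $h_1,h_n:[0,T)\to\mathbb R$ with $h_1(0)=h_n(0)=0$, $h_1(t)\le h_n(t)$ for all $t\in[0,T)$, and, writing $u^i_\pm=u(h_i(t)\pm,t)$, for almost every $t\in[0,T)$: $$a_1\big(q(u^1_+;u_{R,1})-\dot h_1\,\eta(u^1_+|u_{R,1})\big)-q(u^1_-;u_{L,1})+\dot h_1\,\eta(u^1_-|u_{L,1})\le-c_1|\sigma^1-\dot h_1|^2,$$ $$\tfrac1{a_n}\big(q(u^n_+;u_{R,n})-\dot h_n\,\eta(u^n_+|u_{R,n})\big)-q(u^n_-;u_{L,n})+\dot h_n\,\eta(u^n_-|u_{L,n})\le-c_n|\sigma^n-\dot h_n|^2;$$ either $\dot h_1<\lambda_1(v)$ for all $v\in K$, or $(u^1_-,u^1_+,\dot h_1)$ is a 1-shock with $\eta(u^1_-|u_{L,1})\le a_1\,\eta(u^1_-|u_{R,1})$; and either $\dot h_n>\lambda_n(v)$ for all $v\in K$, or $(u^n_-,u^n_+,\dot h_n)$ is an n-shock with $\eta(u^n_+|u_{R,n})\le a_n\,\eta(u^n_+|u_{L,n})$.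 -/

import Mathlib

open MeasureTheory Set Filter Topology Metric
open scoped ENNReal NNReal

noncomputable section

/-- The state vectors: `ℝⁿ` with the Euclidean norm. -/
abbrev State (n : ℕ) := EuclideanSpace ℝ (Fin n)

/-- A system of conservation laws `∂ₜ u + ∂ₓ f(u) = 0` on an open convex state space `V ⊆ ℝⁿ`,
endowed with a strictly convex entropy `η` and an associated entropy flux `q`. -/
structure EntropySystem (n : ℕ) where
  V : Set (State n)
  f : State n → State n
  η : State n → ℝ
  q : State n → ℝ
  isOpen_V : IsOpen V
  convex_V : Convex ℝ V
  contDiffOn_f : ContDiffOn ℝ 2 f V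
  contDiffOn_η : ContDiffOn ℝ 2 η V
  contDiffOn_q : ContDiffOn ℝ 2 q V
  /-- strict convexity: the Hessian of `η` is positive definite on `V` -/
  hessian_pos : ∀ u ∈ V, ∀ w : State n, w ≠ 0 → 0 < fderiv ℝ (fderiv ℝ η) u w w
  /-- compatibility: `∇q = ∇η ∇f` on `V` -/
  compat : ∀ u ∈ V, ∀ w : State n, fderiv ℝ q u w = fderiv ℝ η u (fderiv ℝ f u w)

namespace EntropySystem

variable {n : ℕ} (sys : EntropySystem n)

/-- The set of eigenvalues of the Jacobian `∇f(u)`. -/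
def charSpeeds (u : State n) : Set ℝ :=
  {μ | Module.End.HasEigenvalue (fderiv ℝ sys.f u).toLinearMap μ}

/-- The smallest characteristic speed `λ₁(u)`. -/
def speedMin (u : State n) : ℝ := sInf (sys.charSpeeds u)

/-- The largest characteristic speed `λₙ(u)`. -/
def speedMax (u : State n) : ℝ := sSup (sys.charSpeeds u)

/-- The relative entropy `η(u|v) = η(u) - η(v) - ∇η(v)·(u - v)`. -/
def relEntropy (u v : State n) : ℝ := sys.η u - sys.η v - fderiv ℝ sys.η v (u - v)

/-- The relative entropy flux `q(u;v) = q(u) - q(v) - ∇η(v)·(f(u) - f(v))`. -/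
def relFlux (u v : State n) : ℝ := sys.q u - sys.q v - fderiv ℝ sys.η v (sys.f u - sys.f v)

/-- `(uL, uR, σ)` is an entropic Rankine-Hugoniot discontinuity with left state `uL`, right state
`uR` and speed `σ`. -/
def IsEntropicDiscontinuity (uL uR : State n) (σ : ℝ) : Prop :=
  uL ∈ sys.V ∧ uR ∈ sys.V ∧ uL ≠ uR ∧
    sys.f uR - sys.f uL = σ • (uR - uL) ∧
    sys.q uR - sys.q uL ≤ σ * (sys.η uR - sys.η uL)

end EntropySystem

/-- The data of a family of curves `s ↦ S_u(s)`, `s ∈ [0, s_u)`, with velocities `σ_u(s)`,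
one for each `u` in a set `dom` of states; `s_u = ∞` is allowed. -/
structure ShockCurves (n : ℕ) where
  dom : Set (State n)
  /-- `s_u` -/
  len : State n → ℝ≥0∞
  /-- `S_u(s)` -/
  curve : State n → ℝ → State n
  /-- `σ_u(s)` -/
  speed : State n → ℝ → ℝ

namespace ShockCurves

variable {n : ℕ} (𝒮 : ShockCurves n)

/-- The parameter interval `[0, s_u)`. -/
def params (u : State n) : Set ℝ := {s | 0 ≤ s ∧ ENNReal.ofReal s < 𝒮.len u}

/-- `v = S_u(r)` and `σ = σ_u(r)` for the parameter `r ∈ [0, s_u)`. -/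
def IsShockAt (u v : State n) (σ r : ℝ) : Prop :=
  u ∈ 𝒮.dom ∧ r ∈ 𝒮.params u ∧ 𝒮.curve u r = v ∧ 𝒮.speed u r = σ

/-- `v` lies on the curve issuing from `u`, with velocity `σ`. The parameter `r = 0` is allowed;
it is the degenerate case `v = u`, `σ = σ_u(0)`. -/
def IsShock (u v : State n) (σ : ℝ) : Prop := ∃ r, 𝒮.IsShockAt u v σ r

end ShockCurves

/-- The requirements common to the families of 1-shock curves and of n-shock curves issuing from
the states in a ball around `v`: everything except the Liu condition. -/
structure IsShockFamily {n : ℕ} (sys : EntropySystem n) (𝒮 : ShockCurves n) (v : State n) :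
    Prop where
  dom_eq : ∃ r₀ : ℝ, 0 < r₀ ∧ 𝒮.dom = ball v r₀ ∩ sys.V
  len_pos : ∀ u ∈ 𝒮.dom, 0 < 𝒮.len u
  mapsTo : ∀ u ∈ 𝒮.dom, ∀ s ∈ 𝒮.params u, 𝒮.curve u s ∈ sys.V
  curve_zero : ∀ u ∈ 𝒮.dom, 𝒮.curve u 0 = u
  /-- parametrization by arc length -/
  arcLength : ∀ u ∈ 𝒮.dom, ∀ s ∈ 𝒮.params u, 0 < s → ‖deriv (𝒮.curve u) s‖ = 1
  rankineHugoniot : ∀ u ∈ 𝒮.dom, ∀ s ∈ 𝒮.params u,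
    sys.f (𝒮.curve u s) - sys.f u = 𝒮.speed u s • (𝒮.curve u s - u)
  /-- `u ↦ s_u` is Lipschitz (or identically infinite) -/
  len_lipschitz : (∀ u ∈ 𝒮.dom, 𝒮.len u = ⊤) ∨
    ((∀ u ∈ 𝒮.dom, 𝒮.len u ≠ ⊤) ∧
      ∃ L : ℝ≥0, LipschitzOnWith L (fun u => (𝒮.len u).toReal) 𝒮.dom)
  contDiffOn_curve : ContDiffOn ℝ 1 (fun p : ℝ × State n => 𝒮.curve p.2 p.1)
    {p | p.2 ∈ 𝒮.dom ∧ p.1 ∈ 𝒮.params p.2}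
  contDiffOn_speed : ContDiffOn ℝ 1 (fun p : ℝ × State n => 𝒮.speed p.2 p.1)
    {p | p.2 ∈ 𝒮.dom ∧ p.1 ∈ 𝒮.params p.2}
  /-- the shock strengthens with `s` -/
  strengthens : ∀ u ∈ 𝒮.dom, ∀ s ∈ 𝒮.params u, 0 < s →
    0 < deriv (fun τ => sys.relEntropy u (𝒮.curve u τ)) s
  /-- the curves do not wrap tightly around themselves -/
  noWrap : ∀ R : ℝ, 0 < R → ∃ S' : ℝ, 0 < S' ∧
    {w | ∃ u ∈ 𝒮.dom, ∃ s ∈ 𝒮.params u, ‖u‖ ≤ R ∧ ‖𝒮.curve u s‖ ≤ R ∧ w = 𝒮.curve u s} ⊆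
    {w | ∃ u ∈ 𝒮.dom, ∃ s ∈ 𝒮.params u, ‖u‖ ≤ R ∧ s ≤ S' ∧ w = 𝒮.curve u s}

/-- The hypotheses `(ℋ)` on the 1-shock curves issuing from the states near `vL`. -/
structure HypH {n : ℕ} (sys : EntropySystem n) (𝒮 : ShockCurves n) (vL : State n) : Prop where
  family : IsShockFamily sys 𝒮 vL
  speed_zero : ∀ u ∈ 𝒮.dom, 𝒮.speed u 0 = sys.speedMin u
  /-- Liu condition: the shock speed decreases along the curve -/
  liu : ∀ u ∈ 𝒮.dom, ∀ s ∈ 𝒮.params u, 0 < s → deriv (𝒮.speed u) s < 0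
  speed_gt : ∀ uL uR σ, sys.IsEntropicDiscontinuity uL uR σ → sys.speedMin uR < σ
  separated : ∀ uL uR σ, uL ∈ 𝒮.dom → sys.IsEntropicDiscontinuity uL uR σ →
    σ ≤ sys.speedMin uL → ∃ s ∈ 𝒮.params uL, 𝒮.curve uL s = uR

/-- The dual hypotheses `(ℋ)*` on the n-shock curves issuing from the states near `vR`; these
curves describe the left states of n-shocks with given right state. -/
structure HypHStar {n : ℕ} (sys : EntropySystem n) (𝒮 : ShockCurves n) (vR : State n) :
    Prop where
  family : IsShockFamily sys 𝒮 vR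
  speed_zero : ∀ u ∈ 𝒮.dom, 𝒮.speed u 0 = sys.speedMax u
  /-- Liu condition: the shock speed increases along the curve -/
  liu : ∀ u ∈ 𝒮.dom, ∀ s ∈ 𝒮.params u, 0 < s → 0 < deriv (𝒮.speed u) s
  speed_lt : ∀ uL uR σ, sys.IsEntropicDiscontinuity uL uR σ → σ < sys.speedMax uL
  separated : ∀ uL uR σ, uR ∈ 𝒮.dom → sys.IsEntropicDiscontinuity uL uR σ →
    sys.speedMax uR ≤ σ → ∃ s ∈ 𝒮.params uR, 𝒮.curve uR s = uL

/-- The time interval `[0, T)`, where `T = ∞` is allowed. -/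
def timeSet (T : EReal) : Set ℝ := {t | 0 ≤ t ∧ (t : EReal) < T}

/-- The points `(x, t)` of `ℝ × [0, T)`. -/
def strip (T : EReal) : Set (ℝ × ℝ) := {p | p.2 ∈ timeSet T}

/-- Lipschitz test functions on `ℝ × [0, T)` with compact support (written as restrictions of
Lipschitz functions on the plane). -/
def IsTestFunction {F : Type*} [NormedAddCommGroup F] (T : EReal) (φ : ℝ × ℝ → F) : Prop :=
  (∃ L : ℝ≥0, LipschitzWith L φ) ∧ HasCompactSupport φ ∧
    ∀ p ∈ tsupport φ, (p.2 : EReal) < T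

/-- `∂ₓ φ` at `p = (x, t)`. -/
def dx {F : Type*} [NormedAddCommGroup F] [NormedSpace ℝ F] (φ : ℝ × ℝ → F) (p : ℝ × ℝ) : F :=
  deriv (fun x => φ (x, p.2)) p.1

/-- `∂ₜ φ` at `p = (x, t)`. -/
def dt {F : Type*} [NormedAddCommGroup F] [NormedSpace ℝ F] (φ : ℝ × ℝ → F) (p : ℝ × ℝ) : F :=
  deriv (fun t => φ (p.1, t)) p.2

/-- `u` is a bounded weak solution of the system on `ℝ × [0, T)` with initial data `u⁰`. -/
structure IsWeakSolution {n : ℕ} (sys : EntropySystem n) (T : EReal) (u₀ : ℝ → State n)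
    (u : ℝ × ℝ → State n) : Prop where
  meas : AEStronglyMeasurable u (volume.restrict (strip T))
  bounded : ∃ M : ℝ, ∀ᵐ p ∂(volume.restrict (strip T)), ‖u p‖ ≤ M
  mem_V : ∀ᵐ p ∂(volume.restrict (strip T)), u p ∈ sys.V
  meas_init : AEStronglyMeasurable u₀ volume
  bounded_init : ∃ M : ℝ, ∀ᵐ x, ‖u₀ x‖ ≤ M
  init_mem_V : ∀ᵐ x, u₀ x ∈ sys.V
  weak : ∀ Φ : ℝ × ℝ → State n, IsTestFunction T Φ →
    (∫ p in strip T, (inner ℝ (dt Φ p) (u p) + inner ℝ (dx Φ p) (sys.f (u p)))) +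
      ∫ x, inner ℝ (Φ (x, 0)) (u₀ x) = 0

/-- `u` is entropic for `η`: `∂ₜ η(u) + ∂ₓ q(u) ≤ 0` in the sense of distributions. -/
def IsEntropic {n : ℕ} (sys : EntropySystem n) (T : EReal) (u₀ : ℝ → State n)
    (u : ℝ × ℝ → State n) : Prop :=
  ∀ φ : ℝ × ℝ → ℝ, IsTestFunction T φ → (∀ p, 0 ≤ φ p) →
    0 ≤ (∫ p in strip T, (dt φ p * sys.η (u p) + dx φ p * sys.q (u p))) +
      ∫ x, φ (x, 0) * sys.η (u₀ x)

/-- `up` is the right trace `t ↦ u(h(t)+, t)`. -/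
def IsRightTrace {n : ℕ} (T : EReal) (u : ℝ × ℝ → State n) (h : ℝ → ℝ) (up : ℝ → State n) :
    Prop :=
  AEStronglyMeasurable up (volume.restrict (timeSet T)) ∧
  ∀ t₀ : ℝ, 0 < t₀ → (t₀ : EReal) < T →
    Tendsto (fun k : ℕ => ∫⁻ t in Ioo 0 t₀,
      essSup (fun y => ‖u (h t + y, t) - up t‖ₑ) (volume.restrict (Ioo 0 (1 / ((k : ℝ) + 1)))))
      atTop (𝓝 0)

/-- `um` is the left trace `t ↦ u(h(t)-, t)`. -/
def IsLeftTrace {n : ℕ} (T : EReal) (u : ℝ × ℝ → State n) (h : ℝ → ℝ) (um : ℝ → State n) :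
    Prop :=
  AEStronglyMeasurable um (volume.restrict (timeSet T)) ∧
  ∀ t₀ : ℝ, 0 < t₀ → (t₀ : EReal) < T →
    Tendsto (fun k : ℕ => ∫⁻ t in Ioo 0 t₀,
      essSup (fun y => ‖u (h t + y, t) - um t‖ₑ) (volume.restrict (Ioo (-(1 / ((k : ℝ) + 1))) 0)))
      atTop (𝓝 0)

/-- The strong trace property. -/
def HasStrongTraces {n : ℕ} (T : EReal) (u : ℝ × ℝ → State n) : Prop :=
  ∀ h : ℝ → ℝ, (∃ L : ℝ≥0, LipschitzOnWith L h (timeSet T)) →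
    ∃ up um : ℝ → State n, IsRightTrace T u h up ∧ IsLeftTrace T u h um

end

/-!
# Existence of the shift functions

The shift of a 1-shock is a Lipschitz curve `h` which at almost every time moves in one of two
ways. Let `G(u) = a η(u|u_R) - η(u|u_L)`. Where `G ≥ 0`, the curve may follow the solution: it
travels with a discontinuity, whose left state `m` satisfies `G(m) ≥ 0` and which is not faster
than `λ₁(m)`, or with the speed `λ₁` where the solution is continuous. Where `G ≤ δ` it may travel
to the left with a large speed `M`. In the first case the jump is an admissible 1-shock by
`HypH.separated`, and the dissipation estimate is the contraction property of shocks; in the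
second case the estimate holds because `M` is large.

*Dissipation.* For small `a` the states with `G ≥ 0` lie close to `u_L`, where `u_L` is the left
state of the reference shock. Along the shock curve issuing from such a state `u`, the flux
relative to `u_R`, in the frame of the shock, increases up to the strength of the reference shock
and decreases afterwards; the estimate is quadratic near the reference shock
(`HypH.exists_movingFlux_le_near`) and uniform away from it (`HypH.exists_movingFlux_le_far`). The
entropy relative to `u_L` contributes a term with a sign, because the reference shock is strictly
slower than `λ₁(u_L)`. This gives `HypH.exists_dissipation_shock`; the estimate for the speed `-M`
follows by compactness (`EntropySystem.exists_dissipation_fast`).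

*Construction of the curve.* A Filippov solution of the ordinary differential equation whose
velocity is `λ₁` for `G ≥ θ` and `-M` for `G < θ` is almost what is needed, but it can slide along
`{G = θ}` with a speed strictly between `-M` and `λ₁`. The overlap region `0 ≤ G ≤ δ` is used to
remove such exceptional times. On a short time interval on which the sliding speed is intermediate
and the solution is nearly constant, the curve is replaced by one which moves first with the speed
`-M` (a larger `θ`) and then with the speed `λ₁` (a smaller `θ`) until it has returned to the
original curve, with fewer exceptional times. A maximality argument in the spirit of Ekeland's
principle, in which the measure of the exceptional set controls the measure of the times at which
the curve has been modified, then produces a curve with no exceptional times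
(`ShiftData.exists_good_path`). The construction keeps the curve to the left of any barrier which
moves faster than `λ₁`.

*Traces.* Testing the weak formulation with functions which concentrate on a Lipschitz curve
yields the Rankine-Hugoniot condition and the entropy inequality for the one-sided limits along
that curve (`isEntropicDiscontinuity_of_traces`).

*Two families.* The reflection `x ↦ -x` turns n-shocks into 1-shocks of the system with fluxes
`-f` and `-q`. The n-shift is constructed first; it is at least as fast as `λₙ > λ₁` of its right
trace, so that it serves as a barrier for the 1-shift, and the two shifts are ordered.
-/

/-! ### Lipschitz functions of one real variable -/

/-- At almost every point of the zero set of a function, the derivative vanishes if it exists: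
the zeros with nonzero derivative are isolated, hence countably many. -/
theorem ae_deriv_eq_zero_of_eq_zero (k : ℝ → ℝ) :
    ∀ᵐ t : ℝ, k t = 0 → DifferentiableAt ℝ k t → deriv k t = 0 := by
  set D : Set ℝ := {t | k t = 0 ∧ DifferentiableAt ℝ k t ∧ deriv k t ≠ 0}
  have hdisc : DiscreteTopology D := by
    rw [discreteTopology_subtype_iff]
    rintro t ⟨h0, hd, hne⟩
    rw [← disjoint_iff, Filter.disjoint_principal_right]
    filter_upwards [hd.hasDerivAt.eventually_ne (c := 0) hne] with z hz hzD
    exact hz hzD.1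
  have hc : D.Countable := countable_coe_iff.mp
    (@countable_of_Lindelof_of_discrete D _ inferInstance hdisc)
  filter_upwards [compl_mem_ae_iff.mpr (hc.measure_zero volume)] with t ht h0 hd
  by_contra hne
  exact ht ⟨h0, hd, hne⟩

theorem ae_deriv_eq_of_eq (f g : ℝ → ℝ) :
    ∀ᵐ t : ℝ, f t = g t → DifferentiableAt ℝ f t → DifferentiableAt ℝ g t →
      deriv f t = deriv g t := by
  filter_upwards [ae_deriv_eq_zero_of_eq_zero (fun t => f t - g t)] with t ht h0 hf hg
  have := ht (by simp [h0]) (hf.sub hg)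
  rw [deriv_fun_sub hf hg] at this
  linarith

theorem LipschitzWith.abs_deriv_le {L : ℝ≥0} {f : ℝ → ℝ} (hf : LipschitzWith L f) (t : ℝ) :
    |deriv f t| ≤ L := by
  simpa using norm_deriv_le_of_lipschitz (x₀ := t) hf

theorem LipschitzWith.integral_deriv {L : ℝ≥0} {f : ℝ → ℝ} (hf : LipschitzWith L f) (a b : ℝ) :
    IntervalIntegrable (deriv f) volume a b ∧ ∫ t in a..b, deriv f t = f b - f a :=
  have h := (hf.lipschitzOnWith (s := uIcc a b)).absolutelyContinuousOnInterval
  ⟨h.intervalIntegrable_deriv, h.integral_deriv_eq_sub⟩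

theorem LipschitzWith.abs_sub_le_mul {L : ℝ≥0} {f : ℝ → ℝ} (hf : LipschitzWith L f) (s t : ℝ) :
    |f s - f t| ≤ L * |s - t| := by
  simpa [Real.dist_eq] using hf.dist_le_mul s t

/-- A lower bound for the derivative on `S` gives a lower bound for the increment, up to the
measure of the complement of `S`. -/
theorem LipschitzWith.sub_ge_of_deriv_ge {L : ℝ≥0} {f : ℝ → ℝ} (hf : LipschitzWith L f)
    {a b c : ℝ} (hab : a ≤ b) {S : Set ℝ} (hS : MeasurableSet S)
    (h : ∀ᵐ t, t ∈ Ioo a b → t ∈ S → c ≤ deriv f t) :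
    c * (b - a) - (|c| + L) * volume.real (Ioo a b \ S) ≤ f b - f a := by
  obtain ⟨hi, he⟩ := hf.integral_deriv a b
  rw [← he]
  set g : ℝ → ℝ := fun t => c - (|c| + L) * indicator Sᶜ 1 t
  have hind : IntervalIntegrable (fun t => (|c| + L) * indicator Sᶜ (1 : ℝ → ℝ) t) volume a b := by
    apply IntervalIntegrable.const_mul
    rw [intervalIntegrable_iff]
    exact (integrableOn_const (by rw [uIoc]; exact measure_Ioc_lt_top.ne)).indicator hS.compl
  have hg : IntervalIntegrable g volume a b := by
    exact intervalIntegrable_const.sub hind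
  have hval : ∫ t in a..b, g t = c * (b - a) - (|c| + L) * volume.real (Ioo a b \ S) := by
    simp only [g]
    rw [intervalIntegral.integral_sub intervalIntegrable_const hind,
      intervalIntegral.integral_const, intervalIntegral.integral_const_mul,
      intervalIntegral.integral_of_le hab, integral_Ioc_eq_integral_Ioo,
      integral_indicator_one hS.compl]
    rw [measureReal_restrict_apply hS.compl, smul_eq_mul, mul_comm (b - a)]
    congr 3
    ext; simp [and_comm]
  rw [← hval]
  rw [intervalIntegral.integral_of_le hab, intervalIntegral.integral_of_le hab,
    integral_Ioc_eq_integral_Ioo, integral_Ioc_eq_integral_Ioo]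
  rw [intervalIntegrable_iff_integrableOn_Ioo_of_le hab] at hg hi
  apply integral_mono_ae hg hi
  filter_upwards [ae_restrict_of_ae h, ae_restrict_mem measurableSet_Ioo] with t ht htI
  have habs := neg_le_of_abs_le (hf.abs_deriv_le t)
  by_cases htS : t ∈ S
  · simpa [g, htS] using ht htI htS
  · simp only [g, indicator_of_mem (mem_compl htS), Pi.one_apply]
    linarith [le_abs_self c]

/-- If the increments of `f` are bounded by the integrals of `g`, then `f' ≤ g` almost
everywhere. -/
theorem ae_deriv_le_of_sub_le_integral {L : ℝ≥0} {f g : ℝ → ℝ} (hf : LipschitzWith L f) {t₀ : ℝ}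
    (hg : ∀ a b, IntervalIntegrable g volume a b)
    (h : ∀ a b, t₀ ≤ a → a ≤ b → f b - f a ≤ ∫ t in a..b, g t) :
    ∀ᵐ t, t₀ < t → deriv f t ≤ g t := by
  have hl : LocallyIntegrable g := by
    intro x
    refine ⟨Icc (x - 1) (x + 1), Icc_mem_nhds (by linarith) (by linarith), ?_⟩
    rw [integrableOn_Icc_iff_integrableOn_Ioc]
    exact (intervalIntegrable_iff_integrableOn_Ioc_of_le (by linarith)).mp (hg _ _)
  filter_upwards [hf.ae_differentiableAt_real, _root_.LocallyIntegrable.ae_hasDerivAt_integral hl]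
    with t hft hgt ht
  have hd : HasDerivAt (fun s => (∫ u in t₀..s, g u) - f s) (g t - deriv f t) t :=
    (hgt t₀).sub hft.hasDerivAt
  have hmono : MonotoneOn (fun s => (∫ u in t₀..s, g u) - f s) (Ioi t₀) := by
    intro a ha b hb hab
    have h1 := h a b (le_of_lt ha) hab
    have h2 := intervalIntegral.integral_add_adjacent_intervals (hg t₀ a) (hg a b)
    simp only
    linarith
  have h0 : 0 ≤ derivWithin (fun s => (∫ u in t₀..s, g u) - f s) (Ioi t₀) t :=
    hmono.derivWithin_nonneg
  rw [derivWithin_of_isOpen isOpen_Ioi ht, hd.deriv] at h0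
  linarith

/-- Compactness: along the hyperfilter, an equi-Lipschitz sequence of functions with a common value
at `t₀` converges, uniformly on bounded intervals, to a Lipschitz function. -/
theorem exists_hyperfilter_limit {L : ℝ≥0} {f : ℕ → ℝ → ℝ} (hf : ∀ k, LipschitzWith L (f k))
    {t₀ x₀ : ℝ} (h₀ : ∀ k, f k t₀ = x₀) :
    ∃ h : ℝ → ℝ, LipschitzWith L h ∧
      (∀ t, Tendsto (fun k => f k t) (hyperfilter ℕ) (𝓝 (h t))) ∧
      ∀ a b r, 0 < r → ∀ᶠ k in (hyperfilter ℕ : Filter ℕ), ∀ t ∈ Icc a b, |f k t - h t| ≤ r := by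
  have hlim : ∀ t, ∃ y, Tendsto (fun k => f k t) (hyperfilter ℕ) (𝓝 y) := by
    intro t
    have hb : ∀ k, f k t ∈ closedBall x₀ (L * |t - t₀|) := by
      intro k
      have := (hf k).abs_sub_le_mul t t₀
      rwa [h₀, ← Real.dist_eq] at this
    obtain ⟨y, -, hy⟩ := (isCompact_closedBall x₀ (L * |t - t₀|)).ultrafilter_le_nhds
      ((hyperfilter ℕ).map (fun k => f k t)) (by
        rw [le_principal_iff]
        exact Filter.mem_map.mpr (Filter.univ_mem' hb))
    exact ⟨y, hy⟩
  choose h hh using hlim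
  have hL : LipschitzWith L h := by
    apply LipschitzWith.of_dist_le_mul
    intro s t
    apply le_of_tendsto ((hh s).dist (hh t))
    exact Eventually.of_forall fun k => (hf k).dist_le_mul s t
  refine ⟨h, hL, hh, fun a b r hr => ?_⟩
  set ρ : ℝ := r / (3 * (L + 1))
  have hLp : (0 : ℝ) < L + 1 := by positivity
  have hρ : 0 < ρ := by positivity
  have hLρ : L * ρ ≤ r / 3 := by
    have : (L + 1) * ρ = r / 3 := by simp only [ρ]; field_simp
    nlinarith
  obtain ⟨s, -, hs⟩ := (isCompact_Icc (a := a) (b := b)).elim_nhds_subcover (fun x => ball x ρ)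
    (fun x _ => ball_mem_nhds x hρ)
  have hev : ∀ᶠ k in (hyperfilter ℕ : Filter ℕ), ∀ x ∈ s, |f k x - h x| < r / 3 := by
    rw [Filter.eventually_all_finset]
    intro x _
    have := (Metric.tendsto_nhds.mp (hh x)) (r / 3) (by positivity)
    simpa [Real.dist_eq] using this
  filter_upwards [hev] with k hk t ht
  obtain ⟨x, hx, htx⟩ := mem_iUnion₂.mp (hs ht)
  rw [mem_ball, Real.dist_eq] at htx
  have h1 := (hf k).abs_sub_le_mul t x
  have h2 := hL.abs_sub_le_mul x t
  have h3 := hk x hx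
  rw [abs_sub_comm x t] at h2
  have h4 : L * |t - x| ≤ r / 3 := (mul_le_mul_of_nonneg_left htx.le L.coe_nonneg).trans hLρ
  rw [abs_le] at *
  rw [abs_lt] at h3
  constructor <;> linarith [h1.1, h1.2, h2.1, h2.2, h3.1, h3.2]

/-! ### Filippov solutions of ordinary differential equations with measurable velocity -/

/-- `v` is an admissible velocity at the point `(x, t)`, in the sense of Filippov, for the
measurable velocity field `V`: it lies between the essential infimum and the essential supremum of
`V(·, t)` over every neighbourhood of `x`. -/
def IsFilippovVelocity (V : ℝ × ℝ → ℝ) (x t v : ℝ) : Prop :=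
  ∀ r c : ℝ, 0 < r → ((∀ᵐ y, |y| < r → V (x + y, t) ≤ c) → v ≤ c) ∧
    ((∀ᵐ y, |y| < r → c ≤ V (x + y, t)) → c ≤ v)

theorem measurableSet_ae_section {A : Set (ℝ × ℝ)} (hA : MeasurableSet A) :
    MeasurableSet {s : ℝ | ∀ᵐ y, (s, y) ∈ A} := by
  have : {s : ℝ | ∀ᵐ y, (s, y) ∈ A} = {s | volume (Prod.mk s ⁻¹' Aᶜ) = 0} := by
    ext s; rfl
  rw [this]
  exact measurable_measure_prodMk_left hA.compl (measurableSet_singleton 0)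

/-- The upper Filippov bound passes to the limit of approximate solutions. -/
theorem ae_deriv_le_of_approx {L : ℝ≥0} {h : ℝ → ℝ} (hh : LipschitzWith L h) {t₀ : ℝ}
    {f v : ℕ → ℝ → ℝ} {e : ℕ → ℝ} {W : ℝ × ℝ → ℝ} (hW : Measurable W)
    (hvm : ∀ k, Measurable (v k)) (hvb : ∀ k s, |v k s| ≤ L)
    (hfv : ∀ k a b, f k b - f k a = ∫ t in a..b, v k t)
    (hlim : ∀ a b r, 0 < r → ∀ᶠ k in (hyperfilter ℕ : Filter ℕ), ∀ t ∈ Icc a b, |f k t - h t| ≤ r)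
    (he : Tendsto e (hyperfilter ℕ) (𝓝 0))
    (hv : ∀ k s c r, t₀ ≤ s → (∀ᵐ y, |y| < r → W (s, y) ≤ c) → |f k s - h s| + e k < r →
      v k s ≤ c) :
    ∀ᵐ t, t₀ < t → ∀ r c : ℝ, 0 < r → (∀ᵐ y, |y| < r → W (t, y) ≤ c) → deriv h t ≤ c := by
  have main : ∀ r c : ℚ, 0 < r → ∀ᵐ t, t₀ < t → (∀ᵐ y, |y| < (r : ℝ) → W (t, y) ≤ c) →
      deriv h t ≤ c := by
    intro r c hr
    have hr' : (0 : ℝ) < r := by exact_mod_cast hr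
    set S : Set ℝ := {t | ∀ᵐ y, |y| < (r : ℝ) → W (t, y) ≤ c} with hS
    have hSm : MeasurableSet S := by
      have : MeasurableSet {p : ℝ × ℝ | |p.2| < (r : ℝ) → W p ≤ c} := by
        apply MeasurableSet.imp
        · exact measurableSet_lt (by fun_prop) measurable_const
        · exact measurableSet_le hW measurable_const
      exact measurableSet_ae_section this
    classical
    set g : ℝ → ℝ := S.piecewise (fun _ => (c : ℝ)) (fun _ => (L : ℝ)) with hg
    have hgm : Measurable g := measurable_const.piecewise hSm measurable_const
    have hgb : ∀ t, ‖g t‖ ≤ |(c : ℝ)| + L := by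
      intro t
      by_cases ht : t ∈ S
      · simp only [hg, piecewise_eq_of_mem _ _ _ ht, Real.norm_eq_abs]
        linarith [L.coe_nonneg]
      · simp [hg, ht]
    have hii : ∀ {w : ℝ → ℝ} {B : ℝ} (_ : Measurable w) (_ : ∀ t, ‖w t‖ ≤ B) (a b : ℝ),
        IntervalIntegrable w volume a b := by
      intro w B hw hB a b
      rw [intervalIntegrable_iff]
      exact Measure.integrableOn_of_bounded (by rw [uIoc]; exact measure_Ioc_lt_top.ne)
        hw.aestronglyMeasurable (Eventually.of_forall hB)
    have hgi := hii hgm hgb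
    have key : ∀ a b, t₀ ≤ a → a ≤ b → h b - h a ≤ ∫ t in a..b, g t := by
      intro a b ha hab
      have hev : ∀ᶠ k in (hyperfilter ℕ : Filter ℕ), f k b - f k a ≤ ∫ t in a..b, g t := by
        filter_upwards [hlim a b (r / 4) (by positivity),
          he.eventually (gt_mem_nhds (show (0 : ℝ) < r / 4 by positivity))] with k hk hek
        rw [hfv]
        apply intervalIntegral.integral_mono_on hab (hii (hvm k) (hvb k) a b) (hgi a b)
        intro s hs
        by_cases hsS : s ∈ S
        · simp only [hg, piecewise_eq_of_mem _ _ _ hsS]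
          exact hv k s c r (ha.trans hs.1) hsS (by have := hk s hs; linarith)
        · simp only [hg, piecewise_eq_of_notMem _ _ _ hsS]
          exact le_of_abs_le (hvb k s)
      have hpt : ∀ t, Tendsto (fun k => f k t) (hyperfilter ℕ) (𝓝 (h t)) := by
        intro t
        rw [Metric.tendsto_nhds]
        intro ε hε
        filter_upwards [hlim t t (ε / 2) (by positivity)] with k hk
        rw [Real.dist_eq]
        linarith [hk t (by simp)]
      exact le_of_tendsto ((hpt b).sub (hpt a)) hev
    filter_upwards [ae_deriv_le_of_sub_le_integral hh hgi key] with t ht ht0 htS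
    have := ht ht0
    have htS' : t ∈ S := htS
    simpa [hg, htS'] using this
  have main' := ae_all_iff.mpr fun r : ℚ => ae_all_iff.mpr fun c : ℚ =>
    (Filter.eventually_imp_distrib_left.mpr (main r c))
  filter_upwards [main'] with t ht ht0 r c hr hc
  obtain ⟨r', hr'0, hr'⟩ := exists_rat_btwn hr
  apply le_of_forall_gt_imp_ge_of_dense
  intro b hb
  obtain ⟨c', hc', hcb⟩ := exists_rat_btwn hb
  refine le_trans (ht r' c' (by exact_mod_cast hr'0) ht0 ?_) hcb.le
  filter_upwards [hc] with y hy hyr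
  exact (hy (hyr.trans hr')).trans hc'.le

/-- The Euler scheme with step `e`, in which the velocity is averaged over a distance `e`. -/
theorem exists_euler {V : ℝ × ℝ → ℝ} (hV : Measurable V) {L : ℝ≥0} (hb : ∀ p, |V p| ≤ L)
    (t₀ x₀ : ℝ) {e : ℝ} (he : 0 < e) :
    ∃ f v : ℝ → ℝ, LipschitzWith L f ∧ f t₀ = x₀ ∧ Measurable v ∧ (∀ s, |v s| ≤ L) ∧
      (∀ a b, f b - f a = ∫ t in a..b, v t) ∧
      ∀ s, t₀ ≤ s → ∃ H, |f s - H| ≤ L * e ∧ v s = e⁻¹ * ∫ y in 0..e, V (H + y, s) := by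
  set w : ℝ × ℝ → ℝ := fun p => e⁻¹ * ∫ y in 0..e, V (p.1 + y, p.2) with hw
  have hwm : Measurable w := by
    apply Measurable.const_mul
    have : StronglyMeasurable (fun q : (ℝ × ℝ) × ℝ => V (q.1.1 + q.2, q.1.2)) :=
      (hV.comp (by fun_prop)).stronglyMeasurable
    have h2 := this.integral_prod_right' (ν := volume.restrict (Ioc 0 e))
    simpa only [intervalIntegral.integral_of_le he.le] using h2.measurable
  have hwb : ∀ p, |w p| ≤ L := by
    intro p
    have := intervalIntegral.norm_integral_le_of_norm_le_const (a := 0) (b := e) (C := L)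
      (f := fun y => V (p.1 + y, p.2)) (fun y _ => hb _)
    rw [sub_zero, abs_of_pos he, Real.norm_eq_abs] at this
    simp only [hw, abs_mul, abs_inv, abs_of_pos he]
    rw [inv_mul_le_iff₀ he]
    linarith
  let H : ℕ → ℝ := fun j => Nat.rec x₀
    (fun j x => x + ∫ s in (t₀ + j * e)..(t₀ + (j + 1) * e), w (x, s)) j
  have hH0 : H 0 = x₀ := rfl
  have hHs : ∀ j, H (j + 1) = H j + ∫ s in (t₀ + j * e)..(t₀ + (j + 1) * e), w (H j, s) :=
    fun j => rfl
  set v : ℝ → ℝ := fun s => w (H ⌊(s - t₀) / e⌋₊, s) with hv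
  have hvm : Measurable v := by
    apply hwm.comp
    apply Measurable.prodMk _ measurable_id
    exact (measurable_from_nat (f := H)).comp (Nat.measurable_floor.comp (by fun_prop))
  have hvb : ∀ s, |v s| ≤ L := fun s => hwb _
  have hvi : ∀ a b, IntervalIntegrable v volume a b := by
    intro a b
    rw [intervalIntegrable_iff]
    exact Measure.integrableOn_of_bounded (by rw [uIoc]; exact measure_Ioc_lt_top.ne)
      hvm.aestronglyMeasurable (Eventually.of_forall hvb)
  set f : ℝ → ℝ := fun t => x₀ + ∫ s in t₀..t, v s with hf
  have hfv : ∀ a b, f b - f a = ∫ t in a..b, v t := by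
    intro a b
    have := intervalIntegral.integral_add_adjacent_intervals (hvi t₀ a) (hvi a b)
    simp only [hf]
    linarith
  have hfL : LipschitzWith L f := by
    apply LipschitzWith.of_dist_le_mul
    intro a b
    rw [Real.dist_eq, hfv, Real.dist_eq]
    have := intervalIntegral.norm_integral_le_of_norm_le_const (a := b) (b := a) (C := L)
      (f := v) (fun y _ => hvb _)
    exact this
  have hnode : ∀ j : ℕ, f (t₀ + j * e) = H j := by
    intro j
    induction j with
    | zero => simp [hf, hH0]
    | succ j ih =>
      have h1 := hfv (t₀ + j * e) (t₀ + (j + 1 : ℕ) * e)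
      rw [hHs, ← ih]
      have h2 : ∫ t in (t₀ + j * e)..(t₀ + (j + 1 : ℕ) * e), v t =
          ∫ s in (t₀ + j * e)..(t₀ + (j + 1) * e), w (f (t₀ + j * e), s) := by
        push_cast
        have hle : t₀ + j * e ≤ t₀ + (j + 1) * e := by nlinarith
        rw [intervalIntegral.integral_of_le hle, intervalIntegral.integral_of_le hle,
          integral_Ioc_eq_integral_Ioo, integral_Ioc_eq_integral_Ioo]
        apply setIntegral_congr_fun measurableSet_Ioo
        intro s hs
        have : ⌊(s - t₀) / e⌋₊ = j := by
          rw [Nat.floor_eq_iff (div_nonneg (by nlinarith [hs.1, (Nat.cast_nonneg j : (0:ℝ) ≤ j)])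
            he.le), le_div_iff₀ he, div_lt_iff₀ he]
          constructor <;> linarith [hs.1, hs.2]
        simp only [hv, this, ih]
      rw [← h2]
      linarith
  refine ⟨f, v, hfL, by simp [hf], hvm, hvb, hfv, fun s hs => ⟨H ⌊(s - t₀) / e⌋₊, ?_, rfl⟩⟩
  have hq : 0 ≤ (s - t₀) / e := div_nonneg (by linarith) he.le
  have h1 := Nat.floor_le hq
  have h2 := Nat.lt_floor_add_one ((s - t₀) / e)
  rw [le_div_iff₀ he] at h1
  rw [div_lt_iff₀ he] at h2
  rw [← hnode]
  refine (hfL.abs_sub_le_mul _ _).trans (mul_le_mul_of_nonneg_left ?_ L.coe_nonneg)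
  rw [abs_le]
  constructor <;> linarith

/-- Existence of Filippov solutions: the limit of the averaged Euler schemes. -/
theorem exists_filippov {V : ℝ × ℝ → ℝ} (hV : Measurable V) {L : ℝ≥0} (hb : ∀ p, |V p| ≤ L)
    (t₀ x₀ : ℝ) :
    ∃ h : ℝ → ℝ, LipschitzWith L h ∧ h t₀ = x₀ ∧
      ∀ᵐ t, t₀ < t → IsFilippovVelocity V (h t) t (deriv h t) := by
  have hpos : ∀ k : ℕ, (0 : ℝ) < 1 / ((k : ℝ) + 1) := fun k => by positivity
  choose f v hfL hf0 hvm hvb hfv hst using fun k : ℕ => exists_euler hV hb t₀ x₀ (hpos k)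
  obtain ⟨h, hL, hpt, hunif⟩ := exists_hyperfilter_limit hfL hf0
  have h0 : h t₀ = x₀ := by
    refine tendsto_nhds_unique (hpt t₀) ?_
    simp [hf0]
  refine ⟨h, hL, h0, ?_⟩
  have he : Tendsto (fun k : ℕ => (L + 1) * (1 / ((k : ℝ) + 1))) (hyperfilter ℕ) (𝓝 0) := by
    have := (tendsto_one_div_add_atTop_nhds_zero_nat (𝕜 := ℝ)).const_mul ((L : ℝ) + 1)
    rw [mul_zero] at this
    exact this.mono_left Nat.hyperfilter_le_atTop
  have hWm : Measurable (fun p : ℝ × ℝ => V (h p.1 + p.2, p.1)) := by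
    have := hL.continuous.measurable
    exact hV.comp (by fun_prop)
  -- the points at which the scheme samples the velocity are close to the limit curve
  have hsample : ∀ k s r, |f k s - h s| + (L + 1) * (1 / ((k : ℝ) + 1)) < r → ∀ H,
      |f k s - H| ≤ L * (1 / ((k : ℝ) + 1)) → ∀ P : ℝ → Prop,
      (∀ᵐ y, |y| < r → P (h s + y)) →
      ∀ᵐ y, y ∈ Ioc 0 (1 / ((k : ℝ) + 1)) → P (H + y) := by
    intro k s r hr H hH P hP
    have := (measurePreserving_add_left volume (H - h s)).quasiMeasurePreserving.ae hP
    filter_upwards [this] with y hy hyI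
    have h2 := hy ?_
    · convert h2 using 1; ring
    · rw [abs_le] at hH
      have h3 := abs_lt.mp (show |f k s - h s| < r - (L + 1) * (1 / ((k : ℝ) + 1)) by linarith)
      rw [abs_lt]
      constructor <;> linarith [hyI.1, hyI.2, h3.1, h3.2, hH.1, hH.2]
  have hi : ∀ k s H, IntervalIntegrable (fun y => V (H + y, s)) volume 0 (1 / ((k : ℝ) + 1)) := by
    intro k s H
    rw [intervalIntegrable_iff]
    exact Measure.integrableOn_of_bounded (by rw [uIoc]; exact measure_Ioc_lt_top.ne)
      (hV.comp (by fun_prop)).aestronglyMeasurable (Eventually.of_forall fun y => hb _)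
  have havg : ∀ (k : ℕ) s c r, t₀ ≤ s → (∀ᵐ y, |y| < r → V (h s + y, s) ≤ c) →
      |f k s - h s| + (L + 1) * (1 / ((k : ℝ) + 1)) < r → v k s ≤ c := by
    intro k s c r hs hc hr
    obtain ⟨H, hH, hvs⟩ := hst k s hs
    have hae := hsample k s r hr H hH (fun x => V (x, s) ≤ c) hc
    have := intervalIntegral.integral_mono_ae_restrict (hpos k).le (hi k s H)
      (intervalIntegrable_const (c := c)) (by
        rw [← restrict_Ioc_eq_restrict_Icc]
        exact (ae_restrict_iff' measurableSet_Ioc).mpr hae)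
    rw [intervalIntegral.integral_const, sub_zero, smul_eq_mul] at this
    rw [hvs, inv_mul_le_iff₀ (hpos k)]
    exact this
  have havg' : ∀ (k : ℕ) s c r, t₀ ≤ s → (∀ᵐ y, |y| < r → -V (h s + y, s) ≤ c) →
      |-f k s - -h s| + (L + 1) * (1 / ((k : ℝ) + 1)) < r → -v k s ≤ c := by
    intro k s c r hs hc hr
    obtain ⟨H, hH, hvs⟩ := hst k s hs
    rw [neg_sub_neg, abs_sub_comm] at hr
    have hae := hsample k s r hr H hH (fun x => -V (x, s) ≤ c) hc
    have := intervalIntegral.integral_mono_ae_restrict (hpos k).le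
      (intervalIntegrable_const (c := -c)) (hi k s H) (by
        rw [← restrict_Ioc_eq_restrict_Icc]
        refine (ae_restrict_iff' measurableSet_Ioc).mpr ?_
        filter_upwards [hae] with y hy hyI
        linarith [hy hyI])
    rw [intervalIntegral.integral_const, sub_zero, smul_eq_mul] at this
    have h2 : -c ≤ v k s := by
      rw [hvs, le_inv_mul_iff₀ (hpos k)]
      exact this
    linarith
  have up := ae_deriv_le_of_approx hL (t₀ := t₀) hWm hvm hvb hfv hunif he havg
  have lo := ae_deriv_le_of_approx (h := fun t => -h t) (f := fun k t => -f k t)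
    (v := fun k t => -v k t) (W := fun p => -V (h p.1 + p.2, p.1)) hL.neg (t₀ := t₀) hWm.neg
    (fun k => (hvm k).neg) (fun k s => by simpa using hvb k s)
    (fun k a b => by rw [intervalIntegral.integral_neg, ← hfv]; ring)
    (fun a b r hr => by
      filter_upwards [hunif a b r hr] with k hk t ht
      rw [neg_sub_neg, abs_sub_comm]
      exact hk t ht) he havg'
  filter_upwards [up, lo] with t h1 h2 ht r c hr
  refine ⟨h1 ht r c hr, fun hc => ?_⟩
  have := h2 ht r (-c) hr (by filter_upwards [hc] with y hy hyr; linarith [hy hyr])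
  rw [deriv.fun_neg] at this
  linarith

/-! ### One-sided essential limits in space -/

/-- `p` is the essential limit of `u(x + y, t)` as `y ↓ 0`. -/
def EssRightLim {n : ℕ} (u : ℝ × ℝ → State n) (x t : ℝ) (p : State n) : Prop :=
  ∀ ε : ℝ, 0 < ε → ∃ r : ℝ, 0 < r ∧ ∀ᵐ y, y ∈ Ioo 0 r → dist (u (x + y, t)) p ≤ ε

/-- `p` is the essential limit of `u(x + y, t)` as `y ↑ 0`. -/
def EssLeftLim {n : ℕ} (u : ℝ × ℝ → State n) (x t : ℝ) (p : State n) : Prop :=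
  ∀ ε : ℝ, 0 < ε → ∃ r : ℝ, 0 < r ∧ ∀ᵐ y, y ∈ Ioo (-r) 0 → dist (u (x + y, t)) p ≤ ε

section EssLim

variable {n : ℕ} {u : ℝ × ℝ → State n} {x t : ℝ} {p q : State n}

theorem exists_mem_of_ae_imp {s : Set ℝ} (hs : volume s ≠ 0) {P : ℝ → Prop}
    (h : ∀ᵐ y, y ∈ s → P y) : ∃ y ∈ s, P y := by
  by_contra! hne
  apply hs
  refine measure_mono_null (fun y hy => ?_) (ae_iff.mp h)
  simpa using ⟨hy, hne y hy⟩

theorem EssRightLim.mem_of_isClosed (hp : EssRightLim u x t p) {C : Set (State n)}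
    (hC : IsClosed C) {r : ℝ} (hr : 0 < r) (h : ∀ᵐ y, |y| < r → u (x + y, t) ∈ C) : p ∈ C := by
  rw [← hC.closure_eq, Metric.mem_closure_iff]
  intro ε hε
  obtain ⟨s, hs, hsp⟩ := hp (ε / 2) (by positivity)
  have hvol : volume (Ioo 0 (min r s)) ≠ 0 := by simp [hr, hs]
  obtain ⟨y, hy, h1, h2⟩ := exists_mem_of_ae_imp hvol
    (P := fun y => u (x + y, t) ∈ C ∧ dist (u (x + y, t)) p ≤ ε / 2) (by
      filter_upwards [h, hsp] with y h1 h2 hy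
      have := lt_min_iff.mp hy.2
      exact ⟨h1 (by rw [abs_of_pos hy.1]; exact this.1), h2 ⟨hy.1, this.2⟩⟩)
  exact ⟨_, h1, by rw [dist_comm]; linarith⟩

/-- The reflection of the `x`-axis exchanges left and right limits. -/
theorem essLeftLim_iff_reflect :
    EssLeftLim u x t p ↔ EssRightLim (fun z => u (-z.1, z.2)) (-x) t p := by
  constructor
  · intro h ε hε
    obtain ⟨r, hr, h⟩ := h ε hε
    refine ⟨r, hr, ?_⟩
    have := (Measure.measurePreserving_neg (volume : Measure ℝ)).quasiMeasurePreserving.ae h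
    filter_upwards [this] with y hy hyI
    have := hy ⟨by linarith [hyI.2], by linarith [hyI.1]⟩
    simpa [add_comm] using this
  · intro h ε hε
    obtain ⟨r, hr, h⟩ := h ε hε
    refine ⟨r, hr, ?_⟩
    have := (Measure.measurePreserving_neg (volume : Measure ℝ)).quasiMeasurePreserving.ae h
    filter_upwards [this] with y hy hyI
    have := hy ⟨by linarith [hyI.2], by linarith [hyI.1]⟩
    simpa [add_comm] using this

theorem EssRightLim.unique (hp : EssRightLim u x t p) (hq : EssRightLim u x t q) : p = q := by
  rw [← dist_le_zero]
  apply le_of_forall_pos_le_add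
  intro ε hε
  obtain ⟨r, hr, h1⟩ := hp (ε / 2) (by positivity)
  obtain ⟨s, hs, h2⟩ := hq (ε / 2) (by positivity)
  have hvol : volume (Ioo 0 (min r s)) ≠ 0 := by simp [hr, hs]
  obtain ⟨y, -, h1, h2⟩ := exists_mem_of_ae_imp hvol
    (P := fun y => dist (u (x + y, t)) p ≤ ε / 2 ∧ dist (u (x + y, t)) q ≤ ε / 2) (by
      filter_upwards [h1, h2] with y h1 h2 hy
      have := lt_min_iff.mp hy.2
      exact ⟨h1 ⟨hy.1, this.1⟩, h2 ⟨hy.1, this.2⟩⟩)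
  have := dist_triangle_left p q (u (x + y, t))
  linarith

theorem EssLeftLim.unique (hp : EssLeftLim u x t p) (hq : EssLeftLim u x t q) : p = q :=
  (essLeftLim_iff_reflect.mp hp).unique (essLeftLim_iff_reflect.mp hq)

/-- A property which holds near the two one-sided limits holds on a neighbourhood of `x`. -/
theorem ae_of_essLim {K : Set (State n)} (hK : ∀ z, u z ∈ K) (hp : EssRightLim u x t p)
    (hq : EssLeftLim u x t q) {P : State n → Prop}
    (h1 : ∃ η > 0, ∀ w ∈ K, dist w p ≤ η → P w) (h2 : ∃ η > 0, ∀ w ∈ K, dist w q ≤ η → P w) :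
    ∃ r > 0, ∀ᵐ y, |y| < r → P (u (x + y, t)) := by
  obtain ⟨η₁, hη₁, h1⟩ := h1
  obtain ⟨η₂, hη₂, h2⟩ := h2
  obtain ⟨r, hr, hr'⟩ := hp η₁ hη₁
  obtain ⟨s, hs, hs'⟩ := hq η₂ hη₂
  refine ⟨min r s, lt_min hr hs, ?_⟩
  filter_upwards [hr', hs', compl_mem_ae_iff.mpr (measure_singleton (0 : ℝ))] with y h3 h4 h0 hy
  obtain ⟨h5, h6⟩ := lt_min_iff.mp hy
  rw [abs_lt] at h5 h6
  rcases lt_trichotomy y 0 with h | h | h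
  · exact h2 _ (hK _) (h4 ⟨h6.1, h⟩)
  · exact absurd h h0
  · exact h1 _ (hK _) (h3 ⟨h, h5.2⟩)

end EssLim

/-! ### The shift problem -/

/-- The data of the construction of a shift. The curve `h` sought in the `(x, t)`-plane moves with
speed `lam(u)` or `-M`; the first choice is allowed where `0 ≤ G(u)`, the second where `G(u) ≤ δ`,
so that there is an overlap `0 ≤ G(u) ≤ δ`. The relation `disc m p v` says that a discontinuity
with left state `m`, right state `p` and speed `v` is admissible. -/
structure ShiftData (n : ℕ) where
  K : Set (State n)
  isCompact_K : IsCompact K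
  G : State n → ℝ
  lam : State n → ℝ
  continuousOn_G : ContinuousOn G K
  continuousOn_lam : ContinuousOn lam (K ∩ {w | 0 ≤ G w})
  M : ℝ≥0
  abs_lam_lt : ∀ w ∈ K, |lam w| < M
  δ : ℝ
  δ_pos : 0 < δ
  u : ℝ × ℝ → State n
  measurable_u : Measurable u
  u_mem : ∀ z, u z ∈ K
  I : Set ℝ
  isOpen_I : IsOpen I
  I_pos : ∀ t ∈ I, 0 < t
  I_down : ∀ t ∈ I, Ioo 0 t ⊆ I
  disc : State n → State n → ℝ → Prop
  lam_lt_of_disc : ∀ m p v, disc m p v → lam p < v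
  traces : ∀ (L : ℝ≥0) (h : ℝ → ℝ), LipschitzWith L h → ∀ᵐ t, t ∈ I → ∃ p ∈ K, ∃ m ∈ K,
    EssRightLim u (h t) t p ∧ EssLeftLim u (h t) t m ∧ (p ≠ m → disc m p (deriv h t))

namespace ShiftData

variable {n : ℕ} (D : ShiftData n)

/-- The velocity `v` is allowed at `(x, t)`: either there is an admissible discontinuity which is
not faster than `lam` of its left state `m`, with `0 ≤ G(m)`, or there is none and `v` is one of
the two speeds `lam(p)` and `-M`, according to the value of `G(p)`. -/
def Good (x t v : ℝ) : Prop :=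
  ∃ p ∈ D.K, ∃ m ∈ D.K, EssRightLim D.u x t p ∧ EssLeftLim D.u x t m ∧
    ((p ≠ m ∧ D.disc m p v ∧ 0 ≤ D.G m ∧ v ≤ D.lam m) ∨
      (p = m ∧ 0 ≤ D.G p ∧ v = D.lam p) ∨ (p = m ∧ D.G p ≤ D.δ ∧ v = -D.M))

/-- The solution is continuous at `(x, t)`, with `G = θ` there, and `v` lies strictly between the
two speeds. -/
def BadAt (θ x t v : ℝ) : Prop :=
  ∃ p ∈ D.K, EssRightLim D.u x t p ∧ EssLeftLim D.u x t p ∧ D.G p = θ ∧ -D.M < v ∧ v < D.lam p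

/-- The exceptional velocities: intermediate speeds in the interior of the overlap region. -/
def Bad (x t v : ℝ) : Prop := ∃ θ, 0 < θ ∧ θ < D.δ ∧ D.BadAt θ x t v

/-- A curve all of whose velocities are allowed or exceptional. -/
structure IsPath (h : ℝ → ℝ) : Prop where
  lip : LipschitzWith D.M h
  ae : ∀ᵐ t, t ∈ D.I → D.Good (h t) t (deriv h t) ∨ D.Bad (h t) t (deriv h t)

/-- The times at which a curve has an exceptional velocity. -/
def badSet (h : ℝ → ℝ) : Set ℝ := {t | t ∈ D.I ∧ D.Bad (h t) t (deriv h t)}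

variable {D}

theorem Good.not_bad {x t v : ℝ} (hg : D.Good x t v) : ¬ D.Bad x t v := by
  rintro ⟨θ, -, -, q, -, hr, hl, -, h1, h2⟩
  obtain ⟨p, -, m, -, hp, hm, h⟩ := hg
  obtain rfl := hr.unique hp
  obtain rfl := hl.unique hm
  rcases h with ⟨h, -⟩ | ⟨-, -, h⟩ | ⟨-, -, h⟩
  · exact h rfl
  · exact h2.ne h
  · exact h1.ne' h

variable (D)

open Classical in
/-- The discontinuous velocity with switching level `θ`. -/
noncomputable def vel (θ : ℝ) (w : State n) : ℝ :=
  (D.K ∩ {w | θ ≤ D.G w}).piecewise D.lam (fun _ => -(D.M : ℝ)) w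

theorem isClosed_level (θ : ℝ) : IsClosed (D.K ∩ {w | θ ≤ D.G w}) := by
  have := D.continuousOn_G.preimage_isClosed_of_isClosed D.isCompact_K.isClosed
    (isClosed_Ici (a := θ))
  exact this

variable {D}

theorem vel_of_le {θ : ℝ} {w : State n} (hw : w ∈ D.K) (h : θ ≤ D.G w) : D.vel θ w = D.lam w :=
  if_pos ⟨hw, h⟩

theorem vel_of_lt {θ : ℝ} {w : State n} (h : D.G w < θ) : D.vel θ w = -D.M :=
  if_neg fun hw => h.not_ge hw.2

theorem neg_M_lt_lam {w : State n} (hw : w ∈ D.K) : -D.M < D.lam w :=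
  (abs_lt.mp (D.abs_lam_lt w hw)).1

theorem abs_vel_le (θ : ℝ) (w : State n) : |D.vel θ w| ≤ D.M := by
  by_cases h : w ∈ D.K ∩ {w | θ ≤ D.G w}
  · rw [vel_of_le h.1 h.2]
    exact (D.abs_lam_lt w h.1).le
  · rw [vel, Set.piecewise, if_neg h]
    simp

theorem measurable_vel {θ : ℝ} (hθ : 0 ≤ θ) : Measurable (D.vel θ) := by
  classical
  apply ContinuousOn.measurable_piecewise _ continuousOn_const (D.isClosed_level θ).measurableSet
  exact D.continuousOn_lam.mono fun w hw => ⟨hw.1, hθ.trans hw.2⟩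

theorem exists_G_near {p : State n} (hp : p ∈ D.K) {ε : ℝ} (hε : 0 < ε) :
    ∃ η > 0, ∀ w ∈ D.K, dist w p ≤ η → |D.G w - D.G p| < ε := by
  obtain ⟨η, hη, h⟩ := Metric.continuousOn_iff.mp D.continuousOn_G p hp ε hε
  exact ⟨η / 2, by positivity, fun w hw hd => h w hw (by linarith)⟩

theorem exists_lam_near {p : State n} (hp : p ∈ D.K) (hG : 0 ≤ D.G p) {ε : ℝ} (hε : 0 < ε) :
    ∃ η > 0, ∀ w ∈ D.K, 0 ≤ D.G w → dist w p ≤ η → |D.lam w - D.lam p| < ε := by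
  obtain ⟨η, hη, h⟩ := Metric.continuousOn_iff.mp D.continuousOn_lam p ⟨hp, hG⟩ ε hε
  exact ⟨η / 2, by positivity, fun w hw hw' hd => h w ⟨hw, hw'⟩ (by linarith)⟩

theorem exists_vel_eq {θ : ℝ} {p : State n} (hp : p ∈ D.K) (h : D.G p < θ) :
    ∃ η > 0, ∀ w ∈ D.K, dist w p ≤ η → D.vel θ w = -D.M := by
  obtain ⟨η, hη, h1⟩ := exists_G_near hp (sub_pos.mpr h)
  refine ⟨η, hη, fun w hw hd => vel_of_lt ?_⟩
  linarith [(abs_lt.mp (h1 w hw hd)).2]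

theorem exists_vel_le {θ : ℝ} (hθ : 0 ≤ θ) {p : State n} (hp : p ∈ D.K) {ε : ℝ} (hε : 0 < ε) :
    ∃ η > 0, ∀ w ∈ D.K, dist w p ≤ η → D.vel θ w ≤ D.lam p + ε := by
  have hM := neg_M_lt_lam hp
  rcases lt_or_ge (D.G p) θ with h | h
  · obtain ⟨η, hη, h1⟩ := exists_vel_eq hp h
    refine ⟨η, hη, fun w hw hd => ?_⟩
    rw [h1 w hw hd]
    linarith
  · obtain ⟨η, hη, h1⟩ := exists_lam_near hp (hθ.trans h) hε
    refine ⟨η, hη, fun w hw hd => ?_⟩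
    rcases lt_or_ge (D.G w) θ with hw' | hw'
    · rw [vel_of_lt hw']
      linarith
    · rw [vel_of_le hw hw']
      linarith [(abs_lt.mp (h1 w hw (hθ.trans hw') hd)).2]

theorem exists_le_vel {θ : ℝ} (hθ : 0 ≤ θ) {p : State n} (hp : p ∈ D.K) (h : θ < D.G p) {ε : ℝ}
    (hε : 0 < ε) :
    ∃ η > 0, ∀ w ∈ D.K, dist w p ≤ η → D.lam p - ε ≤ D.vel θ w := by
  obtain ⟨η, hη, h1⟩ := exists_G_near hp (sub_pos.mpr h)
  obtain ⟨η', hη', h2⟩ := exists_lam_near hp (hθ.trans h.le) hε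
  refine ⟨min η η', lt_min hη hη', fun w hw hd => ?_⟩
  have hGw : θ ≤ D.G w := by linarith [(abs_lt.mp (h1 w hw (hd.trans (min_le_left _ _)))).1]
  rw [vel_of_le hw hGw]
  linarith [(abs_lt.mp (h2 w hw (hθ.trans hGw) (hd.trans (min_le_right _ _)))).1]

/-- The upper Filippov bound at a discontinuity: since the discontinuity is faster than `lam` of
its right state, it can only be allowed by its left state. -/
theorem le_lam_of_upper {θ : ℝ} (hθ : 0 ≤ θ) {x t v : ℝ} {p m : State n} (hp : p ∈ D.K)
    (hm : m ∈ D.K) (hr : EssRightLim D.u x t p) (hl : EssLeftLim D.u x t m)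
    (hd : D.lam p < v)
    (hup : ∀ r c : ℝ, 0 < r → (∀ᵐ y, |y| < r → D.vel θ (D.u (x + y, t)) ≤ c) → v ≤ c) :
    θ ≤ D.G m ∧ v ≤ D.lam m := by
  have hθm : θ ≤ D.G m := by
    by_contra! hlt
    refine hd.not_ge (le_of_forall_pos_le_add fun ε hε => ?_)
    obtain ⟨r, hr0, hrr⟩ := ae_of_essLim D.u_mem hr hl (P := fun w => D.vel θ w ≤ D.lam p + ε)
      (exists_vel_le hθ hp hε) (by
        obtain ⟨η, hη, h1⟩ := exists_vel_eq hm hlt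
        refine ⟨η, hη, fun w hw hd => ?_⟩
        rw [h1 w hw hd]
        linarith [neg_M_lt_lam hp])
    exact hup r _ hr0 hrr
  refine ⟨hθm, ?_⟩
  have hmax : v ≤ max (D.lam p) (D.lam m) := by
    refine le_of_forall_pos_le_add fun ε hε => ?_
    have hle1 := le_max_left (D.lam p) (D.lam m)
    have hle2 := le_max_right (D.lam p) (D.lam m)
    obtain ⟨r, hr0, hrr⟩ := ae_of_essLim D.u_mem hr hl
      (P := fun w => D.vel θ w ≤ max (D.lam p) (D.lam m) + ε) (by
        obtain ⟨η, hη, h1⟩ := exists_vel_le hθ hp hε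
        exact ⟨η, hη, fun w hw hd => (h1 w hw hd).trans (by linarith)⟩) (by
        obtain ⟨η, hη, h1⟩ := exists_vel_le hθ hm hε
        exact ⟨η, hη, fun w hw hd => (h1 w hw hd).trans (by linarith)⟩)
    exact hup r _ hr0 hrr
  rcases le_max_iff.mp hmax with h | h
  · exact absurd h hd.not_ge
  · exact h

theorem le_lam_of_upper_of_eq {θ : ℝ} (hθ : 0 ≤ θ) {x t v : ℝ} {p : State n} (hp : p ∈ D.K)
    (hr : EssRightLim D.u x t p) (hl : EssLeftLim D.u x t p)
    (hup : ∀ r c : ℝ, 0 < r → (∀ᵐ y, |y| < r → D.vel θ (D.u (x + y, t)) ≤ c) → v ≤ c) :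
    v ≤ D.lam p ∧ (D.G p < θ → v ≤ -D.M) := by
  constructor
  · refine le_of_forall_pos_le_add fun ε hε => ?_
    obtain ⟨r, hr0, hrr⟩ := ae_of_essLim D.u_mem hr hl (P := fun w => D.vel θ w ≤ D.lam p + ε)
      (exists_vel_le hθ hp hε) (exists_vel_le hθ hp hε)
    exact hup r _ hr0 hrr
  · intro hlt
    obtain ⟨r, hr0, hrr⟩ := ae_of_essLim D.u_mem hr hl (exists_vel_eq hp hlt)
      (exists_vel_eq hp hlt)
    exact hup r _ hr0 (by filter_upwards [hrr] with y h1 h2 using (h1 h2).le)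

/-- A Filippov velocity for the switching level `θ` is allowed, or is exceptional with `G = θ`. -/
theorem good_or_badAt {θ : ℝ} (hθ : 0 < θ) (hθδ : θ < D.δ) {x t v : ℝ} {p m : State n}
    (hp : p ∈ D.K) (hm : m ∈ D.K) (hr : EssRightLim D.u x t p) (hl : EssLeftLim D.u x t m)
    (hd : p ≠ m → D.disc m p v) (hv : -D.M ≤ v)
    (hF : IsFilippovVelocity (fun z => D.vel θ (D.u z)) x t v) :
    D.Good x t v ∨ D.BadAt θ x t v := by
  have hup := fun r c hr => (hF r c hr).1
  by_cases hpm : p = m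
  · subst hpm
    obtain ⟨h1, h2⟩ := le_lam_of_upper_of_eq hθ.le hp hr hl hup
    rcases lt_trichotomy (D.G p) θ with hG | hG | hG
    · exact Or.inl ⟨p, hp, p, hm, hr, hl, Or.inr (Or.inr ⟨rfl, by linarith,
        le_antisymm (h2 hG) hv⟩)⟩
    · rcases hv.eq_or_lt with h3 | h3
      · exact Or.inl ⟨p, hp, p, hm, hr, hl, Or.inr (Or.inr ⟨rfl, by linarith, h3.symm⟩)⟩
      · rcases h1.eq_or_lt with h4 | h4
        · exact Or.inl ⟨p, hp, p, hm, hr, hl, Or.inr (Or.inl ⟨rfl, by linarith, h4⟩)⟩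
        · exact Or.inr ⟨p, hp, hr, hl, hG, h3, h4⟩
    · refine Or.inl ⟨p, hp, p, hm, hr, hl, Or.inr (Or.inl ⟨rfl, by linarith, h1.antisymm ?_⟩)⟩
      refine le_of_forall_pos_le_add fun ε hε => ?_
      obtain ⟨r, hr0, hrr⟩ := ae_of_essLim D.u_mem hr hl (P := fun w => D.lam p - ε ≤ D.vel θ w)
        (exists_le_vel hθ.le hp hG hε) (exists_le_vel hθ.le hp hG hε)
      linarith [(hF r _ hr0).2 hrr]
  · have hdisc := hd hpm
    obtain ⟨h1, h2⟩ := le_lam_of_upper hθ.le hp hm hr hl (D.lam_lt_of_disc _ _ _ hdisc) hup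
    exact Or.inl ⟨p, hp, m, hm, hr, hl, Or.inl ⟨hpm, hdisc, hθ.le.trans h1, h2⟩⟩

/-- Filippov curves for the switching level `θ`, issuing from any point. -/
theorem exists_filippov_path {θ : ℝ} (hθ : 0 < θ) (hθδ : θ < D.δ) (t₀ x₀ : ℝ) :
    ∃ h : ℝ → ℝ, LipschitzWith D.M h ∧ h t₀ = x₀ ∧
      (∀ᵐ t, t₀ < t → IsFilippovVelocity (fun z => D.vel θ (D.u z)) (h t) t (deriv h t)) ∧
      ∀ᵐ t, t ∈ D.I → t₀ < t → D.Good (h t) t (deriv h t) ∨ D.BadAt θ (h t) t (deriv h t) := by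
  obtain ⟨h, hL, h0, hF⟩ := exists_filippov ((measurable_vel hθ.le).comp D.measurable_u)
    (fun z => abs_vel_le θ (D.u z)) t₀ x₀
  refine ⟨h, hL, h0, hF, ?_⟩
  filter_upwards [hF, D.traces _ h hL] with t h1 h2 htI ht
  obtain ⟨p, hp, m, hm, hr, hl, hd⟩ := h2 htI
  exact good_or_badAt hθ hθδ hp hm hr hl hd (neg_le_of_abs_le (hL.abs_deriv_le t)) (h1 ht)

end ShiftData

/-- The last contact point of a continuous function with zero. -/
theorem exists_last_contact {φ : ℝ → ℝ} (hφ : Continuous φ) {a b : ℝ} (hab : a ≤ b)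
    (ha : φ a ≤ 0) (hb : 0 < φ b) :
    ∃ s, a ≤ s ∧ s < b ∧ φ s = 0 ∧ ∀ τ, s < τ → τ ≤ b → 0 < φ τ := by
  have hcomp : IsCompact (Icc a b ∩ {τ | φ τ ≤ 0}) :=
    isCompact_Icc.inter_right (isClosed_le hφ continuous_const)
  obtain ⟨s, hs, hmax⟩ := hcomp.exists_isGreatest ⟨a, ⟨le_rfl, hab⟩, ha⟩
  have hpos : ∀ τ, s < τ → τ ≤ b → 0 < φ τ := by
    intro τ h1 h2
    by_contra! h3
    exact h1.not_ge (hmax ⟨⟨hs.1.1.trans h1.le, h2⟩, h3⟩)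
  have hsb : s < b := lt_of_le_of_ne hs.1.2 fun h => by
    have := hs.2
    rw [h] at this
    exact hb.not_ge this
  refine ⟨s, hs.1.1, hsb, ?_, hpos⟩
  obtain ⟨τ, hτ, h0⟩ := intermediate_value_Icc hsb.le hφ.continuousOn
    (show (0 : ℝ) ∈ Icc (φ s) (φ b) from ⟨hs.2, hb.le⟩)
  have : τ ≤ s := hmax ⟨⟨hs.1.1.trans hτ.1, hτ.2⟩, h0.le⟩
  rw [← le_antisymm this hτ.1]
  exact h0

theorem exists_first_contact {φ : ℝ → ℝ} (hφ : Continuous φ) {a b : ℝ} (hab : a ≤ b)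
    (ha : 0 < φ a) (hb : φ b ≤ 0) :
    ∃ s, a < s ∧ s ≤ b ∧ φ s = 0 ∧ ∀ τ, a ≤ τ → τ < s → 0 < φ τ := by
  obtain ⟨s, h1, h2, h3, h4⟩ := exists_last_contact (φ := fun t => φ (-t))
    (hφ.comp continuous_neg) (neg_le_neg hab) (by simpa using hb) (by simpa using ha)
  refine ⟨-s, by linarith, by linarith, h3, fun τ h5 h6 => ?_⟩
  simpa using h4 (-τ) (by linarith) (by linarith)

namespace ShiftData

variable {n : ℕ} {D : ShiftData n}

/-- A first curve, which stays to the left of a barrier `b`: the velocity is replaced by `-M` to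
the right of the barrier. On the set of times at which the curve touches the barrier the solution
has an admissible discontinuity. -/
theorem exists_path_le_barrier {L : ℝ≥0} {b : ℝ → ℝ} (hb : LipschitzWith L b) (hb0 : 0 ≤ b 0)
    (hbM : ∀ᵐ t, t ∈ D.I → -D.M < deriv b t)
    (hbl : ∀ᵐ t, t ∈ D.I → ∀ p ∈ D.K, EssRightLim D.u (b t) t p → EssLeftLim D.u (b t) t p →
      D.lam p < deriv b t) :
    ∃ h, D.IsPath h ∧ h 0 = 0 ∧ ∀ t ∈ D.I, h t ≤ b t := by
  classical
  have hδ := D.δ_pos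
  set θ := D.δ / 2 with hθdef
  have hθ : 0 < θ := by positivity
  have hθδ : θ < D.δ := by linarith
  set V : ℝ × ℝ → ℝ := {z : ℝ × ℝ | z.1 ≤ b z.2}.piecewise (fun z => D.vel θ (D.u z))
    (fun _ => -(D.M : ℝ)) with hV
  have hVm : Measurable V := by
    apply Measurable.piecewise
    · have := hb.continuous.measurable
      exact measurableSet_le (by fun_prop) (by fun_prop)
    · exact (measurable_vel hθ.le).comp D.measurable_u
    · exact measurable_const
  have hV1 : ∀ x t, x ≤ b t → V (x, t) = D.vel θ (D.u (x, t)) := fun x t h =>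
    piecewise_eq_of_mem _ _ _ h
  have hV2 : ∀ x t, b t < x → V (x, t) = -D.M := fun x t h =>
    piecewise_eq_of_notMem _ _ _ (by simpa using h)
  have hVle : ∀ z, V z ≤ D.vel θ (D.u z) := by
    rintro ⟨x, t⟩
    rcases le_or_gt x (b t) with h | h
    · rw [hV1 _ _ h]
    · rw [hV2 _ _ h]
      exact neg_le_of_abs_le (abs_vel_le _ _)
  have hVb : ∀ z, |V z| ≤ D.M := by
    rintro ⟨x, t⟩
    rcases le_or_gt x (b t) with h | h
    · rw [hV1 _ _ h]
      exact abs_vel_le _ _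
    · rw [hV2 _ _ h]
      simp
  obtain ⟨h, hL, h0, hF⟩ := exists_filippov hVm hVb 0 0
  have hle : ∀ t ∈ D.I, h t ≤ b t := by
    intro t ht
    by_contra! hlt
    obtain ⟨s, hs0, hst, hs, hpos⟩ := exists_last_contact (φ := fun τ => h τ - b τ)
      (hL.continuous.sub hb.continuous) (D.I_pos t ht).le (by simpa [h0] using hb0)
      (sub_pos.mpr hlt)
    have hLip : LipschitzWith (L + D.M) (fun τ => b τ - h τ) := hb.sub hL
    have := hLip.sub_ge_of_deriv_ge (c := 0) hst.le MeasurableSet.univ (by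
      filter_upwards [hF, hbM, hb.ae_differentiableAt_real, hL.ae_differentiableAt_real]
        with τ h1 h2 h3 h4 hτ _
      rw [deriv_fun_sub h3 h4]
      have h5 := h2 (D.I_down t ht ⟨by linarith [hτ.1], hτ.2⟩)
      have hgap := hpos τ hτ.1 hτ.2.le
      have h6 := (h1 (by linarith [hτ.1]) (h τ - b τ) (-D.M) hgap).1 (Eventually.of_forall
        fun y hy => (hV2 _ _ (by linarith [(abs_lt.mp hy).1])).le)
      linarith)
    simp at this
    linarith
  refine ⟨h, ⟨hL, ?_⟩, h0, hle⟩
  filter_upwards [hF, hbl, D.traces _ h hL, ae_deriv_eq_of_eq h b, hb.ae_differentiableAt_real,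
    hL.ae_differentiableAt_real] with t h1 h2 h3 h4 h5 h6 htI
  have htF := h1 (D.I_pos t htI)
  obtain ⟨p, hp, m, hm, hr, hl, hd⟩ := h3 htI
  have hv : -D.M ≤ deriv h t := neg_le_of_abs_le (hL.abs_deriv_le t)
  rcases (hle t htI).eq_or_lt with heq | hlt
  · have hup : ∀ r c : ℝ, 0 < r → (∀ᵐ y, |y| < r → D.vel θ (D.u (h t + y, t)) ≤ c) →
        deriv h t ≤ c := fun r c hr0 hc => (htF r c hr0).1 (by
      filter_upwards [hc] with y hy hyr using (hVle _).trans (hy hyr))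
    by_cases hpm : p = m
    · subst hpm
      have h7 := (le_lam_of_upper_of_eq hθ.le hp hr hl hup).1
      rw [heq] at hr hl
      have h8 := h2 htI p hp hr hl
      rw [h4 heq h6 h5] at h7
      exact absurd h8 h7.not_gt
    · have hdisc := hd hpm
      obtain ⟨h7, h8⟩ := le_lam_of_upper hθ.le hp hm hr hl (D.lam_lt_of_disc _ _ _ hdisc) hup
      exact Or.inl ⟨p, hp, m, hm, hr, hl, Or.inl ⟨hpm, hdisc, hθ.le.trans h7, h8⟩⟩
  · have hFv : IsFilippovVelocity (fun z => D.vel θ (D.u z)) (h t) t (deriv h t) := by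
      intro r c hr0
      have hloc : ∀ y, |y| < min r (b t - h t) → |y| < r ∧
          V (h t + y, t) = D.vel θ (D.u (h t + y, t)) := by
        intro y hy
        obtain ⟨hy1, hy2⟩ := lt_min_iff.mp hy
        exact ⟨hy1, hV1 _ _ (by linarith [(abs_lt.mp hy2).2])⟩
      obtain ⟨h7, h8⟩ := htF (min r (b t - h t)) c (lt_min hr0 (by linarith))
      constructor
      · intro hc
        apply h7
        filter_upwards [hc] with y hy hyr
        rw [(hloc y hyr).2]
        exact hy (hloc y hyr).1
      · intro hc
        apply h8
        filter_upwards [hc] with y hy hyr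
        rw [(hloc y hyr).2]
        exact hy (hloc y hyr).1
    rcases good_or_badAt hθ hθδ hp hm hr hl hd hv hFv with h7 | h7
    · exact Or.inl h7
    · exact Or.inr ⟨θ, hθ, hθδ, h7⟩

end ShiftData

/-! ### Removing the exceptional velocities -/

/-- The curve which follows `f` up to time `c` and `g` afterwards. -/
noncomputable def glue (c : ℝ) (f g : ℝ → ℝ) (t : ℝ) : ℝ := if t ≤ c then f t else g t

theorem glue_of_le {c t : ℝ} {f g : ℝ → ℝ} (h : t ≤ c) : glue c f g t = f t := if_pos h

theorem glue_of_gt {c t : ℝ} {f g : ℝ → ℝ} (h : c < t) : glue c f g t = g t := if_neg h.not_ge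

theorem deriv_glue_of_lt {c t : ℝ} {f g : ℝ → ℝ} (h : t < c) :
    deriv (glue c f g) t = deriv f t :=
  EventuallyEq.deriv_eq (by
    filter_upwards [Iio_mem_nhds h] with s hs using glue_of_le (le_of_lt hs))

theorem deriv_glue_of_gt {c t : ℝ} {f g : ℝ → ℝ} (h : c < t) :
    deriv (glue c f g) t = deriv g t :=
  EventuallyEq.deriv_eq (by
    filter_upwards [Ioi_mem_nhds h] with s hs using glue_of_gt hs)

theorem LipschitzWith.glue {L : ℝ≥0} {c : ℝ} {f g : ℝ → ℝ} (hf : LipschitzWith L f)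
    (hg : LipschitzWith L g) (h : f c = g c) : LipschitzWith L (glue c f g) := by
  have key : ∀ s t, s ≤ t → |_root_.glue c f g s - _root_.glue c f g t| ≤ L * |s - t| := by
    intro s t hst
    rcases le_or_gt t c with ht | ht
    · rw [glue_of_le ht, glue_of_le (hst.trans ht)]
      exact hf.abs_sub_le_mul s t
    · rcases le_or_gt s c with hs | hs
      · rw [glue_of_le hs, glue_of_gt ht]
        have h1 := hf.abs_sub_le_mul s c
        have h2 := hg.abs_sub_le_mul c t
        rw [abs_of_nonpos (sub_nonpos.mpr hs)] at h1
        rw [abs_of_nonpos (sub_nonpos.mpr ht.le)] at h2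
        rw [abs_of_nonpos (sub_nonpos.mpr hst)]
        have h3 := abs_sub_le (f s) (f c) (g t)
        rw [h] at h1 h3
        linarith
      · rw [glue_of_gt hs, glue_of_gt ht]
        exact hg.abs_sub_le_mul s t
  apply LipschitzWith.of_dist_le_mul
  intro s t
  rw [Real.dist_eq, Real.dist_eq]
  rcases le_total s t with hst | hst
  · exact key s t hst
  · rw [abs_sub_comm, abs_sub_comm s t]
    exact key t s hst

/-- A set of positive measure fills almost all of suitable short intervals. -/
theorem exists_interval_of_measure_ne_zero {E W : Set ℝ} (hEm : MeasurableSet E)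
    (hpos : volume E ≠ 0) (hW : IsOpen W) (hEW : E ⊆ W) {ε R : ℝ} (hε0 : 0 < ε) (hR : 0 < R) :
    ∃ x ρ, 0 < ρ ∧ ρ < R ∧ Icc (x - ρ) (x + ρ) ⊆ W ∧
      volume (Ioo (x - ρ) (x + ρ) \ E) ≤ ENNReal.ofReal (ε * (2 * ρ)) := by
  have hdens : ∃ x, x ∈ E ∧ Tendsto (fun ρ => volume (E ∩ closedBall x ρ) /
      volume (closedBall x ρ)) (𝓝[>] 0) (𝓝 1) := by
    by_contra! hne
    have h1 := Besicovitch.ae_tendsto_measure_inter_div (volume : Measure ℝ) E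
    rw [ae_restrict_iff' hEm] at h1
    have h2 : ∀ᵐ x : ℝ, x ∉ E := by
      filter_upwards [h1] with x hx hxE using hne x hxE (hx hxE)
    exact hpos (measure_eq_zero_iff_ae_notMem.mpr h2)
  obtain ⟨x, hxE, hx⟩ := hdens
  obtain ⟨ρ₀, hρ₀, hρW⟩ := Metric.isOpen_iff.mp hW x (hEW hxE)
  have hev1 : ∀ᶠ ρ in 𝓝[>] (0 : ℝ), ENNReal.ofReal (1 - ε) <
      volume (E ∩ closedBall x ρ) / volume (closedBall x ρ) := by
    apply hx.eventually (lt_mem_nhds _)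
    rw [ENNReal.ofReal_lt_one]
    linarith
  have hev2 : ∀ᶠ ρ in 𝓝[>] (0 : ℝ), ρ < min ρ₀ R :=
    (gt_mem_nhds (lt_min hρ₀ hR)).filter_mono nhdsWithin_le_nhds
  obtain ⟨ρ, hρ1, hρ2, hρ0 : 0 < ρ⟩ := (hev1.and (hev2.and self_mem_nhdsWithin)).exists
  obtain ⟨hρ3, hρ4⟩ := lt_min_iff.mp hρ2
  have hlen0 : 0 < 2 * ρ := by positivity
  refine ⟨x, ρ, hρ0, hρ4, ?_, ?_⟩
  · intro t ht
    apply hρW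
    rw [mem_ball, Real.dist_eq, abs_lt]
    constructor <;> linarith [ht.1, ht.2]
  · have hvol : volume (Icc (x - ρ) (x + ρ)) = ENNReal.ofReal (2 * ρ) := by
      rw [Real.volume_Icc]
      congr 1
      ring
    rw [Real.closedBall_eq_Icc, hvol] at hρ1
    have h1 : ENNReal.ofReal ((1 - ε) * (2 * ρ)) ≤ volume (E ∩ Icc (x - ρ) (x + ρ)) := by
      rw [ENNReal.ofReal_mul' hlen0.le]
      exact (ENNReal.mul_le_of_le_div hρ1.le)
    have h2 : volume (E ∩ Icc (x - ρ) (x + ρ)) + volume (Icc (x - ρ) (x + ρ) \ E) =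
        ENNReal.ofReal (2 * ρ) := by
      rw [← hvol, inter_comm]
      exact measure_inter_add_sdiff _ hEm
    refine (measure_mono (sdiff_subset_sdiff_left Ioo_subset_Icc_self)).trans ?_
    have h4 : ENNReal.ofReal (2 * ρ) ≤
        ENNReal.ofReal ((1 - ε) * (2 * ρ)) + ENNReal.ofReal (ε * (2 * ρ)) := by
      refine le_trans (ENNReal.ofReal_le_ofReal ?_) ENNReal.ofReal_add_le
      linarith
    have hfin : volume (E ∩ Icc (x - ρ) (x + ρ)) ≠ ⊤ := by
      refine ne_top_of_le_ne_top ?_ (measure_mono inter_subset_right)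
      rw [hvol]
      exact ENNReal.ofReal_ne_top
    rw [← h2] at h4
    exact (ENNReal.add_le_add_iff_left hfin).mp (h4.trans (add_le_add_left h1 _))

namespace ShiftData

variable {n : ℕ} {D : ShiftData n}

/-- The times in `W` at which a neighbourhood of the curve `h` lies in the set where the values of
`u` belong to the closed set `C`, and at which the velocity of `h` lies in `[p, q]`. -/
def tubeSet (D : ShiftData n) (W : Set ℝ) (h : ℝ → ℝ) (C : Set (State n)) (p q r : ℝ) : Set ℝ :=
  {t | t ∈ W ∧ p ≤ deriv h t ∧ deriv h t ≤ q ∧ ∀ᵐ y, |y| < r → D.u (h t + y, t) ∈ C}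

theorem measurableSet_tubeSet {W : Set ℝ} (hW : MeasurableSet W) {h : ℝ → ℝ} (hh : Continuous h)
    {C : Set (State n)} (hC : MeasurableSet C) (p q r : ℝ) :
    MeasurableSet (D.tubeSet W h C p q r) := by
  have h1 : MeasurableSet {z : ℝ × ℝ | |z.2| < r → D.u (h z.1 + z.2, z.1) ∈ C} := by
    apply MeasurableSet.imp
    · exact measurableSet_lt (by fun_prop) measurable_const
    · have := hh.measurable
      exact (D.measurable_u.comp (show Measurable fun z : ℝ × ℝ => (h z.1 + z.2, z.1) by
        fun_prop)) hC
  exact hW.inter ((measurableSet_le measurable_const (measurable_deriv h)).inter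
    ((measurableSet_le (measurable_deriv h) measurable_const).inter (measurableSet_ae_section h1)))

/-- The states of the overlap region with `G` between `α` and `β` and `lam` close to `l`. -/
def overlapSet (D : ShiftData n) (α β l ε : ℝ) : Set (State n) :=
  (D.K ∩ {w | α ≤ D.G w}) ∩ {w | D.G w ≤ β ∧ |D.lam w - l| ≤ ε}

theorem isClosed_overlapSet {α β l ε : ℝ} (hα : 0 ≤ α) : IsClosed (D.overlapSet α β l ε) := by
  have h1 : ContinuousOn (fun w => (D.G w, |D.lam w - l|)) (D.K ∩ {w | α ≤ D.G w}) := by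
    apply ContinuousOn.prodMk (D.continuousOn_G.mono inter_subset_left)
    apply ContinuousOn.abs
    exact (D.continuousOn_lam.mono fun w hw => ⟨hw.1, hα.trans hw.2⟩).sub continuousOn_const
  exact h1.preimage_isClosed_of_isClosed (D.isClosed_level α) (t := Iic β ×ˢ Iic ε)
    (isClosed_Iic.prod isClosed_Iic)

/-- Exceptional times belong to countably many tube sets. -/
theorem exists_tubeSet_of_bad {W : Set ℝ} {h : ℝ → ℝ} {t : ℝ} (htW : t ∈ W)
    (hbad : D.Bad (h t) t (deriv h t)) :
    ∃ α β l κ r : ℚ, 0 < α ∧ (β : ℝ) < D.δ ∧ 0 < κ ∧ 0 < r ∧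
      t ∈ D.tubeSet W h (D.overlapSet α β l (κ / 8)) (-D.M + κ) (l - κ) r := by
  obtain ⟨θ, hθ, hθδ, p, hp, hr, hl, hG, hv1, hv2⟩ := hbad
  obtain ⟨α, hα0, hα⟩ := exists_rat_btwn hθ
  obtain ⟨β, hβ, hβδ⟩ := exists_rat_btwn hθδ
  obtain ⟨κ, hκ0, hκ⟩ := exists_rat_btwn (show (0 : ℝ) < min (deriv h t + D.M)
    ((D.lam p - deriv h t) / 2) by
      apply lt_min <;> linarith)
  obtain ⟨hκ1, hκ2⟩ := lt_min_iff.mp hκ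
  obtain ⟨l, hl1, hl2⟩ := exists_rat_btwn (show D.lam p - κ / 16 < D.lam p by linarith)
  obtain ⟨η, hη, h1⟩ := exists_G_near hp (ε := min (θ - α) (β - θ)) (by
    apply lt_min <;> linarith)
  obtain ⟨η', hη', h2⟩ := exists_lam_near hp (by linarith) (ε := (κ : ℝ) / 16) (by linarith)
  have hnear : ∃ η > 0, ∀ w ∈ D.K, dist w p ≤ η → w ∈ D.overlapSet α β l (κ / 8) := by
    refine ⟨min η η', lt_min hη hη', fun w hw hd => ?_⟩
    obtain ⟨h3, h4⟩ := lt_min_iff.mp (h1 w hw (hd.trans (min_le_left _ _)))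
    rw [hG, abs_lt] at h3 h4
    have hGα : (α : ℝ) ≤ D.G w := by linarith [h3.1]
    have h5 := abs_lt.mp (h2 w hw (by linarith) (hd.trans (min_le_right _ _)))
    refine ⟨⟨hw, hGα⟩, by linarith [h4.2], ?_⟩
    rw [abs_le]
    constructor <;> linarith [h5.1, h5.2]
  obtain ⟨r, hr0, hrr⟩ := ae_of_essLim D.u_mem hr hl hnear hnear
  obtain ⟨r', hr'0, hr'⟩ := exists_rat_btwn hr0
  refine ⟨α, β, l, κ, r', by exact_mod_cast hα0, hβδ, by exact_mod_cast hκ0,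
    by exact_mod_cast hr'0, htW, by linarith, by linarith, ?_⟩
  filter_upwards [hrr] with y hy hyr
  exact hy (hyr.trans hr')

set_option maxHeartbeats 1000000 in
/-- An excursion. Near a density point of a tube set the curve `h` is replaced by a Filippov curve
with a high switching level, which moves away to the left with speed `-M` as long as the times
belong to the tube set, and then by a Filippov curve with a low switching level, which moves with
speed `lam(u)` and catches up with `h`. Both are free of exceptional velocities at the times of
the tube set. -/
theorem exists_excursion_of_tubeSet {W : Set ℝ} (hWo : IsOpen W) (hWI : W ⊆ D.I) {h : ℝ → ℝ}
    (hh : D.IsPath h) {α β l κ r : ℝ} (hα : 0 < α) (hβ : β < D.δ) (hκ : 0 < κ) (hr : 0 < r)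
    (hpos : volume (D.tubeSet W h (D.overlapSet α β l (κ / 8)) (-D.M + κ) (l - κ) r) ≠ 0) :
    ∃ g a b, D.IsPath g ∧ a < b ∧ Icc a b ⊆ W ∧ (∀ t, t ∉ Ioo a b → g t = h t) ∧
      (∀ t, g t ≤ h t) ∧ volume (D.badSet g ∩ Ioo a b) ≤ ENNReal.ofReal ((b - a) / 4) ∧
      ENNReal.ofReal (3 * (b - a) / 4) ≤ volume (D.badSet h ∩ Ioo a b) := by
  set C := D.overlapSet α β l (κ / 8) with hC
  set E := D.tubeSet W h C (-D.M + κ) (l - κ) r with hE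
  have hL := hh.lip
  have hCc : IsClosed C := isClosed_overlapSet hα.le
  have hEm : MeasurableSet E :=
    measurableSet_tubeSet hWo.measurableSet hL.continuous hCc.measurableSet _ _ _
  have hCmem : ∀ w ∈ C, w ∈ D.K ∧ α ≤ D.G w ∧ D.G w ≤ β ∧ |D.lam w - l| ≤ κ / 8 :=
    fun w hw => ⟨hw.1.1, hw.1.2, hw.2.1, hw.2.2⟩
  -- the essential limits at the times of `E`, along curves close to `h`
  have hclose : ∀ t ∈ E, ∀ x, |x - h t| < r → ∀ᵐ y, |y| < r - |x - h t| → D.u (x + y, t) ∈ C := by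
    intro t ht x hx
    have := (measurePreserving_add_left volume (x - h t)).quasiMeasurePreserving.ae ht.2.2.2
    filter_upwards [this] with y hy hyr
    have h2 := hy ((abs_add_le _ _).trans_lt (by linarith))
    convert h2 using 3
    ring
  have hCtr : ∀ t ∈ E, ∀ x, |x - h t| < r → ∀ p, EssRightLim D.u x t p → p ∈ C :=
    fun t ht x hx p hp => hp.mem_of_isClosed hCc (sub_pos.mpr hx) (hclose t ht x hx)
  obtain ⟨t₁, ht₁⟩ := nonempty_of_measure_ne_zero hpos
  have hκM : κ ≤ 2 * D.M := by
    have := le_of_abs_le (hL.abs_deriv_le t₁)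
    linarith [ht₁.2.1]
  have hM : (0 : ℝ) < D.M := by linarith
  -- the density point and the interval
  set ε : ℝ := κ ^ 2 / (256 * D.M ^ 2) with hε
  have hε0 : 0 < ε := by positivity
  obtain ⟨x, ρ, hρ0, hρ4, hAB, hmeas⟩ := exists_interval_of_measure_ne_zero hEm hpos hWo
    (fun t ht => ht.1) hε0 (show 0 < r / (8 * D.M) by positivity)
  rw [lt_div_iff₀ (by positivity)] at hρ4
  set A := x - ρ with hA
  set B := x + ρ with hB
  rw [show 2 * ρ = B - A by simp only [hA, hB]; ring] at hmeas
  set len := B - A with hlen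
  have hlen2 : len = 2 * ρ := by simp only [hlen, hA, hB]; ring
  have hlen0 : 0 < len := by linarith
  have hmeasR : ∀ a b, A ≤ a → b ≤ B → volume.real (Ioo a b \ E) ≤ ε * len := by
    intro a b ha hb
    apply ENNReal.toReal_le_of_le_ofReal (by positivity)
    exact (measure_mono (sdiff_subset_sdiff_left (Ioo_subset_Ioo ha hb))).trans hmeas
  set s : ℝ := κ / (16 * D.M) with hs
  have hs0 : 0 < s := by positivity
  have hsM : s * (16 * D.M) = κ := by simp only [hs]; field_simp
  have hεM : ε * (256 * D.M ^ 2) = κ ^ 2 := by simp only [hε]; field_simp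
  have hs8 : s ≤ 1 / 8 := by
    rw [hs, div_le_iff₀ (by positivity)]
    linarith
  have hεs : ε * D.M * 16 = κ * s := by
    have : (ε * D.M * 16 - κ * s) * (16 * D.M) = 0 := by
      linear_combination hεM - κ * hsM
    rcases mul_eq_zero.mp this with h | h
    · linarith
    · exfalso; linarith
  set τ := A + s * len with hτ
  have hslen : s * len ≤ 1 / 8 * len := mul_le_mul_of_nonneg_right hs8 hlen0.le
  have hτ1 : A < τ := by linarith [mul_pos hs0 hlen0]
  have hτ2 : τ < B := by linarith
  have hθd : 0 < (max β 0 + D.δ) / 2 ∧ (max β 0 + D.δ) / 2 < D.δ ∧ β < (max β 0 + D.δ) / 2 := by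
    have h1 := le_max_left β 0
    have h2 := le_max_right β 0
    have h3 : max β 0 < D.δ := max_lt hβ D.δ_pos
    refine ⟨by linarith, by linarith, by linarith⟩
  obtain ⟨w₁, hw₁⟩ : ∃ w, w ∈ C := by
    obtain ⟨y, -, hy⟩ := exists_mem_of_ae_imp (s := Ioo (-r) r) (by simp [hr])
      (P := fun y => D.u (h t₁ + y, t₁) ∈ C) (by
        filter_upwards [ht₁.2.2.2] with y hy hyr using hy (abs_lt.mpr hyr))
    exact ⟨_, hy⟩
  have hαδ : α < D.δ := by
    have := hCmem w₁ hw₁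
    linarith
  obtain ⟨d, hdL, hdA, hdF, hdG⟩ := exists_filippov_path hθd.1 hθd.2.1 A (h A)
  obtain ⟨e, heL, heτ, heF, heG⟩ := exists_filippov_path (D := D) (θ := α / 2) (by positivity)
    (by linarith) τ (d τ)
  have hdr : ∀ t ∈ Icc A B, |d t - h t| < r := by
    intro t ht
    have h1 := hdL.abs_sub_le_mul t A
    have h2 := hL.abs_sub_le_mul A t
    rw [hdA] at h1
    rw [abs_of_nonneg (by linarith [ht.1] : 0 ≤ t - A)] at h1
    rw [abs_of_nonpos (by linarith [ht.1] : A - t ≤ 0)] at h2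
    have h3 : (D.M : ℝ) * (t - A) ≤ D.M * (2 * ρ) :=
      mul_le_mul_of_nonneg_left (by linarith [ht.2]) D.M.coe_nonneg
    have h4 := abs_sub_le (d t) (h A) (h t)
    linarith
  have her : ∀ t ∈ Icc τ B, |e t - h t| < r := by
    intro t ht
    have h1 := heL.abs_sub_le_mul t τ
    have h5 := hdL.abs_sub_le_mul τ A
    have h2 := hL.abs_sub_le_mul A t
    rw [heτ] at h1
    rw [hdA] at h5
    rw [abs_of_nonneg (by linarith [ht.1] : 0 ≤ t - τ)] at h1
    rw [abs_of_nonneg (by linarith [ht.1] : 0 ≤ τ - A)] at h5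
    rw [abs_of_nonpos (by linarith [ht.1] : A - t ≤ 0)] at h2
    have h3 : (D.M : ℝ) * (t - A) ≤ D.M * (2 * ρ) :=
      mul_le_mul_of_nonneg_left (by linarith [ht.2]) D.M.coe_nonneg
    have h4 := abs_sub_le (e t) (d τ) (h t)
    have h6 := abs_sub_le (d τ) (h A) (h t)
    linarith
  have hdE : ∀ᵐ t, t ∈ Ioo A B → t ∈ E → deriv d t = -D.M := by
    filter_upwards [hdF] with t ht htI htE
    have hx := hdr t (Ioo_subset_Icc_self htI)
    refine le_antisymm ((ht htI.1 _ _ (sub_pos.mpr hx)).1 ?_)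
      (neg_le_of_abs_le (hdL.abs_deriv_le t))
    filter_upwards [hclose t htE _ hx] with y hy hyr
    have := hCmem _ (hy hyr)
    rw [vel_of_lt (by linarith)]
  have heE : ∀ᵐ t, t ∈ Ioo τ B → t ∈ E → l - κ / 8 ≤ deriv e t := by
    filter_upwards [heF] with t ht htI htE
    have hx := her t (Ioo_subset_Icc_self htI)
    refine (ht htI.1 _ _ (sub_pos.mpr hx)).2 ?_
    filter_upwards [hclose t htE _ hx] with y hy hyr
    have := hCmem _ (hy hyr)
    rw [vel_of_le this.1 (by linarith)]
    linarith [(abs_le.mp this.2.2.2).1]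
  have hdiffh := hL.ae_differentiableAt_real
  have hdiffd := hdL.ae_differentiableAt_real
  have hdiffe := heL.ae_differentiableAt_real
  -- the curve `d` falls behind, and `e` catches up
  have hgap : κ * s * len / 2 ≤ h τ - d τ := by
    have h1 := (hL.sub hdL).sub_ge_of_deriv_ge (c := κ) hτ1.le hEm (by
      filter_upwards [hdE, hdiffh, hdiffd] with t h1 h2 h3 htI htE
      rw [deriv_fun_sub h2 h3, h1 ⟨htI.1, htI.2.trans hτ2⟩ htE]
      linarith [htE.2.1])
    rw [abs_of_pos hκ, NNReal.coe_add, hdA] at h1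
    have h2 := hmeasR A τ le_rfl hτ2.le
    have h3 : (κ + (D.M + D.M)) * volume.real (Ioo A τ \ E) ≤ (4 * D.M) * (ε * len) :=
      mul_le_mul (by linarith) h2 measureReal_nonneg (by positivity)
    have h4 : τ - A = s * len := by simp only [hτ]; ring
    rw [h4] at h1
    have h5 : (4 * D.M) * (ε * len) = κ * s * len / 4 := by
      linear_combination (len / 4) * hεs
    linarith [mul_pos (mul_pos hκ hs0) hlen0]
  have hcatch : 0 ≤ e B - h B := by
    have h1 := (heL.sub hL).sub_ge_of_deriv_ge (c := κ / 2) hτ2.le hEm (by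
      filter_upwards [heE, hdiffh, hdiffe] with t h1 h2 h3 htI htE
      rw [deriv_fun_sub h3 h2]
      linarith [htE.2.2.1, h1 htI htE])
    rw [abs_of_pos (by linarith), NNReal.coe_add, heτ] at h1
    have h2 := hmeasR τ B hτ1.le le_rfl
    have h3 : (κ / 2 + (D.M + D.M)) * volume.real (Ioo τ B \ E) ≤ (4 * D.M) * (ε * len) :=
      mul_le_mul (by linarith) h2 measureReal_nonneg (by positivity)
    have h4 : B - τ = (1 - s) * len := by simp only [hτ, hlen]; ring
    rw [h4] at h1
    have h5 : (4 * D.M) * (ε * len) = κ * s * len / 4 := by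
      linear_combination (len / 4) * hεs
    have h6 : h τ - d τ ≤ κ / 8 * len := by
      have h7 := (hL.sub hdL).abs_sub_le_mul τ A
      have h8 : τ - A = s * len := by simp only [hτ]; ring
      simp only [NNReal.coe_add, hdA, sub_self, sub_zero, h8] at h7
      rw [abs_of_pos (mul_pos hs0 hlen0)] at h7
      have h9 := le_of_abs_le h7
      have h10 : ((D.M : ℝ) + D.M) * (s * len) = κ / 8 * len := by
        linear_combination (len / 8) * hsM
      linarith
    have h11 : κ * s * len ≤ κ * (1 / 8) * len := by gcongr
    linarith [mul_pos hκ hlen0]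
  obtain ⟨a, haA, haτ, hha, hapos⟩ := exists_last_contact (φ := fun t => h t - d t)
    (hL.continuous.sub hdL.continuous) hτ1.le (by simp [hdA])
    (lt_of_lt_of_le (by positivity) hgap)
  obtain ⟨b, hτb, hbB, hhb, hbpos⟩ := exists_first_contact (φ := fun t => h t - e t)
    (hL.continuous.sub heL.continuous) hτ2.le
    (by rw [heτ]; exact lt_of_lt_of_le (by positivity) hgap) (by linarith)
  have hab : a < b := haτ.trans hτb
  have hlong : ε * len ≤ (b - a) / 4 := by
    have h7 := (hL.sub hdL).abs_sub_le_mul τ a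
    simp only [NNReal.coe_add, hha, sub_zero] at h7
    rw [abs_of_pos (sub_pos.mpr haτ)] at h7
    have h9 := le_of_abs_le h7
    have h10 : κ * s * len / 2 ≤ 2 * D.M * (τ - a) := by linarith
    have h11 : ε * len * (8 * D.M) ≤ 2 * D.M * (τ - a) := by
      have : ε * len * (8 * D.M) = κ * s * len / 2 := by linear_combination (len / 2) * hεs
      linarith
    have h12 : ε * len * 4 ≤ τ - a := by
      have h13 : 0 ≤ 2 * D.M * (τ - a - ε * len * 4) := by linarith
      linarith [nonneg_of_mul_nonneg_right h13 (by positivity)]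
    linarith
  set g := glue a h (glue τ d (glue b e h)) with hg
  have hbeh : e b = h b := by linarith
  have hgL : LipschitzWith D.M g := by
    apply hL.glue
    · apply hdL.glue (heL.glue hL hbeh)
      rw [glue_of_le hτb.le, heτ]
    · rw [glue_of_le haτ.le]
      linarith
  have hg1 : ∀ t, t ≤ a → g t = h t := fun t ht => glue_of_le ht
  have hg2 : ∀ t, a < t → t ≤ τ → g t = d t := fun t h1 h2 => by
    rw [hg, glue_of_gt h1, glue_of_le h2]
  have hg3 : ∀ t, τ < t → t ≤ b → g t = e t := fun t h1 h2 => by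
    rw [hg, glue_of_gt (haτ.trans h1), glue_of_gt h1, glue_of_le h2]
  have hg4 : ∀ t, b < t → g t = h t := fun t h1 => by
    rw [hg, glue_of_gt (hab.trans h1), glue_of_gt (hτb.trans h1), glue_of_gt h1]
  have hg1' : ∀ t, t < a → deriv g t = deriv h t := fun t ht => deriv_glue_of_lt ht
  have hg2' : ∀ t, a < t → t < τ → deriv g t = deriv d t := fun t h1 h2 => by
    rw [hg, deriv_glue_of_gt h1, deriv_glue_of_lt h2]
  have hg3' : ∀ t, τ < t → t < b → deriv g t = deriv e t := fun t h1 h2 => by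
    rw [hg, deriv_glue_of_gt (haτ.trans h1), deriv_glue_of_gt h1, deriv_glue_of_lt h2]
  have hg4' : ∀ t, b < t → deriv g t = deriv h t := fun t h1 => by
    rw [hg, deriv_glue_of_gt (hab.trans h1), deriv_glue_of_gt (hτb.trans h1), deriv_glue_of_gt h1]
  have hne : ∀ᵐ t : ℝ, t ≠ a ∧ t ≠ τ ∧ t ≠ b := by
    have h1 : ∀ c : ℝ, ∀ᵐ t : ℝ, t ≠ c := fun c => compl_mem_ae_iff.mpr (measure_singleton c)
    filter_upwards [h1 a, h1 τ, h1 b] with t h1 h2 h3 using ⟨h1, h2, h3⟩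
  have habI : Icc a b ⊆ W := (Icc_subset_Icc haA hbB).trans hAB
  refine ⟨g, a, b, ⟨hgL, ?_⟩, hab, habI, ?_, ?_, ?_, ?_⟩
  · filter_upwards [hne, hh.ae, hdG, heG] with t hne h1 h2 h3 htI
    rcases lt_or_gt_of_ne hne.1 with h4 | h4
    · rw [hg1 t h4.le, hg1' t h4]
      exact h1 htI
    rcases lt_or_gt_of_ne hne.2.1 with h5 | h5
    · rw [hg2 t h4 h5.le, hg2' t h4 h5]
      exact (h2 htI (haA.trans_lt h4)).imp_right fun h => ⟨_, hθd.1, hθd.2.1, h⟩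
    rcases lt_or_gt_of_ne hne.2.2 with h6 | h6
    · rw [hg3 t h5 h6.le, hg3' t h5 h6]
      exact (h3 htI h5).imp_right fun h => ⟨_, by positivity, by linarith, h⟩
    · rw [hg4 t h6, hg4' t h6]
      exact h1 htI
  · intro t ht
    rcases le_or_gt t a with h1 | h1
    · exact hg1 t h1
    · have h2 : b ≤ t := by
        by_contra! h2
        exact ht ⟨h1, h2⟩
      rcases h2.eq_or_lt with h3 | h3
      · rw [← h3, hg3 b hτb le_rfl, hbeh]
      · exact hg4 t h3
  · intro t
    rcases le_or_gt t a with h1 | h1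
    · exact (hg1 t h1).le
    rcases le_or_gt t τ with h2 | h2
    · rw [hg2 t h1 h2]
      linarith [hapos t h1 h2]
    rcases le_or_gt t b with h3 | h3
    · rw [hg3 t h2 h3]
      rcases h3.eq_or_lt with h4 | h4
      · rw [h4, hbeh]
      · linarith [hbpos t h2.le h4]
    · exact (hg4 t h3).le
  · have hsub : (D.badSet g ∩ Ioo a b : Set ℝ) ≤ᵐ[volume] (Ioo A B \ E : Set ℝ) := by
      filter_upwards [hne, hdE, heG] with t hne h2 h3 ht
      obtain ⟨⟨htI, hbad⟩, hta, htb⟩ := ht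
      have htAB : t ∈ Ioo A B := ⟨haA.trans_lt hta, htb.trans_le hbB⟩
      refine ⟨htAB, fun htE => ?_⟩
      rcases lt_or_gt_of_ne hne.2.1 with h5 | h5
      · rw [hg2 t hta h5.le, hg2' t hta h5] at hbad
        obtain ⟨θ, -, -, p, -, -, -, -, h7, -⟩ := hbad
        exact h7.ne' (h2 htAB htE)
      · rw [hg3 t h5 htb.le, hg3' t h5 htb] at hbad
        rcases h3 htI h5 with h6 | ⟨p, hp, hpr, -, hpG, -⟩
        · exact h6.not_bad hbad
        · have := hCmem p (hCtr t htE _ (her t ⟨h5.le, htAB.2.le⟩) p hpr)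
          linarith
    exact (measure_mono_ae hsub).trans (hmeas.trans (ENNReal.ofReal_le_ofReal hlong))
  · have hsub : (E ∩ Ioo a b : Set ℝ) ≤ᵐ[volume] (D.badSet h ∩ Ioo a b : Set ℝ) := by
      filter_upwards [hh.ae] with t h1 ht
      obtain ⟨htE, htab⟩ := ht
      have htI := hWI htE.1
      refine ⟨⟨htI, (h1 htI).resolve_left ?_⟩, htab⟩
      rintro ⟨p, hp, m, hm, hpr, hml, hcase⟩
      have hpC := hCmem p (hCtr t htE _ (by simpa using hr) p hpr)
      have hlam := (abs_le.mp hpC.2.2.2).1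
      have hv1 := htE.2.1
      have hv2 := htE.2.2.1
      rcases hcase with ⟨-, hd, -⟩ | ⟨-, -, hv⟩ | ⟨-, -, hv⟩
      · have := D.lam_lt_of_disc _ _ _ hd
        linarith
      · linarith
      · linarith
    refine le_trans ?_ (measure_mono_ae hsub)
    have h1 : volume (Ioo a b ∩ E) + volume (Ioo a b \ E) = ENNReal.ofReal (b - a) := by
      rw [← Real.volume_Ioo]
      exact measure_inter_add_sdiff _ hEm
    have h2 : volume (Ioo a b \ E) ≤ ENNReal.ofReal ((b - a) / 4) :=
      (measure_mono (sdiff_subset_sdiff_left (Ioo_subset_Ioo haA hbB))).trans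
        (hmeas.trans (ENNReal.ofReal_le_ofReal hlong))
    rw [inter_comm E]
    have h3 : ENNReal.ofReal (b - a) =
        ENNReal.ofReal (3 * (b - a) / 4) + ENNReal.ofReal ((b - a) / 4) := by
      rw [← ENNReal.ofReal_add (by linarith) (by linarith)]
      congr 1
      ring
    rw [h3] at h1
    have h4 : ENNReal.ofReal (3 * (b - a) / 4) + ENNReal.ofReal ((b - a) / 4) ≤
        volume (Ioo a b ∩ E) + ENNReal.ofReal ((b - a) / 4) := by
      rw [← h1]
      gcongr
    exact (ENNReal.add_le_add_iff_right ENNReal.ofReal_ne_top).mp h4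

end ShiftData

namespace ShiftData

variable {n : ℕ} {D : ShiftData n}

theorem exists_excursion {W : Set ℝ} (hWo : IsOpen W) (hWI : W ⊆ D.I) {h : ℝ → ℝ}
    (hh : D.IsPath h) (hpos : volume (D.badSet h ∩ W) ≠ 0) :
    ∃ g a b, D.IsPath g ∧ a < b ∧ Icc a b ⊆ W ∧ (∀ t, t ∉ Ioo a b → g t = h t) ∧
      (∀ t, g t ≤ h t) ∧ volume (D.badSet g ∩ Ioo a b) ≤ ENNReal.ofReal ((b - a) / 4) ∧
      ENNReal.ofReal (3 * (b - a) / 4) ≤ volume (D.badSet h ∩ Ioo a b) := by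
  by_contra hcon
  apply hpos
  have hnull : ∀ α β l κ r : ℚ, 0 < α ∧ (β : ℝ) < D.δ ∧ 0 < κ ∧ 0 < r →
      ∀ᵐ t, t ∉ D.tubeSet W h (D.overlapSet α β l (κ / 8)) (-D.M + κ) (l - κ) r := by
    rintro α β l κ r ⟨h1, h2, h3, h4⟩
    rw [← measure_eq_zero_iff_ae_notMem]
    by_contra h5
    exact hcon (exists_excursion_of_tubeSet hWo hWI hh (by exact_mod_cast h1) h2
      (by exact_mod_cast h3) (by exact_mod_cast h4) h5)
  rw [measure_eq_zero_iff_ae_notMem]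
  simp_rw [← eventually_imp_distrib_left] at hnull
  simp_rw [← ae_all_iff] at hnull
  filter_upwards [hnull] with t ht htb
  obtain ⟨α, β, l, κ, r, h1, h2, h3, h4, h5⟩ := exists_tubeSet_of_bad htb.2 htb.1.2
  exact ht α β l κ r ⟨h1, h2, h3, h4⟩ h5

/-- Where two curves coincide on a set, they have the same velocities at almost all its times. -/
theorem ae_deriv_eq_of_eq_path {f g : ℝ → ℝ} (hf : LipschitzWith D.M f) (hg : LipschitzWith D.M g) :
    ∀ᵐ t, f t = g t → deriv f t = deriv g t := by
  filter_upwards [ae_deriv_eq_of_eq f g, hf.ae_differentiableAt_real,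
    hg.ae_differentiableAt_real] with t h1 h2 h3 h4 using h1 h4 h2 h3

/-- The limit of a sequence of curves in which almost every time is affected by finitely many
modifications only. -/
theorem exists_limit_path {h : ℕ → ℝ → ℝ} (hh : ∀ k, D.IsPath (h k)) {U : ℕ → Set ℝ}
    (hU : ∀ k, U k ⊆ D.I) (hmod : ∀ k t, t ∉ U k → h (k + 1) t = h k t)
    (hle : ∀ k t, h (k + 1) t ≤ h k t)
    (hfin : ∀ᵐ t : ℝ, ∃ k, ∀ j, k ≤ j → t ∉ U j) :
    ∃ g, D.IsPath g ∧ (∀ k t, (∀ j, k ≤ j → t ∉ U j) → g t = h k t) ∧ ∀ k t, g t ≤ h k t := by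
  have hstat : ∀ k t, (∀ j, k ≤ j → t ∉ U j) → ∀ j, k ≤ j → h j t = h k t := by
    intro k t ht j hj
    induction j, hj using Nat.le_induction with
    | base => rfl
    | succ j hj ih => rw [hmod j t (ht j hj), ih]
  have h0 : ∀ k, h k 0 = h 0 0 := by
    intro k
    exact hstat 0 0 (fun j _ hj => (D.I_pos 0 (hU j hj)).false) k (Nat.zero_le k)
  obtain ⟨g, hgL, hgt, -⟩ := exists_hyperfilter_limit (fun k => (hh k).lip) h0
  have hev : ∀ k : ℕ, ∀ᶠ j in (hyperfilter ℕ : Filter ℕ), k ≤ j := fun k =>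
    Nat.hyperfilter_le_atTop (eventually_ge_atTop k)
  have hgeq : ∀ k t, (∀ j, k ≤ j → t ∉ U j) → g t = h k t := by
    intro k t ht
    refine tendsto_nhds_unique (hgt t) (tendsto_const_nhds.congr' ?_)
    filter_upwards [hev k] with j hj using (hstat k t ht j hj).symm
  have hmono : ∀ t, Antitone fun k => h k t := fun t => antitone_nat_of_succ_le fun k => hle k t
  refine ⟨g, ⟨hgL, ?_⟩, hgeq, fun k t => ?_⟩
  · filter_upwards [hfin, ae_all_iff.mpr fun k => ae_deriv_eq_of_eq_path hgL (hh k).lip,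
      ae_all_iff.mpr fun k => (hh k).ae] with t ⟨k, hk⟩ h1 h2 htI
    have h3 := hgeq k t hk
    rw [h1 k h3, h3]
    exact h2 k htI
  · apply le_of_tendsto (hgt t)
    filter_upwards [hev k] with j hj using hmono t hj

/-- `g` arises from `h` by modifications in a part `U` of `W` whose measure is controlled by the
decrease of the measure of the set of exceptional times. -/
structure Improves (D : ShiftData n) (W : Set ℝ) (h g : ℝ → ℝ) : Prop where
  isPath : D.IsPath g
  le : ∀ t, g t ≤ h t
  exists_set : ∃ U ⊆ W, (∀ t, t ∉ U → g t = h t) ∧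
    volume (D.badSet g ∩ W) + volume U / 2 ≤ volume (D.badSet h ∩ W)

theorem Improves.refl {W : Set ℝ} {h : ℝ → ℝ} (hh : D.IsPath h) : D.Improves W h h :=
  ⟨hh, fun _ => le_rfl, ∅, empty_subset _, fun _ _ => rfl, by simp⟩

theorem Improves.trans {W : Set ℝ} {f g h : ℝ → ℝ} (h1 : D.Improves W f g)
    (h2 : D.Improves W g h) : D.Improves W f h := by
  obtain ⟨hg, hgf, U, hUW, hU, hUm⟩ := h1
  obtain ⟨hh, hhg, U', hU'W, hU', hU'm⟩ := h2
  refine ⟨hh, fun t => (hhg t).trans (hgf t), U ∪ U', union_subset hUW hU'W, fun t ht => ?_, ?_⟩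
  · rw [mem_union, not_or] at ht
    rw [hU' t ht.2, hU t ht.1]
  · calc volume (D.badSet h ∩ W) + volume (U ∪ U') / 2
        ≤ volume (D.badSet h ∩ W) + (volume U + volume U') / 2 := by
          gcongr; exact measure_union_le _ _
      _ = volume (D.badSet h ∩ W) + volume U' / 2 + volume U / 2 := by
          rw [ENNReal.add_div]; ring
      _ ≤ volume (D.badSet g ∩ W) + volume U / 2 := by gcongr
      _ ≤ _ := hUm

theorem exists_improves {W : Set ℝ} (hWo : IsOpen W) (hWI : W ⊆ D.I) (hWf : volume W ≠ ⊤)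
    {h : ℝ → ℝ} (hh : D.IsPath h) (hpos : volume (D.badSet h ∩ W) ≠ 0) :
    ∃ g, D.Improves W h g ∧ volume (D.badSet g ∩ W) < volume (D.badSet h ∩ W) := by
  obtain ⟨g, a, b, hg, hab, habW, hgh, hle, hbg, hbh⟩ := exists_excursion hWo hWI hh hpos
  have hIW : Ioo a b ⊆ W := Ioo_subset_Icc_self.trans habW
  have hsplit : ∀ f : ℝ → ℝ, volume (D.badSet f ∩ W ∩ Ioo a b) +
      volume ((D.badSet f ∩ W) \ Ioo a b) = volume (D.badSet f ∩ W) := fun f =>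
    measure_inter_add_sdiff _ measurableSet_Ioo
  have hin : ∀ f : ℝ → ℝ, D.badSet f ∩ W ∩ Ioo a b = D.badSet f ∩ Ioo a b := fun f => by
    rw [inter_assoc, inter_eq_right.mpr hIW]
  have hout : volume ((D.badSet g ∩ W) \ Ioo a b) ≤ volume ((D.badSet h ∩ W) \ Ioo a b) := by
    apply measure_mono_ae
    filter_upwards [ae_deriv_eq_of_eq_path hg.lip hh.lip] with t h1 ht
    obtain ⟨⟨⟨htI, hb⟩, htW⟩, hn⟩ := ht
    have h2 := hgh t hn
    rw [h1 h2, h2] at hb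
    exact ⟨⟨⟨htI, hb⟩, htW⟩, hn⟩
  have hkey : volume (D.badSet g ∩ W) + volume (Ioo a b) / 2 ≤ volume (D.badSet h ∩ W) := by
    rw [← hsplit g, ← hsplit h, hin, hin]
    calc volume (D.badSet g ∩ Ioo a b) + volume ((D.badSet g ∩ W) \ Ioo a b) +
          volume (Ioo a b) / 2
        = (volume (D.badSet g ∩ Ioo a b) + volume (Ioo a b) / 2) +
          volume ((D.badSet g ∩ W) \ Ioo a b) := by ring
      _ ≤ volume (D.badSet h ∩ Ioo a b) + volume ((D.badSet h ∩ W) \ Ioo a b) := by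
          gcongr
          refine le_trans ?_ hbh
          have h2 : volume (Ioo a b) / 2 = ENNReal.ofReal ((b - a) / 2) := by
            rw [Real.volume_Ioo, ENNReal.ofReal_div_of_pos (by norm_num)]
            simp
          rw [h2]
          calc _ ≤ ENNReal.ofReal ((b - a) / 4) + ENNReal.ofReal ((b - a) / 2) := by gcongr
            _ = _ := by
              rw [← ENNReal.ofReal_add (by linarith) (by linarith)]
              congr 1; ring
  refine ⟨g, ⟨hg, hle, Ioo a b, hIW, hgh, hkey⟩, ?_⟩
  have hfin : volume (D.badSet g ∩ W) ≠ ⊤ :=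
    ne_top_of_le_ne_top hWf (measure_mono inter_subset_right)
  refine lt_of_lt_of_le (ENNReal.lt_add_right hfin ?_) hkey
  simp [hab]

/-- Every curve can be modified in a bounded open set `W` of times such that no exceptional
velocities remain in `W`. A sequence of almost optimal improvements converges to a curve which
cannot be improved. -/
theorem exists_improves_null {W : Set ℝ} (hWo : IsOpen W) (hWI : W ⊆ D.I) (hWf : volume W ≠ ⊤)
    {h : ℝ → ℝ} (hh : D.IsPath h) :
    ∃ g, D.Improves W h g ∧ volume (D.badSet g ∩ W) = 0 := by
  have hfin : ∀ f, volume (D.badSet f ∩ W) ≠ ⊤ := fun f =>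
    ne_top_of_le_ne_top hWf (measure_mono inter_subset_right)
  set μ : (ℝ → ℝ) → ℝ := fun f => (volume (D.badSet f ∩ W)).toReal with hμ
  -- an almost optimal improvement
  have hstep : ∀ (k : ℕ) (f : ℝ → ℝ), ∃ g, D.IsPath f → D.Improves W f g ∧
      ∀ g', D.Improves W f g' → μ g ≤ μ g' + 1 / ((k : ℝ) + 1) := by
    intro k f
    by_cases hf : D.IsPath f
    · have hne : (μ '' {g | D.Improves W f g}).Nonempty := ⟨_, f, Improves.refl hf, rfl⟩
      have hbdd : BddBelow (μ '' {g | D.Improves W f g}) :=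
        ⟨0, by rintro _ ⟨g, -, rfl⟩; exact ENNReal.toReal_nonneg⟩
      obtain ⟨_, ⟨g, hg, rfl⟩, hlt⟩ := Real.lt_sInf_add_pos hne
        (show (0 : ℝ) < 1 / ((k : ℝ) + 1) by positivity)
      refine ⟨g, fun _ => ⟨hg, fun g' hg' => ?_⟩⟩
      linarith [csInf_le hbdd ⟨g', hg', rfl⟩]
    · exact ⟨f, fun h => absurd h hf⟩
  choose next hnext using hstep
  let H : ℕ → ℝ → ℝ := fun k => Nat.rec h (fun k f => next k f) k
  have hHs : ∀ k, H (k + 1) = next k (H k) := fun k => rfl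
  have hHp : ∀ k, D.IsPath (H k) := by
    intro k
    induction k with
    | zero => exact hh
    | succ k ih => exact (hnext k _ ih).1.isPath
  have himp : ∀ k, D.Improves W (H k) (H (k + 1)) := fun k => (hnext k _ (hHp k)).1
  choose U hUW hUeq hUm using fun k => (himp k).exists_set
  have htele : ∀ k m, volume (D.badSet (H (k + m)) ∩ W) +
      ∑ j ∈ Finset.range m, volume (U (k + j)) / 2 ≤ volume (D.badSet (H k) ∩ W) := by
    intro k m
    induction m with
    | zero => simp
    | succ m ih =>
      rw [Finset.sum_range_succ]
      calc _ = (volume (D.badSet (H (k + m + 1)) ∩ W) + volume (U (k + m)) / 2) +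
            ∑ j ∈ Finset.range m, volume (U (k + j)) / 2 := by
              rw [← add_assoc k m 1]; ring
        _ ≤ volume (D.badSet (H (k + m)) ∩ W) +
            ∑ j ∈ Finset.range m, volume (U (k + j)) / 2 := by gcongr; exact hUm _
        _ ≤ _ := ih
  have hsum : ∑' j, volume (U j) ≠ ⊤ := by
    have h1 : ∑' j, volume (U j) / 2 ≤ volume (D.badSet (H 0) ∩ W) := by
      rw [ENNReal.tsum_eq_iSup_nat]
      apply iSup_le
      intro m
      have := htele 0 m
      simp only [zero_add] at this
      exact le_trans le_add_self this
    simp only [div_eq_mul_inv] at h1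
    rw [ENNReal.tsum_mul_right] at h1
    have h2 := ne_top_of_le_ne_top (hfin _) h1
    intro h3
    rw [h3] at h2
    exact h2 (ENNReal.top_mul (by simp))
  have hBC : ∀ᵐ t : ℝ, ∃ k, ∀ j, k ≤ j → t ∉ U j := by
    filter_upwards [ae_eventually_notMem hsum] with t ht
    exact eventually_atTop.mp ht
  obtain ⟨g, hg, hgeq, hgle⟩ := exists_limit_path hHp (fun k => (hUW k).trans hWI) hUeq
    (fun k => (himp k).le) hBC
  have htail : Tendsto (fun k => ∑' j, volume (U (k + j))) atTop (𝓝 0) := by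
    have := ENNReal.tendsto_sum_nat_add (fun j => volume (U j)) hsum
    simpa only [add_comm] using this
  have hgH : ∀ k, volume (D.badSet g ∩ W) ≤
      volume (D.badSet (H k) ∩ W) + ∑' j, volume (U (k + j)) := by
    intro k
    have h1 : (D.badSet g ∩ W : Set ℝ) ≤ᵐ[volume]
        ((D.badSet (H k) ∩ W) ∪ ⋃ j, U (k + j) : Set ℝ) := by
      filter_upwards [ae_deriv_eq_of_eq_path hg.lip (hHp k).lip] with t h1 ht
      by_cases htU : t ∈ ⋃ j, U (k + j)
      · exact Or.inr htU
      · rw [mem_iUnion, not_exists] at htU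
        have h2 := hgeq k t fun j hj => by
          have := htU (j - k)
          rwa [Nat.add_sub_cancel' hj] at this
        refine Or.inl ⟨⟨ht.1.1, ?_⟩, ht.2⟩
        have h3 := ht.1.2
        rwa [h1 h2, h2] at h3
    refine (measure_mono_ae h1).trans ((measure_union_le _ _).trans ?_)
    gcongr
    exact measure_iUnion_le _
  have hgimp : ∀ k, D.Improves W (H k) g := by
    intro k
    refine ⟨hg, hgle k, ⋃ j, U (k + j), iUnion_subset fun j => hUW _, fun t ht => ?_, ?_⟩
    · rw [mem_iUnion, not_exists] at ht
      exact hgeq k t fun j hj => by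
        have := ht (j - k)
        rwa [Nat.add_sub_cancel' hj] at this
    · have h2 : ∀ m, volume (D.badSet g ∩ W) + ∑ j ∈ Finset.range m, volume (U (k + j)) / 2 ≤
          volume (D.badSet (H k) ∩ W) + ∑' j, volume (U (k + m + j)) := by
        intro m
        calc _ ≤ (volume (D.badSet (H (k + m)) ∩ W) + ∑' j, volume (U (k + m + j))) +
              ∑ j ∈ Finset.range m, volume (U (k + j)) / 2 := by gcongr; exact hgH _
          _ = (volume (D.badSet (H (k + m)) ∩ W) +
              ∑ j ∈ Finset.range m, volume (U (k + j)) / 2) +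
              ∑' j, volume (U (k + m + j)) := by ring
          _ ≤ _ := by gcongr; exact htele k m
      have h3 : Tendsto (fun m => ∑' j, volume (U (k + m + j))) atTop (𝓝 0) :=
        htail.comp (tendsto_atTop_mono (fun m => Nat.le_add_left m k) tendsto_id)
      have h4 : Tendsto (fun m => ∑ j ∈ Finset.range m, volume (U (k + j)) / 2) atTop
          (𝓝 (∑' j, volume (U (k + j)) / 2)) := ENNReal.tendsto_nat_tsum _
      have h5 := le_of_tendsto_of_tendsto' (tendsto_const_nhds.add h4)
        (tendsto_const_nhds.add h3) h2
      rw [add_zero] at h5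
      refine le_trans ?_ h5
      gcongr
      simp only [div_eq_mul_inv]
      rw [ENNReal.tsum_mul_right]
      gcongr
      exact measure_iUnion_le _
  refine ⟨g, hgimp 0, ?_⟩
  by_contra hne
  obtain ⟨g', hg', hlt⟩ := exists_improves hWo hWI hWf hg hne
  have hlt' : μ g' < μ g := (ENNReal.toReal_lt_toReal (hfin _) (hfin _)).mpr hlt
  have hmono : ∀ k, μ g ≤ μ (H k) := by
    intro k
    apply ENNReal.toReal_mono (hfin _)
    obtain ⟨V, -, -, hV⟩ := (hgimp k).exists_set
    exact le_trans le_self_add hV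
  obtain ⟨k, hk⟩ := exists_nat_one_div_lt (sub_pos.mpr hlt')
  have := (hnext k _ (hHp k)).2 g' ((hgimp k).trans hg')
  rw [← hHs] at this
  linarith [hmono (k + 1)]

/-- The shift: a curve to the left of a given barrier which has only allowed velocities. -/
theorem exists_good_path {L : ℝ≥0} {b : ℝ → ℝ} (hb : LipschitzWith L b) (hb0 : 0 ≤ b 0)
    (hbM : ∀ᵐ t, t ∈ D.I → -D.M < deriv b t)
    (hbl : ∀ᵐ t, t ∈ D.I → ∀ p ∈ D.K, EssRightLim D.u (b t) t p → EssLeftLim D.u (b t) t p →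
      D.lam p < deriv b t) :
    ∃ h, LipschitzWith D.M h ∧ h 0 = 0 ∧ (∀ t ∈ D.I, h t ≤ b t) ∧
      ∀ᵐ t, t ∈ D.I → D.Good (h t) t (deriv h t) := by
  obtain ⟨h, hh, h0, hhb⟩ := exists_path_le_barrier hb hb0 hbM hbl
  set W : ℕ → Set ℝ := fun k => D.I ∩ Ioo (k : ℝ) (k + 1) with hW
  have hWo : ∀ k, IsOpen (W k) := fun k => D.isOpen_I.inter isOpen_Ioo
  have hWf : ∀ k, volume (W k) ≠ ⊤ := fun k =>
    ne_top_of_le_ne_top (by simp) (measure_mono (inter_subset_right : W k ⊆ Ioo (k : ℝ) (k + 1)))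
  have hstep : ∀ (k : ℕ) (f : ℝ → ℝ), ∃ g, D.IsPath f → D.Improves (W k) f g ∧
      volume (D.badSet g ∩ W k) = 0 := by
    intro k f
    by_cases hf : D.IsPath f
    · obtain ⟨g, hg⟩ := exists_improves_null (hWo k) inter_subset_left (hWf k) hf
      exact ⟨g, fun _ => hg⟩
    · exact ⟨f, fun h => absurd h hf⟩
  choose next hnext using hstep
  let H : ℕ → ℝ → ℝ := fun k => Nat.rec h (fun k f => next k f) k
  have hHp : ∀ k, D.IsPath (H k) := by
    intro k
    induction k with
    | zero => exact hh
    | succ k ih => exact (hnext k _ ih).1.isPath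
  have himp : ∀ k, D.Improves (W k) (H k) (H (k + 1)) := fun k => (hnext k _ (hHp k)).1
  have hnull : ∀ k, volume (D.badSet (H (k + 1)) ∩ W k) = 0 := fun k => (hnext k _ (hHp k)).2
  have hmod : ∀ k t, t ∉ W k → H (k + 1) t = H k t := by
    intro k t ht
    obtain ⟨U, hU, hUeq, -⟩ := (himp k).exists_set
    exact hUeq t fun h => ht (hU h)
  have hfloor : ∀ t : ℝ, ∀ j, ⌊t⌋₊ + 1 ≤ j → t ∉ W j := by
    intro t j hj ht
    have h1 := Nat.lt_floor_add_one t
    have h2 : ((⌊t⌋₊ + 1 : ℕ) : ℝ) ≤ j := by exact_mod_cast hj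
    push_cast at h2
    linarith [ht.2.1]
  obtain ⟨g, hg, hgeq, hgle⟩ := exists_limit_path hHp (fun k => inter_subset_left) hmod
    (fun k => (himp k).le) (Eventually.of_forall fun t => ⟨_, hfloor t⟩)
  refine ⟨g, hg.lip, ?_, fun t ht => (hgle 0 t).trans (hhb t ht), ?_⟩
  · rw [hgeq 0 0 fun j _ hj => (D.I_pos 0 hj.1).false]
    exact h0
  · have hint : ∀ᵐ t : ℝ, t ∉ range ((↑) : ℕ → ℝ) :=
      compl_mem_ae_iff.mpr ((countable_range _).measure_zero _)
    filter_upwards [hint, hg.ae, ae_all_iff.mpr fun k => ae_deriv_eq_of_eq_path hg.lip (hHp k).lip,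
      ae_all_iff.mpr fun k => measure_eq_zero_iff_ae_notMem.mp (hnull k)] with t h1 h2 h3 h4 htI
    refine (h2 htI).resolve_right fun hbad => ?_
    have hk := hgeq _ t (hfloor t)
    rw [h3 (⌊t⌋₊ + 1) hk, hk] at hbad
    refine h4 ⌊t⌋₊ ⟨⟨htI, hbad⟩, htI, ?_, Nat.lt_floor_add_one t⟩
    exact lt_of_le_of_ne (Nat.floor_le (D.I_pos t htI).le) fun h => h1 ⟨_, h⟩

end ShiftData

/-! ### Convexity of the entropy and the characteristic speeds -/

theorem eq_zero_of_forall_quadratic_nonneg {S Q : ℝ} (h : ∀ t : ℝ, 0 ≤ 2 * t * S + t ^ 2 * Q) :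
    S = 0 := by
  by_contra hS
  have h1 := h (-S / (|Q| + 1))
  have hQ : 0 < |Q| + 1 := by positivity
  have h2 : 2 * (-S / (|Q| + 1)) * S + (-S / (|Q| + 1)) ^ 2 * Q =
      S ^ 2 / (|Q| + 1) ^ 2 * (Q - 2 * (|Q| + 1)) := by
    field_simp
    ring
  rw [h2] at h1
  have h3 : 0 < S ^ 2 / (|Q| + 1) ^ 2 := by positivity
  have h4 : Q - 2 * (|Q| + 1) < 0 := by linarith [le_abs_self Q, abs_nonneg Q]
  exact (mul_neg_of_pos_of_neg h3 h4).not_ge h1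

namespace EntropySystem

variable {n : ℕ} (sys : EntropySystem n)

section Smooth

variable {sys} {v : State n}

theorem contDiffAt_f (hv : v ∈ sys.V) : ContDiffAt ℝ 2 sys.f v :=
  sys.contDiffOn_f.contDiffAt (sys.isOpen_V.mem_nhds hv)

theorem contDiffAt_η (hv : v ∈ sys.V) : ContDiffAt ℝ 2 sys.η v :=
  sys.contDiffOn_η.contDiffAt (sys.isOpen_V.mem_nhds hv)

theorem contDiffAt_q (hv : v ∈ sys.V) : ContDiffAt ℝ 2 sys.q v :=
  sys.contDiffOn_q.contDiffAt (sys.isOpen_V.mem_nhds hv)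

theorem contDiffAt_fderiv_f (hv : v ∈ sys.V) : ContDiffAt ℝ 1 (fderiv ℝ sys.f) v :=
  (contDiffAt_f hv).fderiv_right (by norm_num)

theorem contDiffAt_fderiv_η (hv : v ∈ sys.V) : ContDiffAt ℝ 1 (fderiv ℝ sys.η) v :=
  (contDiffAt_η hv).fderiv_right (by norm_num)

theorem hasFDerivAt_f (hv : v ∈ sys.V) : HasFDerivAt sys.f (fderiv ℝ sys.f v) v :=
  ((contDiffAt_f hv).differentiableAt (by norm_num)).hasFDerivAt

theorem hasFDerivAt_η (hv : v ∈ sys.V) : HasFDerivAt sys.η (fderiv ℝ sys.η v) v :=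
  ((contDiffAt_η hv).differentiableAt (by norm_num)).hasFDerivAt

theorem hasFDerivAt_fderiv_η (hv : v ∈ sys.V) :
    HasFDerivAt (fderiv ℝ sys.η) (fderiv ℝ (fderiv ℝ sys.η) v) v :=
  ((contDiffAt_fderiv_η hv).differentiableAt (by norm_num)).hasFDerivAt

theorem fderiv_q (hv : v ∈ sys.V) :
    fderiv ℝ sys.q v = (fderiv ℝ sys.η v).comp (fderiv ℝ sys.f v) := by
  ext w
  simpa using sys.compat v hv w

theorem hasFDerivAt_q (hv : v ∈ sys.V) :
    HasFDerivAt sys.q ((fderiv ℝ sys.η v).comp (fderiv ℝ sys.f v)) v := by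
  rw [← fderiv_q hv]
  exact ((contDiffAt_q hv).differentiableAt (by norm_num)).hasFDerivAt

theorem hessian_symm (hv : v ∈ sys.V) (z w : State n) :
    fderiv ℝ (fderiv ℝ sys.η) v z w = fderiv ℝ (fderiv ℝ sys.η) v w z :=
  ((contDiffAt_η hv).isSymmSndFDerivAt (by simp)) z w

/-- The Jacobian `∇f(v)` is self-adjoint for the inner product `∇²η(v)`. -/
theorem hessian_fderiv_symm (hv : v ∈ sys.V) (z w : State n) :
    fderiv ℝ (fderiv ℝ sys.η) v z (fderiv ℝ sys.f v w) =
      fderiv ℝ (fderiv ℝ sys.η) v w (fderiv ℝ sys.f v z) := by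
  have hf' : HasFDerivAt (fderiv ℝ sys.f) (fderiv ℝ (fderiv ℝ sys.f) v) v :=
    ((contDiffAt_fderiv_f hv).differentiableAt (by norm_num)).hasFDerivAt
  have hq := (hasFDerivAt_fderiv_η hv).clm_comp hf'
  have heq : fderiv ℝ sys.q =ᶠ[𝓝 v] fun u => (fderiv ℝ sys.η u).comp (fderiv ℝ sys.f u) := by
    filter_upwards [sys.isOpen_V.mem_nhds hv] with u hu using fderiv_q hu
  have hq' := (hq.congr_of_eventuallyEq heq).fderiv
  have hsq := ((contDiffAt_q hv).isSymmSndFDerivAt (by simp)) z w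
  have hsf := ((contDiffAt_f hv).isSymmSndFDerivAt (by simp)) z w
  rw [hq'] at hsq
  simp at hsq
  rw [hsf] at hsq
  linarith

theorem hasFDerivAt_relEntropy {w : State n} (hw : w ∈ sys.V) (v : State n) :
    HasFDerivAt (fun u => sys.relEntropy u v) (fderiv ℝ sys.η w - fderiv ℝ sys.η v) w := by
  have h := (((hasFDerivAt_η hw).sub_const (sys.η v)).sub
    ((fderiv ℝ sys.η v).hasFDerivAt.comp w ((hasFDerivAt_id w).sub_const v)))
  exact h

theorem hasFDerivAt_relFlux {w : State n} (hw : w ∈ sys.V) (v : State n) :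
    HasFDerivAt (fun u => sys.relFlux u v)
      ((fderiv ℝ sys.η w - fderiv ℝ sys.η v).comp (fderiv ℝ sys.f w)) w := by
  have h := (((hasFDerivAt_q hw).sub_const (sys.q v)).sub
    ((fderiv ℝ sys.η v).hasFDerivAt.comp w ((hasFDerivAt_f hw).sub_const (sys.f v))))
  rw [ContinuousLinearMap.sub_comp]
  exact h

theorem continuousOn_relEntropy (v : State n) :
    ContinuousOn (fun u => sys.relEntropy u v) sys.V := fun _ hw =>
  (hasFDerivAt_relEntropy hw v).continuousAt.continuousWithinAt

theorem continuousOn_relFlux (v : State n) :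
    ContinuousOn (fun u => sys.relFlux u v) sys.V := fun _ hw =>
  (hasFDerivAt_relFlux hw v).continuousAt.continuousWithinAt

theorem relEntropy_self (v : State n) : sys.relEntropy v v = 0 := by simp [relEntropy]

theorem relFlux_self (v : State n) : sys.relFlux v v = 0 := by simp [relFlux]

theorem exists_hessian_lower (hv : v ∈ sys.V) :
    ∃ b > 0, ∀ z, b * ‖z‖ ^ 2 ≤ fderiv ℝ (fderiv ℝ sys.η) v z z := by
  set B := fderiv ℝ (fderiv ℝ sys.η) v with hB
  rcases (sphere (0 : State n) 1).eq_empty_or_nonempty with h | h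
  · refine ⟨1, one_pos, fun z => ?_⟩
    by_cases hz : z = 0
    · simp [hz]
    · exfalso
      have : ‖z‖⁻¹ • z ∈ sphere (0 : State n) 1 := by simp [norm_smul, hz]
      rw [h] at this
      exact this
  · obtain ⟨z₀, hz₀, hmin⟩ := (isCompact_sphere (0 : State n) 1).exists_isMinOn h
      (f := fun z => B z z) (Continuous.continuousOn (by fun_prop))
    have hne : z₀ ≠ 0 := by
      rintro rfl
      simp at hz₀
    refine ⟨B z₀ z₀, sys.hessian_pos v hv z₀ hne, fun z => ?_⟩
    by_cases hz : z = 0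
    · simp [hz]
    · have h1 : ‖z‖⁻¹ • z ∈ sphere (0 : State n) 1 := by simp [norm_smul, hz]
      have h2 : B z₀ z₀ ≤ B (‖z‖⁻¹ • z) (‖z‖⁻¹ • z) := hmin h1
      have hpos : 0 < ‖z‖ := norm_pos_iff.mpr hz
      simp only [map_smul, _root_.smul_apply, smul_eq_mul] at h2
      calc B z₀ z₀ * ‖z‖ ^ 2 ≤ (‖z‖⁻¹ * (‖z‖⁻¹ * B z z)) * ‖z‖ ^ 2 := by gcongr
        _ = B z z := by field_simp

theorem abs_charSpeed_le {μ : ℝ} (hμ : μ ∈ sys.charSpeeds v) : |μ| ≤ ‖fderiv ℝ sys.f v‖ := by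
  obtain ⟨z, hz⟩ := Module.End.HasEigenvalue.exists_hasEigenvector hμ
  have h1 : fderiv ℝ sys.f v z = μ • z := hz.apply_eq_smul
  have h2 := (fderiv ℝ sys.f v).le_opNorm z
  rw [h1, norm_smul, Real.norm_eq_abs] at h2
  exact le_of_mul_le_mul_right h2 (norm_pos_iff.mpr hz.2)

theorem bddBelow_charSpeeds (v : State n) : BddBelow (sys.charSpeeds v) :=
  ⟨-‖fderiv ℝ sys.f v‖, fun _ hμ => neg_le_of_abs_le (abs_charSpeed_le hμ)⟩

/-- The smallest characteristic speed bounds the Rayleigh quotient of `∇f(v)` with respect to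
`∇²η(v)` from below, because the minimum of this quotient is attained at an eigenvector. -/
theorem speedMin_mul_le (hv : v ∈ sys.V) (z : State n) :
    sys.speedMin v * fderiv ℝ (fderiv ℝ sys.η) v z z ≤
      fderiv ℝ (fderiv ℝ sys.η) v z (fderiv ℝ sys.f v z) := by
  by_cases hz : z = 0
  · simp [hz]
  set B := fderiv ℝ (fderiv ℝ sys.η) v with hB
  set A := fderiv ℝ sys.f v with hA
  have hpos : ∀ z, z ≠ 0 → 0 < B z z := fun z hz => sys.hessian_pos v hv z hz
  have hne1 : ∀ z ∈ sphere (0 : State n) 1, z ≠ 0 := by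
    rintro z hz rfl
    simp at hz
  have hsph : ∀ z : State n, z ≠ 0 → ‖z‖⁻¹ • z ∈ sphere (0 : State n) 1 := fun z hz => by
    simp [norm_smul, hz]
  obtain ⟨z₀, hz₀, hmin⟩ := (isCompact_sphere (0 : State n) 1).exists_isMinOn ⟨_, hsph z hz⟩
    (f := fun z => B z (A z) / B z z) (by
      apply ContinuousOn.div
      · exact Continuous.continuousOn (by fun_prop)
      · exact Continuous.continuousOn (by fun_prop)
      · exact fun z hz => (hpos z (hne1 z hz)).ne')
  set μ := B z₀ (A z₀) / B z₀ z₀ with hμ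
  have hz₀0 := hne1 z₀ hz₀
  have hQ : ∀ w, 0 ≤ B w (A w) - μ * B w w := by
    intro w
    by_cases hw : w = 0
    · simp [hw]
    have h1 : μ ≤ B (‖w‖⁻¹ • w) (A (‖w‖⁻¹ • w)) / B (‖w‖⁻¹ • w) (‖w‖⁻¹ • w) := hmin (hsph w hw)
    have h2 : B (‖w‖⁻¹ • w) (A (‖w‖⁻¹ • w)) / B (‖w‖⁻¹ • w) (‖w‖⁻¹ • w) = B w (A w) / B w w := by
      simp only [map_smul, _root_.smul_apply, smul_eq_mul]
      have := hpos w hw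
      have hw' : ‖w‖ ≠ 0 := norm_ne_zero_iff.mpr hw
      field_simp
    rw [h2, le_div_iff₀ (hpos w hw)] at h1
    linarith
  have hQ0 : B z₀ (A z₀) - μ * B z₀ z₀ = 0 := by
    have := (hpos z₀ hz₀0).ne'
    rw [hμ]
    field_simp
    ring
  have hS : ∀ w, B w (A z₀) - μ * B w z₀ = 0 := by
    intro w
    apply eq_zero_of_forall_quadratic_nonneg (Q := B w (A w) - μ * B w w)
    intro t
    have h1 := hQ (z₀ + t • w)
    have h2 := hessian_fderiv_symm hv z₀ w
    have h3 := hessian_symm hv z₀ w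
    rw [← hB] at h2 h3
    rw [← hA] at h2
    simp only [map_add, map_smul, _root_.add_apply, _root_.smul_apply,
      smul_eq_mul] at h1
    rw [h2, h3] at h1
    linarith
  have heig : A z₀ = μ • z₀ := by
    by_contra hne
    have h1 := hpos _ (sub_ne_zero.mpr hne)
    have h2 := hS (A z₀ - μ • z₀)
    rw [map_sub (B (A z₀ - μ • z₀)), map_smul, smul_eq_mul] at h1
    linarith
  have hmem : μ ∈ sys.charSpeeds v := by
    apply Module.End.hasEigenvalue_of_hasEigenvector (x := z₀)
    rw [Module.End.hasEigenvector_iff, Module.End.mem_eigenspace_iff]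
    exact ⟨heig, hz₀0⟩
  have hle : sys.speedMin v ≤ μ := csInf_le (bddBelow_charSpeeds v) hmem
  calc sys.speedMin v * B z z ≤ μ * B z z := by
        gcongr
        exact (hpos z hz).le
    _ ≤ B z (A z) := by linarith [hQ z]

/-- Second order expansion of a function whose gradient is `(∇η - ∇η(v)) A`. -/
theorem taylor_of_hasFDerivAt (hv : v ∈ sys.V) {φ : State n → ℝ}
    {A : State n → State n →L[ℝ] State n}
    (hA : ContinuousAt A v)
    (hφ : ∀ w ∈ sys.V, HasFDerivAt φ ((fderiv ℝ sys.η w - fderiv ℝ sys.η v).comp (A w)) w)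
    {ε : ℝ} (hε : 0 < ε) :
    ∃ r > 0, ball v r ⊆ sys.V ∧ ∀ w, dist w v < r →
      |φ w - φ v - fderiv ℝ (fderiv ℝ sys.η) v (w - v) (A v (w - v)) / 2| ≤ ε * ‖w - v‖ ^ 2 := by
  set B := fderiv ℝ (fderiv ℝ sys.η) v with hB
  set ε₁ : ℝ := min 1 (ε / (‖A v‖ + 1 + ‖B‖)) with hε₁
  have hden : 0 < ‖A v‖ + 1 + ‖B‖ := by positivity
  have hε₁0 : 0 < ε₁ := lt_min one_pos (by positivity)
  have hε₁1 : ε₁ ≤ 1 := min_le_left _ _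
  have hε₁2 : ε₁ * (‖A v‖ + 1 + ‖B‖) ≤ ε := by
    rw [← le_div_iff₀ hden]
    exact min_le_right _ _
  obtain ⟨r₁, hr₁, hV⟩ := Metric.isOpen_iff.mp sys.isOpen_V v hv
  obtain ⟨r₂, hr₂, hA'⟩ := Metric.continuousAt_iff.mp hA ε₁ hε₁0
  have hlo := (hasFDerivAt_fderiv_η hv).isLittleO.def hε₁0
  obtain ⟨r₃, hr₃, hη⟩ := Metric.eventually_nhds_iff.mp hlo
  refine ⟨min r₁ (min r₂ r₃), by positivity, (ball_subset_ball (min_le_left _ _)).trans hV,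
    fun w hw => ?_⟩
  set z := w - v with hz
  set b := B z (A v z) with hb
  have hzr : ‖z‖ < min r₁ (min r₂ r₃) := by rwa [hz, ← dist_eq_norm]
  obtain ⟨hz1, hz23⟩ := lt_min_iff.mp hzr
  obtain ⟨hz2, hz3⟩ := lt_min_iff.mp hz23
  have hd : ∀ τ ∈ Icc (0 : ℝ) 1, dist (v + τ • z) v ≤ ‖z‖ := by
    intro τ hτ
    rw [dist_eq_norm, add_sub_cancel_left, norm_smul, Real.norm_eq_abs, abs_of_nonneg hτ.1]
    exact mul_le_of_le_one_left (norm_nonneg _) hτ.2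
  have hmem : ∀ τ ∈ Icc (0 : ℝ) 1, v + τ • z ∈ sys.V := fun τ hτ =>
    hV (mem_ball.mpr ((hd τ hτ).trans_lt hz1))
  have hder : ∀ τ ∈ Icc (0 : ℝ) 1, HasDerivAt (fun τ : ℝ => φ (v + τ • z) - τ ^ 2 / 2 * b)
      ((fderiv ℝ sys.η (v + τ • z) - fderiv ℝ sys.η v) (A (v + τ • z) z) - τ * b) τ := by
    intro τ hτ
    have h1 : HasDerivAt (fun τ : ℝ => v + τ • z) z τ := by
      simpa using ((hasDerivAt_id τ).smul_const z).const_add v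
    have h2 := (hφ _ (hmem τ hτ)).comp_hasDerivAt τ h1
    have h3 : HasDerivAt (fun τ : ℝ => τ ^ 2 / 2 * b) (τ * b) τ := by
      have := ((hasDerivAt_pow 2 τ).div_const 2).mul_const b
      refine this.congr_deriv ?_
      norm_num
    exact h2.sub h3
  have hbound : ∀ τ ∈ Ico (0 : ℝ) 1,
      ‖(fderiv ℝ sys.η (v + τ • z) - fderiv ℝ sys.η v) (A (v + τ • z) z) - τ * b‖ ≤
        ε * ‖z‖ ^ 2 := by
    intro τ hτ'
    have hτ := Ico_subset_Icc_self hτ'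
    have h1 := hη ((hd τ hτ).trans_lt hz3)
    rw [add_sub_cancel_left] at h1
    have h2 := (hA' ((hd τ hτ).trans_lt hz2)).le
    rw [dist_eq_norm] at h2
    have hτz : ‖τ • z‖ ≤ ‖z‖ := by
      have := hd τ hτ
      rwa [dist_eq_norm, add_sub_cancel_left] at this
    have hsplit : (fderiv ℝ sys.η (v + τ • z) - fderiv ℝ sys.η v) (A (v + τ • z) z) - τ * b =
        (fderiv ℝ sys.η (v + τ • z) - fderiv ℝ sys.η v - B (τ • z)) (A (v + τ • z) z) +
          B (τ • z) ((A (v + τ • z) - A v) z) := by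
      simp only [hb, _root_.sub_apply, map_sub, map_smul,
        _root_.smul_apply, smul_eq_mul]
      ring
    have hAn : ‖A (v + τ • z)‖ ≤ ‖A v‖ + 1 := by
      have := norm_le_norm_add_norm_sub' (A (v + τ • z)) (A v)
      linarith
    rw [hsplit]
    calc _ ≤ ‖(fderiv ℝ sys.η (v + τ • z) - fderiv ℝ sys.η v - B (τ • z)) (A (v + τ • z) z)‖ +
          ‖B (τ • z) ((A (v + τ • z) - A v) z)‖ := norm_add_le _ _
      _ ≤ (ε₁ * ‖z‖) * ((‖A v‖ + 1) * ‖z‖) + (‖B‖ * ‖z‖) * (ε₁ * ‖z‖) := by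
          gcongr
          · refine (ContinuousLinearMap.le_opNorm _ _).trans ?_
            gcongr
            · exact h1.trans (by gcongr)
            · exact (ContinuousLinearMap.le_opNorm _ _).trans (by gcongr)
          · refine (ContinuousLinearMap.le_opNorm _ _).trans ?_
            gcongr
            · exact (ContinuousLinearMap.le_opNorm _ _).trans (by gcongr)
            · exact (ContinuousLinearMap.le_opNorm _ _).trans (by gcongr)
      _ = ε₁ * (‖A v‖ + 1 + ‖B‖) * ‖z‖ ^ 2 := by ring
      _ ≤ ε * ‖z‖ ^ 2 := by gcongr
  have := norm_image_sub_le_of_norm_deriv_le_segment_01'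
    (fun τ hτ => (hder τ hτ).hasDerivWithinAt) hbound
  simp only [Real.norm_eq_abs] at this
  convert this using 2
  simp only [hz, hb, one_smul, zero_smul, add_zero, add_sub_cancel]
  ring

theorem taylor_relEntropy (hv : v ∈ sys.V) {ε : ℝ} (hε : 0 < ε) :
    ∃ r > 0, ball v r ⊆ sys.V ∧ ∀ w, dist w v < r →
      |sys.relEntropy w v - fderiv ℝ (fderiv ℝ sys.η) v (w - v) (w - v) / 2| ≤
        ε * ‖w - v‖ ^ 2 := by
  obtain ⟨r, hr, hV, h⟩ := taylor_of_hasFDerivAt hv (φ := fun w => sys.relEntropy w v)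
    (A := fun _ => ContinuousLinearMap.id ℝ (State n)) continuousAt_const
    (fun w hw => by simpa using hasFDerivAt_relEntropy hw v) hε
  refine ⟨r, hr, hV, fun w hw => ?_⟩
  simpa [relEntropy_self] using h w hw

theorem taylor_relFlux (hv : v ∈ sys.V) {ε : ℝ} (hε : 0 < ε) :
    ∃ r > 0, ball v r ⊆ sys.V ∧ ∀ w, dist w v < r →
      |sys.relFlux w v - fderiv ℝ (fderiv ℝ sys.η) v (w - v) (fderiv ℝ sys.f v (w - v)) / 2| ≤
        ε * ‖w - v‖ ^ 2 := by
  obtain ⟨r, hr, hV, h⟩ := taylor_of_hasFDerivAt hv (φ := fun w => sys.relFlux w v)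
    (A := fderiv ℝ sys.f) (contDiffAt_fderiv_f hv).continuousAt
    (fun w hw => hasFDerivAt_relFlux hw v) hε
  refine ⟨r, hr, hV, fun w hw => ?_⟩
  simpa [relFlux_self] using h w hw

theorem exists_relEntropy_relFlux_le (hv : v ∈ sys.V) :
    ∃ C > 0, ∃ r > 0, ball v r ⊆ sys.V ∧ ∀ w, dist w v < r →
      |sys.relEntropy w v| ≤ C * ‖w - v‖ ^ 2 ∧ |sys.relFlux w v| ≤ C * ‖w - v‖ ^ 2 := by
  obtain ⟨r₁, hr₁, hV, h1⟩ := taylor_relEntropy hv one_pos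
  obtain ⟨r₂, hr₂, -, h2⟩ := taylor_relFlux hv one_pos
  set B := fderiv ℝ (fderiv ℝ sys.η) v with hB
  set A := fderiv ℝ sys.f v with hA
  refine ⟨‖B‖ * (1 + ‖A‖) + 1, by positivity, min r₁ r₂, lt_min hr₁ hr₂,
    (ball_subset_ball (min_le_left _ _)).trans hV, fun w hw => ?_⟩
  obtain ⟨hw1, hw2⟩ := lt_min_iff.mp hw
  have h3 := abs_le.mp (h1 w hw1)
  have h4 := abs_le.mp (h2 w hw2)
  set z := w - v
  have h5 : |B z z| ≤ ‖B‖ * ‖z‖ ^ 2 := by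
    have := B.le_opNorm₂ z z
    rw [Real.norm_eq_abs] at this
    linarith
  have h6 : |B z (A z)| ≤ ‖B‖ * ‖A‖ * ‖z‖ ^ 2 := by
    have h7 := B.le_opNorm₂ z (A z)
    rw [Real.norm_eq_abs] at h7
    have h8 := A.le_opNorm z
    calc _ ≤ ‖B‖ * ‖z‖ * ‖A z‖ := h7
      _ ≤ ‖B‖ * ‖z‖ * (‖A‖ * ‖z‖) := by gcongr
      _ = _ := by ring
  have h9 : 0 ≤ ‖B‖ * ‖z‖ ^ 2 := by positivity
  have h10 : 0 ≤ ‖B‖ * ‖A‖ * ‖z‖ ^ 2 := by positivity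
  rw [abs_le] at h5 h6
  constructor <;> rw [abs_le] <;> constructor <;> linarith [h3.1, h3.2, h4.1, h4.2, h5.1, h5.2,
    h6.1, h6.2]

theorem exists_le_relEntropy (hv : v ∈ sys.V) :
    ∃ c > 0, ∃ r > 0, ball v r ⊆ sys.V ∧ ∀ w, dist w v < r →
      c * ‖w - v‖ ^ 2 ≤ sys.relEntropy w v := by
  obtain ⟨b, hb, hB⟩ := exists_hessian_lower hv
  obtain ⟨r, hr, hV, h⟩ := taylor_relEntropy hv (ε := b / 4) (by positivity)
  refine ⟨b / 4, by positivity, r, hr, hV, fun w hw => ?_⟩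
  linarith [(abs_le.mp (h w hw)).1, hB (w - v)]

/-- Up to an arbitrarily small error, the relative entropy flux is bounded from below by the
smallest characteristic speed times the relative entropy. -/
theorem exists_speedMin_mul_relEntropy_le (hv : v ∈ sys.V) {ε : ℝ} (hε : 0 < ε) :
    ∃ r > 0, ball v r ⊆ sys.V ∧ ∀ w, dist w v < r →
      (sys.speedMin v - ε) * sys.relEntropy w v ≤ sys.relFlux w v := by
  obtain ⟨b, hb, hB⟩ := exists_hessian_lower hv
  set l := sys.speedMin v with hl
  set ε₁ := ε * b / (2 * (1 + |l - ε|)) with hε₁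
  have hpos : 0 < 1 + |l - ε| := by positivity
  have hε₁0 : 0 < ε₁ := by positivity
  have hmul : ε₁ * (1 + |l - ε|) = ε * b / 2 := by
    rw [hε₁]
    field_simp
  obtain ⟨r₁, hr₁, hV, h1⟩ := taylor_relEntropy hv hε₁0
  obtain ⟨r₂, hr₂, -, h2⟩ := taylor_relFlux hv hε₁0
  refine ⟨min r₁ r₂, lt_min hr₁ hr₂, (ball_subset_ball (min_le_left _ _)).trans hV,
    fun w hw => ?_⟩
  obtain ⟨hw1, hw2⟩ := lt_min_iff.mp hw
  have h3 := h1 w hw1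
  have h4 := abs_le.mp (h2 w hw2)
  have h5 := speedMin_mul_le hv (w - v)
  have h6 := hB (w - v)
  set z := w - v
  set X := fderiv ℝ (fderiv ℝ sys.η) v z z
  have h7 : (l - ε) * (sys.relEntropy w v - X / 2) ≤ |l - ε| * (ε₁ * ‖z‖ ^ 2) := by
    refine (le_abs_self _).trans ?_
    rw [abs_mul]
    gcongr
  have h8 : ε₁ * (1 + |l - ε|) * ‖z‖ ^ 2 = ε * (b * ‖z‖ ^ 2) / 2 := by
    rw [hmul]
    ring
  have h9 : ε * (b * ‖z‖ ^ 2) ≤ ε * X := by gcongr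
  linarith [h4.1]

/-- Strict convexity of the entropy: the relative entropy of two different states is positive. -/
theorem relEntropy_pos {w : State n} (hv : v ∈ sys.V) (hw : w ∈ sys.V) (hne : w ≠ v) :
    0 < sys.relEntropy w v := by
  set z := w - v with hz
  have hz0 : z ≠ 0 := sub_ne_zero.mpr hne
  have hmem : ∀ τ ∈ Icc (0 : ℝ) 1, v + τ • z ∈ sys.V := by
    intro τ hτ
    have := sys.convex_V hv hw (sub_nonneg.mpr hτ.2) hτ.1 (by ring)
    convert this using 1
    simp only [hz, smul_sub, sub_smul, one_smul]
    abel
  have hline : ∀ τ : ℝ, HasDerivAt (fun τ : ℝ => v + τ • z) z τ := fun τ => by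
    simpa using ((hasDerivAt_id τ).smul_const z).const_add v
  have hd1 : ∀ τ ∈ Icc (0 : ℝ) 1, HasDerivAt (fun τ : ℝ => sys.relEntropy (v + τ • z) v)
      ((fderiv ℝ sys.η (v + τ • z) - fderiv ℝ sys.η v) z) τ := fun τ hτ => by
    have := (hasFDerivAt_relEntropy (hmem τ hτ) v).comp_hasDerivAt τ (hline τ)
    exact this
  have hd2 : ∀ τ ∈ Icc (0 : ℝ) 1, HasDerivAt
      (fun τ : ℝ => (fderiv ℝ sys.η (v + τ • z) - fderiv ℝ sys.η v) z)
      (fderiv ℝ (fderiv ℝ sys.η) (v + τ • z) z z) τ := by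
    intro τ hτ
    have h1 := (hasFDerivAt_fderiv_η (hmem τ hτ)).comp_hasDerivAt τ (hline τ)
    have h2 := (h1.sub_const (fderiv ℝ sys.η v)).clm_apply (hasDerivAt_const τ z)
    simpa using h2
  have hmono2 : StrictMonoOn (fun τ : ℝ => (fderiv ℝ sys.η (v + τ • z) - fderiv ℝ sys.η v) z)
      (Icc 0 1) := by
    apply strictMonoOn_of_deriv_pos (convex_Icc 0 1)
    · exact fun τ hτ => (hd2 τ hτ).continuousAt.continuousWithinAt
    · intro τ hτ
      rw [interior_Icc] at hτ
      rw [(hd2 τ (Ioo_subset_Icc_self hτ)).deriv]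
      exact sys.hessian_pos _ (hmem τ (Ioo_subset_Icc_self hτ)) z hz0
  have hmono1 : StrictMonoOn (fun τ : ℝ => sys.relEntropy (v + τ • z) v) (Icc 0 1) := by
    apply strictMonoOn_of_deriv_pos (convex_Icc 0 1)
    · exact fun τ hτ => (hd1 τ hτ).continuousAt.continuousWithinAt
    · intro τ hτ
      rw [interior_Icc] at hτ
      rw [(hd1 τ (Ioo_subset_Icc_self hτ)).deriv]
      have := hmono2 (left_mem_Icc.mpr zero_le_one) (Ioo_subset_Icc_self hτ) hτ.1
      simpa using this
  have := hmono1 (left_mem_Icc.mpr zero_le_one) (right_mem_Icc.mpr zero_le_one) one_pos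
  simpa [hz, relEntropy_self] using this

theorem relEntropy_nonneg {w : State n} (hv : v ∈ sys.V) (hw : w ∈ sys.V) :
    0 ≤ sys.relEntropy w v := by
  by_cases h : w = v
  · rw [h, relEntropy_self]
  · exact (relEntropy_pos hv hw h).le

end Smooth

variable {sys}

/-- The characteristic speeds are bounded on compact sets. -/
theorem exists_abs_charSpeed_le {K : Set (State n)} (hK : IsCompact K) (hKV : K ⊆ sys.V) :
    ∃ C > 0, ∀ v ∈ K, ∀ μ ∈ sys.charSpeeds v, |μ| ≤ C := by
  have hc : ContinuousOn (fun v => fderiv ℝ sys.f v) K := fun v hv =>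
    (contDiffAt_fderiv_f (hKV hv)).continuousAt.continuousWithinAt
  obtain ⟨C, hC⟩ := hK.exists_bound_of_continuousOn hc
  refine ⟨max C 1, by positivity, fun v hv μ hμ => ?_⟩
  exact (abs_charSpeed_le hμ).trans ((hC v hv).trans (le_max_left _ _))

theorem charSpeeds_nonempty {v : State n} (hgap : sys.speedMin v < sys.speedMax v) :
    (sys.charSpeeds v).Nonempty := by
  by_contra h
  rw [not_nonempty_iff_eq_empty] at h
  simp [speedMin, speedMax, h] at hgap

theorem abs_speedMin_le {v : State n} {C : ℝ} (hne : (sys.charSpeeds v).Nonempty)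
    (hC : ∀ μ ∈ sys.charSpeeds v, |μ| ≤ C) : |sys.speedMin v| ≤ C := by
  obtain ⟨μ, hμ⟩ := hne
  rw [abs_le]
  exact ⟨le_csInf ⟨μ, hμ⟩ fun b hb => neg_le_of_abs_le (hC b hb),
    (csInf_le (bddBelow_charSpeeds v) hμ).trans (le_of_abs_le (hC μ hμ))⟩

end EntropySystem

/-! ### Dissipation along the shock curves -/

namespace EntropySystem

variable {n : ℕ} (sys : EntropySystem n)

/-- The flux of the entropy relative to `v` through a line of speed `σ`. -/
noncomputable def movingFlux (σ : ℝ) (w v : State n) : ℝ := sys.relFlux w v - σ * sys.relEntropy w v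

theorem movingFlux_self (σ : ℝ) (v : State n) : sys.movingFlux σ v v = 0 := by
  simp [movingFlux, relEntropy_self, relFlux_self]

end EntropySystem

section Curves

variable {n : ℕ} {sys : EntropySystem n} {𝒮 : ShockCurves n} {v : State n}

theorem ShockCurves.mem_params_of_le {u : State n} {s t : ℝ} (ht : t ∈ 𝒮.params u) (hs : 0 ≤ s)
    (hst : s ≤ t) : s ∈ 𝒮.params u :=
  ⟨hs, (ENNReal.ofReal_le_ofReal hst).trans_lt ht.2⟩

theorem ShockCurves.convex_params (u : State n) : Convex ℝ (𝒮.params u) := by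
  apply OrdConnected.convex
  rw [ordConnected_iff]
  intro s hs t ht _ x hx
  exact ShockCurves.mem_params_of_le ht (hs.1.trans hx.1) hx.2

theorem ShockCurves.interior_params_subset (u : State n) :
    interior (𝒮.params u) ⊆ {s | s ∈ 𝒮.params u ∧ 0 < s} := by
  intro s hs
  refine ⟨interior_subset hs, ?_⟩
  have : interior (𝒮.params u) ⊆ interior (Ici (0 : ℝ)) := interior_mono fun s hs => hs.1
  rw [interior_Ici] at this
  exact this hs

namespace IsShockFamily

theorem isOpen_dom (F : IsShockFamily sys 𝒮 v) : IsOpen 𝒮.dom := by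
  obtain ⟨r, -, h⟩ := F.dom_eq
  rw [h]
  exact isOpen_ball.inter sys.isOpen_V

theorem dom_subset (F : IsShockFamily sys 𝒮 v) : 𝒮.dom ⊆ sys.V := by
  obtain ⟨r, -, h⟩ := F.dom_eq
  rw [h]
  exact inter_subset_right

theorem zero_mem_params (F : IsShockFamily sys 𝒮 v) {u : State n} (hu : u ∈ 𝒮.dom) :
    0 ∈ 𝒮.params u := ⟨le_rfl, by simpa using F.len_pos u hu⟩

/-- The domain of the family is a neighbourhood of each of its points with positive parameter. -/
theorem domain_mem_nhds (F : IsShockFamily sys 𝒮 v) {u : State n} (hu : u ∈ 𝒮.dom) {s : ℝ}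
    (hs : s ∈ 𝒮.params u) (hs0 : 0 < s) :
    {p : ℝ × State n | p.2 ∈ 𝒮.dom ∧ p.1 ∈ 𝒮.params p.2} ∈ 𝓝 (s, u) := by
  have h1 : ∀ᶠ p : ℝ × State n in 𝓝 (s, u), p.2 ∈ 𝒮.dom :=
    continuousAt_snd.eventually (F.isOpen_dom.mem_nhds hu)
  have h2 : ∀ᶠ p : ℝ × State n in 𝓝 (s, u), 0 < p.1 :=
    continuousAt_fst.eventually (lt_mem_nhds hs0)
  have h3 : ∀ᶠ p : ℝ × State n in 𝓝 (s, u), p.2 ∈ 𝒮.dom → ENNReal.ofReal p.1 < 𝒮.len p.2 := by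
    rcases F.len_lipschitz with h | ⟨hfin, L, hL⟩
    · filter_upwards with p hp
      rw [h _ hp]
      exact ENNReal.ofReal_lt_top
    · have hc : ContinuousAt (fun p : ℝ × State n => (𝒮.len p.2).toReal - p.1) (s, u) := by
        apply ContinuousAt.sub _ continuousAt_fst
        exact ContinuousAt.comp (f := Prod.snd) (g := fun u => (𝒮.len u).toReal)
          (hL.continuousOn.continuousAt (F.isOpen_dom.mem_nhds hu)) continuousAt_snd
      have hpos : 0 < (𝒮.len u).toReal - s := by
        rw [sub_pos, ← ENNReal.ofReal_lt_iff_lt_toReal hs0.le (hfin u hu)]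
        exact hs.2
      filter_upwards [hc.eventually (lt_mem_nhds hpos), h2] with p hp hp2 hpd
      rw [ENNReal.ofReal_lt_iff_lt_toReal hp2.le (hfin _ hpd)]
      exact sub_pos.mp hp
  filter_upwards [h1, h2, h3] with p h1 h2 h3
  exact ⟨h1, h2.le, h3 h1⟩

theorem eventually_mem_params (F : IsShockFamily sys 𝒮 v) {u : State n} (hu : u ∈ 𝒮.dom) {s : ℝ}
    (hs : s ∈ 𝒮.params u) (hs0 : 0 < s) : ∀ᶠ τ in 𝓝 s, τ ∈ 𝒮.params u := by
  have h : ContinuousAt (fun τ : ℝ => (τ, u)) s := by fun_prop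
  exact (h.eventually (F.domain_mem_nhds hu hs hs0)).mono fun τ hτ => hτ.2

theorem contDiffAt_curve (F : IsShockFamily sys 𝒮 v) {u : State n} (hu : u ∈ 𝒮.dom) {s : ℝ}
    (hs : s ∈ 𝒮.params u) (hs0 : 0 < s) :
    ContDiffAt ℝ 1 (fun p : ℝ × State n => 𝒮.curve p.2 p.1) (s, u) :=
  F.contDiffOn_curve.contDiffAt (F.domain_mem_nhds hu hs hs0)

theorem contDiffAt_speed (F : IsShockFamily sys 𝒮 v) {u : State n} (hu : u ∈ 𝒮.dom) {s : ℝ}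
    (hs : s ∈ 𝒮.params u) (hs0 : 0 < s) :
    ContDiffAt ℝ 1 (fun p : ℝ × State n => 𝒮.speed p.2 p.1) (s, u) :=
  F.contDiffOn_speed.contDiffAt (F.domain_mem_nhds hu hs hs0)

theorem hasDerivAt_curve (F : IsShockFamily sys 𝒮 v) {u : State n} (hu : u ∈ 𝒮.dom) {s : ℝ}
    (hs : s ∈ 𝒮.params u) (hs0 : 0 < s) :
    HasDerivAt (𝒮.curve u) (deriv (𝒮.curve u) s) s := by
  have h : DifferentiableAt ℝ (fun τ : ℝ => (τ, u)) s := by fun_prop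
  exact (((F.contDiffAt_curve hu hs hs0).differentiableAt (by norm_num)).comp s h).hasDerivAt

theorem hasDerivAt_speed (F : IsShockFamily sys 𝒮 v) {u : State n} (hu : u ∈ 𝒮.dom) {s : ℝ}
    (hs : s ∈ 𝒮.params u) (hs0 : 0 < s) :
    HasDerivAt (𝒮.speed u) (deriv (𝒮.speed u) s) s := by
  have h : DifferentiableAt ℝ (fun τ : ℝ => (τ, u)) s := by fun_prop
  exact (((F.contDiffAt_speed hu hs hs0).differentiableAt (by norm_num)).comp s h).hasDerivAt

theorem continuousOn_curve (F : IsShockFamily sys 𝒮 v) {u : State n} (hu : u ∈ 𝒮.dom) :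
    ContinuousOn (𝒮.curve u) (𝒮.params u) :=
  F.contDiffOn_curve.continuousOn.comp (f := fun τ : ℝ => (τ, u)) (by fun_prop)
    fun _ hs => ⟨hu, hs⟩

theorem continuousOn_speed (F : IsShockFamily sys 𝒮 v) {u : State n} (hu : u ∈ 𝒮.dom) :
    ContinuousOn (𝒮.speed u) (𝒮.params u) :=
  F.contDiffOn_speed.continuousOn.comp (f := fun τ : ℝ => (τ, u)) (by fun_prop)
    fun _ hs => ⟨hu, hs⟩

/-- Along a shock curve, the flux relative to a fixed state `w` varies according to the difference
between the strength of the shock and the entropy of `u` relative to `w`. -/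
theorem hasDerivAt_movingFlux (F : IsShockFamily sys 𝒮 v) {u : State n} (hu : u ∈ 𝒮.dom) {s : ℝ}
    (hs : s ∈ 𝒮.params u) (hs0 : 0 < s) (w : State n) :
    HasDerivAt (fun τ => sys.movingFlux (𝒮.speed u τ) (𝒮.curve u τ) w)
      (deriv (𝒮.speed u) s * (sys.relEntropy u (𝒮.curve u s) - sys.relEntropy u w)) s := by
  have hc := F.hasDerivAt_curve hu hs hs0
  have hσ := F.hasDerivAt_speed hu hs hs0
  set c' := deriv (𝒮.curve u) s
  set σ' := deriv (𝒮.speed u) s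
  have hV := F.mapsTo u hu s hs
  have h1 := (EntropySystem.hasFDerivAt_relFlux hV w).comp_hasDerivAt s hc
  have h2 := (EntropySystem.hasFDerivAt_relEntropy hV w).comp_hasDerivAt s hc
  have h3 := h1.sub (hσ.mul h2)
  -- the derivative of the Rankine-Hugoniot relation
  have hRH : fderiv ℝ sys.f (𝒮.curve u s) c' = 𝒮.speed u s • c' + σ' • (𝒮.curve u s - u) := by
    have h4 := ((EntropySystem.hasFDerivAt_f hV).comp_hasDerivAt s hc).sub_const (sys.f u)
    have h5 := hσ.smul (hc.sub_const u)
    have h6 : (fun τ => 𝒮.speed u τ • (𝒮.curve u τ - u)) =ᶠ[𝓝 s]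
        fun τ => (sys.f ∘ 𝒮.curve u) τ - sys.f u := by
      filter_upwards [F.eventually_mem_params hu hs hs0] with τ hτ
      exact (F.rankineHugoniot u hu τ hτ).symm
    exact (h4.congr_of_eventuallyEq h6).unique h5
  refine h3.congr_deriv ?_
  simp only [ContinuousLinearMap.comp_apply, hRH, EntropySystem.relEntropy, Function.comp,
    _root_.sub_apply, map_add, map_sub, map_smul, smul_eq_mul]
  ring

theorem continuousOn_relEntropy_curve (F : IsShockFamily sys 𝒮 v) {u : State n} (hu : u ∈ 𝒮.dom) :
    ContinuousOn (fun τ => sys.relEntropy u (𝒮.curve u τ)) (𝒮.params u) := by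
  have hc := F.continuousOn_curve hu
  have hmaps : MapsTo (𝒮.curve u) (𝒮.params u) sys.V := F.mapsTo u hu
  have h1 : ContinuousOn (fun τ => sys.η (𝒮.curve u τ)) (𝒮.params u) :=
    sys.contDiffOn_η.continuousOn.comp hc hmaps
  have h2 : ContinuousOn (fun τ => fderiv ℝ sys.η (𝒮.curve u τ)) (𝒮.params u) := by
    have : ContinuousOn (fderiv ℝ sys.η) sys.V := fun w hw =>
      (EntropySystem.contDiffAt_fderiv_η hw).continuousAt.continuousWithinAt
    exact this.comp hc hmaps
  exact (continuousOn_const.sub h1).sub (h2.clm_apply (continuousOn_const.sub hc))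

theorem continuousOn_movingFlux (F : IsShockFamily sys 𝒮 v) {u : State n} (hu : u ∈ 𝒮.dom)
    (w : State n) :
    ContinuousOn (fun τ => sys.movingFlux (𝒮.speed u τ) (𝒮.curve u τ) w) (𝒮.params u) := by
  have hc := F.continuousOn_curve hu
  have hmaps : MapsTo (𝒮.curve u) (𝒮.params u) sys.V := F.mapsTo u hu
  exact ((EntropySystem.continuousOn_relFlux w).comp hc hmaps).sub
    ((F.continuousOn_speed hu).mul ((EntropySystem.continuousOn_relEntropy w).comp hc hmaps))

theorem strictMonoOn_relEntropy (F : IsShockFamily sys 𝒮 v) {u : State n} (hu : u ∈ 𝒮.dom) :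
    StrictMonoOn (fun τ => sys.relEntropy u (𝒮.curve u τ)) (𝒮.params u) := by
  apply strictMonoOn_of_deriv_pos (ShockCurves.convex_params u) (F.continuousOn_relEntropy_curve hu)
  intro s hs
  obtain ⟨h1, h2⟩ := ShockCurves.interior_params_subset u hs
  exact F.strengthens u hu s h1 h2

/-- The parameter of a point of a shock curve is unique. -/
theorem injOn_curve (F : IsShockFamily sys 𝒮 v) {u : State n} (hu : u ∈ 𝒮.dom) :
    InjOn (𝒮.curve u) (𝒮.params u) := by
  intro s hs t ht hst
  apply (F.strictMonoOn_relEntropy hu).injOn hs ht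
  simp only [hst]

theorem isShockAt_unique (F : IsShockFamily sys 𝒮 v) {u w : State n} {σ σ' r r' : ℝ}
    (h : 𝒮.IsShockAt u w σ r) (h' : 𝒮.IsShockAt u w σ' r') : r = r' ∧ σ = σ' := by
  have hr : r = r' := F.injOn_curve h.1 h.2.1 h'.2.1 (h.2.2.1.trans h'.2.2.1.symm)
  refine ⟨hr, ?_⟩
  rw [← h.2.2.2, ← h'.2.2.2, hr]

end IsShockFamily

namespace HypH

variable {uL : State n}

theorem strictAntiOn_speed (H : HypH sys 𝒮 uL) {u : State n} (hu : u ∈ 𝒮.dom) :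
    StrictAntiOn (𝒮.speed u) (𝒮.params u) := by
  apply strictAntiOn_of_deriv_neg (ShockCurves.convex_params u) (H.family.continuousOn_speed hu)
  intro s hs
  obtain ⟨h1, h2⟩ := ShockCurves.interior_params_subset u hs
  exact H.liu u hu s h1 h2

theorem speed_le (H : HypH sys 𝒮 uL) {u : State n} (hu : u ∈ 𝒮.dom) {s : ℝ}
    (hs : s ∈ 𝒮.params u) : 𝒮.speed u s ≤ sys.speedMin u := by
  rw [← H.speed_zero u hu]
  exact (H.strictAntiOn_speed hu).antitoneOn (H.family.zero_mem_params hu) hs hs.1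

theorem continuousOn_speedMin (H : HypH sys 𝒮 uL) : ContinuousOn sys.speedMin 𝒮.dom := by
  have h : ContinuousOn (fun u => 𝒮.speed u 0) 𝒮.dom :=
    H.family.contDiffOn_speed.continuousOn.comp (f := fun u : State n => ((0 : ℝ), u))
      (by fun_prop) fun u hu => ⟨hu, H.family.zero_mem_params hu⟩
  exact h.congr fun u hu => (H.speed_zero u hu).symm

/-- Before the strength of the shock reaches the entropy of `u` relative to `w`, the flux
increases. -/
theorem movingFlux_lt_of_lt (H : HypH sys 𝒮 uL) {u w : State n} (hu : u ∈ 𝒮.dom) {s s₀ : ℝ}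
    (hs : 0 ≤ s) (hss : s < s₀) (hs₀ : s₀ ∈ 𝒮.params u)
    (hle : sys.relEntropy u (𝒮.curve u s₀) ≤ sys.relEntropy u w) :
    sys.movingFlux (𝒮.speed u s) (𝒮.curve u s) w <
      sys.movingFlux (𝒮.speed u s₀) (𝒮.curve u s₀) w := by
  have hsub : Icc s s₀ ⊆ 𝒮.params u := fun τ hτ =>
    ShockCurves.mem_params_of_le hs₀ (hs.trans hτ.1) hτ.2
  have hmono : StrictMonoOn (fun τ => sys.movingFlux (𝒮.speed u τ) (𝒮.curve u τ) w)
      (Icc s s₀) := by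
    apply strictMonoOn_of_deriv_pos (convex_Icc s s₀)
      ((H.family.continuousOn_movingFlux hu w).mono hsub)
    intro τ hτ
    rw [interior_Icc] at hτ
    have hτp := hsub (Ioo_subset_Icc_self hτ)
    have hτ0 : 0 < τ := hs.trans_lt hτ.1
    rw [(H.family.hasDerivAt_movingFlux hu hτp hτ0 w).deriv]
    have h1 := H.liu u hu τ hτp hτ0
    have h2 := H.family.strictMonoOn_relEntropy hu hτp hs₀ hτ.2
    exact mul_pos_of_neg_of_neg h1 (by linarith)
  exact hmono (left_mem_Icc.mpr hss.le) (right_mem_Icc.mpr hss.le) hss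

/-- After the strength of the shock has reached the entropy of `u` relative to `w`, the flux
decreases. -/
theorem movingFlux_lt_of_gt (H : HypH sys 𝒮 uL) {u w : State n} (hu : u ∈ 𝒮.dom) {s s₀ : ℝ}
    (hs₀ : 0 ≤ s₀) (hss : s₀ < s) (hs : s ∈ 𝒮.params u)
    (hle : sys.relEntropy u w ≤ sys.relEntropy u (𝒮.curve u s₀)) :
    sys.movingFlux (𝒮.speed u s) (𝒮.curve u s) w <
      sys.movingFlux (𝒮.speed u s₀) (𝒮.curve u s₀) w := by
  have hsub : Icc s₀ s ⊆ 𝒮.params u := fun τ hτ =>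
    ShockCurves.mem_params_of_le hs (hs₀.trans hτ.1) hτ.2
  have hanti : StrictAntiOn (fun τ => sys.movingFlux (𝒮.speed u τ) (𝒮.curve u τ) w)
      (Icc s₀ s) := by
    apply strictAntiOn_of_deriv_neg (convex_Icc s₀ s)
      ((H.family.continuousOn_movingFlux hu w).mono hsub)
    intro τ hτ
    rw [interior_Icc] at hτ
    have hτp := hsub (Ioo_subset_Icc_self hτ)
    have hτ0 : 0 < τ := hs₀.trans_lt hτ.1
    rw [(H.family.hasDerivAt_movingFlux hu hτp hτ0 w).deriv]
    have h1 := H.liu u hu τ hτp hτ0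
    have h2 := H.family.strictMonoOn_relEntropy hu
      (ShockCurves.mem_params_of_le hs hs₀ hss.le) hτp hτ.1
    exact mul_neg_of_neg_of_pos h1 (by linarith)
  exact hanti (left_mem_Icc.mpr hss.le) (right_mem_Icc.mpr hss.le) hss

end HypH

/-- A function which is `C¹` near `(s₀, u₀)` is Lipschitz there, and its partial derivative in `s`
is continuous. -/
theorem exists_nhds_partial_deriv {n : ℕ} {Φ : ℝ × State n → ℝ} {s₀ : ℝ} {u₀ : State n}
    (hΦ : ContDiffAt ℝ 1 Φ (s₀, u₀)) {ε : ℝ} (hε : 0 < ε) :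
    ∃ C > 0, ∃ r > 0, ∀ s u, |s - s₀| < r → dist u u₀ < r →
      |deriv (fun τ => Φ (τ, u)) s - deriv (fun τ => Φ (τ, u₀)) s₀| < ε ∧
      DifferentiableAt ℝ (fun τ => Φ (τ, u)) s ∧
      |Φ (s, u) - Φ (s₀, u₀)| ≤ C * (|s - s₀| + ‖u - u₀‖) := by
  obtain ⟨L, T, hT, hL⟩ := hΦ.exists_lipschitzOnWith
  have h1 : ∀ᶠ p in 𝓝 (s₀, u₀), DifferentiableAt ℝ Φ p := by
    filter_upwards [hΦ.eventually (by simp)] with p hp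
    exact hp.differentiableAt (by norm_num)
  have h2 : ContinuousAt (fun p => fderiv ℝ Φ p ((1 : ℝ), (0 : State n))) (s₀, u₀) := by
    have := (hΦ.fderiv_right (m := 0) (by norm_num)).continuousAt
    exact this.clm_apply continuousAt_const
  have h3 := Metric.continuousAt_iff'.mp h2 ε hε
  obtain ⟨r, hr, h4⟩ := Metric.eventually_nhds_iff.mp ((h1.and h3).and hT)
  have hd : ∀ p, DifferentiableAt ℝ Φ p →
      HasDerivAt (fun τ => Φ (τ, p.2)) (fderiv ℝ Φ p (1, 0)) p.1 := by
    intro p hp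
    have h5 : HasDerivAt (fun τ : ℝ => (τ, p.2)) ((1 : ℝ), (0 : State n)) p.1 :=
      (hasDerivAt_id p.1).prodMk (hasDerivAt_const p.1 p.2)
    exact hp.hasFDerivAt.comp_hasDerivAt p.1 h5
  refine ⟨L + 1, by positivity, r, hr, fun s u hs hu => ?_⟩
  have hdist : dist (s, u) (s₀, u₀) < r := by
    rw [Prod.dist_eq, Real.dist_eq]
    exact max_lt hs hu
  obtain ⟨⟨h5, h6⟩, h7⟩ := h4 hdist
  have h8 := hd _ h5
  have h9 := hd _ h1.self_of_nhds
  refine ⟨?_, h8.differentiableAt, ?_⟩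
  · rw [h8.deriv, h9.deriv, ← Real.dist_eq]
    exact h6
  · have h10 := hL.dist_le_mul _ h7 _ (mem_of_mem_nhds hT)
    rw [Real.dist_eq, Prod.dist_eq, Real.dist_eq, dist_eq_norm] at h10
    refine h10.trans ?_
    have h11 : max |s - s₀| ‖u - u₀‖ ≤ |s - s₀| + ‖u - u₀‖ :=
      max_le (by linarith [norm_nonneg (u - u₀)]) (by linarith [abs_nonneg (s - s₀)])
    have h12 : 0 ≤ |s - s₀| + ‖u - u₀‖ := by positivity
    calc (L : ℝ) * max |s - s₀| ‖u - u₀‖ ≤ L * (|s - s₀| + ‖u - u₀‖) := by gcongr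
      _ ≤ _ := by linarith

end Curves

section Constants

variable {n : ℕ} {sys : EntropySystem n} {𝒮 : ShockCurves n} {uL : State n}

theorem IsShockFamily.contDiffAt_relEntropy_curve {v : State n} (F : IsShockFamily sys 𝒮 v)
    {u : State n} (hu : u ∈ 𝒮.dom) {s : ℝ} (hs : s ∈ 𝒮.params u) (hs0 : 0 < s) :
    ContDiffAt ℝ 1 (fun p : ℝ × State n => sys.relEntropy p.2 (𝒮.curve p.2 p.1)) (s, u) := by
  have hc := F.contDiffAt_curve hu hs hs0
  have hV := F.mapsTo u hu s hs
  have h1 : ContDiffAt ℝ 1 (fun p : ℝ × State n => sys.η p.2) (s, u) :=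
    ContDiffAt.comp (s, u) (g := sys.η) (f := Prod.snd)
      ((EntropySystem.contDiffAt_η (F.dom_subset hu)).of_le (by norm_num)) contDiffAt_snd
  have h2 : ContDiffAt ℝ 1 (fun p : ℝ × State n => sys.η (𝒮.curve p.2 p.1)) (s, u) :=
    ContDiffAt.comp (s, u) (g := sys.η) (f := fun p : ℝ × State n => 𝒮.curve p.2 p.1)
      ((EntropySystem.contDiffAt_η hV).of_le (by norm_num)) hc
  have h3 : ContDiffAt ℝ 1 (fun p : ℝ × State n => fderiv ℝ sys.η (𝒮.curve p.2 p.1)) (s, u) :=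
    ContDiffAt.comp (s, u) (g := fderiv ℝ sys.η) (f := fun p : ℝ × State n => 𝒮.curve p.2 p.1)
      (EntropySystem.contDiffAt_fderiv_η hV) hc
  exact (h1.sub h2).sub (h3.clm_apply (contDiffAt_snd.sub hc))

theorem IsShockFamily.continuousAt_movingFlux {v : State n} (F : IsShockFamily sys 𝒮 v)
    {u : State n} (hu : u ∈ 𝒮.dom) {s : ℝ} (hs : s ∈ 𝒮.params u) (hs0 : 0 < s) (w : State n) :
    ContinuousAt (fun p : ℝ × State n =>
      sys.movingFlux (𝒮.speed p.2 p.1) (𝒮.curve p.2 p.1) w) (s, u) := by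
  have hc := (F.contDiffAt_curve hu hs hs0).continuousAt
  have hσ := (F.contDiffAt_speed hu hs hs0).continuousAt
  have hV := F.mapsTo u hu s hs
  have h1 : ContinuousAt (fun p : ℝ × State n => sys.relFlux (𝒮.curve p.2 p.1) w) (s, u) :=
    ContinuousAt.comp (g := fun z => sys.relFlux z w)
      (f := fun p : ℝ × State n => 𝒮.curve p.2 p.1)
      (EntropySystem.hasFDerivAt_relFlux hV w).continuousAt hc
  have h2 : ContinuousAt (fun p : ℝ × State n => sys.relEntropy (𝒮.curve p.2 p.1) w) (s, u) :=
    ContinuousAt.comp (g := fun z => sys.relEntropy z w)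
      (f := fun p : ℝ × State n => 𝒮.curve p.2 p.1)
      (EntropySystem.hasFDerivAt_relEntropy hV w).continuousAt hc
  exact h1.sub (hσ.mul h2)

theorem continuousAt_prodMk_right {s : ℝ} {u : State n} {X : Type*} [TopologicalSpace X]
    {Φ : ℝ × State n → X} (h : ContinuousAt Φ (s, u)) : ContinuousAt (fun w => Φ (s, w)) u :=
  ContinuousAt.comp (g := Φ) (f := fun w : State n => (s, w)) h (by fun_prop)

/-- The flux relative to `uR` along the shock curves issuing from the states `u` near `uL`, for
parameters near the one of `uR`: it is quadratic at `(uL, r₁)`, and strictly concave in the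
parameter. -/
theorem HypH.exists_movingFlux_le_near (H : HypH sys 𝒮 uL) (huL : uL ∈ 𝒮.dom) {r₁ : ℝ}
    (hr₁ : r₁ ∈ 𝒮.params uL) (hr0 : 0 < r₁) :
    ∃ C > 0, ∃ κ > 0, ∃ r > 0, r < r₁ ∧ ∀ u, dist u uL < r → u ∈ 𝒮.dom ∧
      ∀ s, |s - r₁| < r → s ∈ 𝒮.params u ∧
        |𝒮.speed u s - 𝒮.speed uL r₁| ≤ C * (|s - r₁| + ‖u - uL‖) ∧
        sys.movingFlux (𝒮.speed u s) (𝒮.curve u s) (𝒮.curve uL r₁) ≤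
          C * ‖u - uL‖ ^ 2 + C * ‖u - uL‖ * |s - r₁| - κ * |s - r₁| ^ 2 := by
  have F := H.family
  set uR := 𝒮.curve uL r₁ with huR
  have hRV : uR ∈ sys.V := F.mapsTo uL huL r₁ hr₁
  set m₁ := -deriv (𝒮.speed uL) r₁ with hm₁
  set m₂ := deriv (fun τ => sys.relEntropy uL (𝒮.curve uL τ)) r₁ with hm₂
  have hm₁0 : 0 < m₁ := neg_pos.mpr (H.liu uL huL r₁ hr₁ hr0)
  have hm₂0 : 0 < m₂ := F.strengthens uL huL r₁ hr₁ hr0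
  obtain ⟨C₁, hC₁, ρ₁, hρ₁, hσ⟩ := exists_nhds_partial_deriv (F.contDiffAt_speed huL hr₁ hr0)
    (ε := m₁ / 2) (by positivity)
  obtain ⟨C₂, hC₂, ρ₂, hρ₂, hζ⟩ := exists_nhds_partial_deriv
    (F.contDiffAt_relEntropy_curve huL hr₁ hr0) (ε := m₂ / 2) (by positivity)
  obtain ⟨C₃, hC₃, ρ₃, hρ₃, -, hQ⟩ := EntropySystem.exists_relEntropy_relFlux_le hRV
  -- Lipschitz bounds for `u ↦ η(u|uR)` and for the curve
  obtain ⟨C₄, hC₄⟩ := ((EntropySystem.hasFDerivAt_relEntropy (F.dom_subset huL)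
    uR).differentiableAt.isBigO_sub).bound
  obtain ⟨L, T, hT, hL⟩ := (F.contDiffAt_curve huL hr₁ hr0).exists_lipschitzOnWith
  have hdomn := F.domain_mem_nhds huL hr₁ hr0
  obtain ⟨ρ₄, hρ₄, hev⟩ := Metric.eventually_nhds_iff.mp ((eventually_mem_set.mpr hT).and
    (eventually_mem_set.mpr hdomn))
  obtain ⟨ρ₅, hρ₅, hC₄'⟩ := Metric.eventually_nhds_iff.mp hC₄
  have hcc : ContinuousAt (fun u => 𝒮.curve u r₁) uL :=
    continuousAt_prodMk_right (F.contDiffAt_curve huL hr₁ hr0).continuousAt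
  obtain ⟨ρ₆, hρ₆, hcn⟩ := Metric.continuousAt_iff.mp hcc ρ₃ hρ₃
  set r := min r₁ (min ρ₁ (min ρ₂ (min ρ₄ (min ρ₅ ρ₆)))) / 2 with hr
  have hmin : 0 < min r₁ (min ρ₁ (min ρ₂ (min ρ₄ (min ρ₅ ρ₆)))) := by positivity
  have hr0' : 0 < r := by positivity
  have hrlt : r < min r₁ (min ρ₁ (min ρ₂ (min ρ₄ (min ρ₅ ρ₆)))) := by linarith
  simp only [lt_min_iff] at hrlt
  obtain ⟨hrr, hrρ₁, hrρ₂, hrρ₄, hrρ₅, hrρ₆⟩ := hrlt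
  set σ₁ := 𝒮.speed uL r₁ with hσ₁
  set C₅ := C₂ + |C₄| with hC₅
  have hC₅0 : 0 < C₅ := by positivity
  set C₆ := C₃ * (1 + (|σ₁| + C₁ * r)) * L ^ 2 with hC₆
  have hC₆0 : 0 ≤ C₆ := by positivity
  refine ⟨C₁ + C₆ + 2 * m₁ * C₅, by positivity, m₁ * m₂ / 8, by positivity, r, hr0', hrr,
    fun u hu => ?_⟩
  have hdom : ∀ s, |s - r₁| < r → u ∈ 𝒮.dom ∧ s ∈ 𝒮.params u ∧ (s, u) ∈ T := by
    intro s hs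
    have : dist (s, u) (r₁, uL) < ρ₄ := by
      rw [Prod.dist_eq, Real.dist_eq]
      exact max_lt (hs.trans hrρ₄) (hu.trans hrρ₄)
    obtain ⟨h1, h2⟩ := hev this
    exact ⟨h2.1, h2.2, h1⟩
  have hr₁r : |r₁ - r₁| < r := by simpa using hr0'
  obtain ⟨hud, hr₁u, hr₁T⟩ := hdom r₁ hr₁r
  set d := ‖u - uL‖ with hd
  have hd0 : 0 ≤ d := norm_nonneg _
  -- the value at `s = r₁`
  have hbase : sys.movingFlux (𝒮.speed u r₁) (𝒮.curve u r₁) uR ≤ C₆ * d ^ 2 := by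
    have h1 := hQ (𝒮.curve u r₁) (hcn (hu.trans hrρ₆))
    have h2 : ‖𝒮.curve u r₁ - uR‖ ≤ L * d := by
      have := hL.dist_le_mul _ hr₁T _ (mem_of_mem_nhds hT)
      rw [Prod.dist_eq, dist_self, max_eq_right dist_nonneg, dist_eq_norm, dist_eq_norm] at this
      exact this
    have h3 : |𝒮.speed u r₁| ≤ |σ₁| + C₁ * r := by
      have h4 := (hσ r₁ u (by simpa using hρ₁) (hu.trans hrρ₁)).2.2
      rw [sub_self, abs_zero, zero_add] at h4
      have h5 : C₁ * d ≤ C₁ * r := by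
        have : d < r := by rw [hd, ← dist_eq_norm]; exact hu
        gcongr
      have h6 : |𝒮.speed u r₁ - σ₁| ≤ C₁ * r := h4.trans h5
      linarith [abs_sub_abs_le_abs_sub (𝒮.speed u r₁) σ₁]
    have h7 : sys.movingFlux (𝒮.speed u r₁) (𝒮.curve u r₁) uR ≤
        C₃ * ‖𝒮.curve u r₁ - uR‖ ^ 2 +
          (|σ₁| + C₁ * r) * (C₃ * ‖𝒮.curve u r₁ - uR‖ ^ 2) := by
      have h8 : |𝒮.speed u r₁ * sys.relEntropy (𝒮.curve u r₁) uR| ≤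
          (|σ₁| + C₁ * r) * (C₃ * ‖𝒮.curve u r₁ - uR‖ ^ 2) := by
        rw [abs_mul]
        exact mul_le_mul h3 h1.1 (abs_nonneg _) (by positivity)
      have h9 := le_of_abs_le h1.2
      have h10 := neg_le_of_abs_le h8
      rw [EntropySystem.movingFlux]
      linarith
    refine h7.trans ?_
    have h11 : ‖𝒮.curve u r₁ - uR‖ ^ 2 ≤ (L * d) ^ 2 := by gcongr
    calc _ = C₃ * (1 + (|σ₁| + C₁ * r)) * ‖𝒮.curve u r₁ - uR‖ ^ 2 := by ring
      _ ≤ C₃ * (1 + (|σ₁| + C₁ * r)) * (L * d) ^ 2 := by gcongr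
      _ = C₆ * d ^ 2 := by rw [hC₆]; ring
  -- the entropies relative to `uR` and to the shock curve
  have hent : |sys.relEntropy u (𝒮.curve u r₁) - sys.relEntropy u uR| ≤ C₅ * d := by
    have h1 := (hζ r₁ u (by simpa using hρ₂) (hu.trans hrρ₂)).2.2
    rw [sub_self, abs_zero, zero_add] at h1
    have h2 := hC₄' (hu.trans hrρ₅)
    rw [Real.norm_eq_abs] at h2
    have h3 : C₄ * d ≤ |C₄| * d := mul_le_mul_of_nonneg_right (le_abs_self _) hd0
    have h4 := abs_sub_le (sys.relEntropy u (𝒮.curve u r₁)) (sys.relEntropy uL uR)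
      (sys.relEntropy u uR)
    rw [abs_sub_comm (sys.relEntropy uL uR)] at h4
    change |sys.relEntropy u (𝒮.curve u r₁) - sys.relEntropy uL uR| ≤ C₂ * d at h1
    rw [hC₅]
    linarith
  -- the derivatives
  have hder : ∀ τ, |τ - r₁| < r →
      HasDerivAt (fun τ => sys.movingFlux (𝒮.speed u τ) (𝒮.curve u τ) uR)
        (deriv (𝒮.speed u) τ * (sys.relEntropy u (𝒮.curve u τ) - sys.relEntropy u uR)) τ ∧
      (m₁ / 2 ≤ -deriv (𝒮.speed u) τ ∧ -deriv (𝒮.speed u) τ ≤ 2 * m₁) ∧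
      HasDerivAt (fun τ => sys.relEntropy u (𝒮.curve u τ))
        (deriv (fun τ => sys.relEntropy u (𝒮.curve u τ)) τ) τ ∧
      m₂ / 2 ≤ deriv (fun τ => sys.relEntropy u (𝒮.curve u τ)) τ := by
    intro τ hτ
    have hτ0 : 0 < τ := by linarith [(abs_lt.mp hτ).1]
    have h1 := hσ τ u (hτ.trans hrρ₁) (hu.trans hrρ₁)
    have h2 := hζ τ u (hτ.trans hrρ₂) (hu.trans hrρ₂)
    have h3 := abs_lt.mp h1.1
    have h4 := abs_lt.mp h2.1
    change -(m₁ / 2) < deriv (𝒮.speed u) τ - deriv (𝒮.speed uL) r₁ ∧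
      deriv (𝒮.speed u) τ - deriv (𝒮.speed uL) r₁ < m₁ / 2 at h3
    change -(m₂ / 2) < deriv (fun τ => sys.relEntropy u (𝒮.curve u τ)) τ - m₂ ∧ _ at h4
    refine ⟨F.hasDerivAt_movingFlux hud (hdom τ hτ).2.1 hτ0 uR, ⟨?_, ?_⟩,
      h2.2.1.hasDerivAt, ?_⟩ <;> linarith [h3.1, h3.2, h4.1]
  -- growth of the strength of the shock
  have hgrow : ∀ a b, |a - r₁| < r → |b - r₁| < r → a ≤ b → m₂ / 2 * (b - a) ≤
      sys.relEntropy u (𝒮.curve u b) - sys.relEntropy u (𝒮.curve u a) := by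
    intro a b ha hb hab
    have hin : ∀ τ ∈ Icc a b, |τ - r₁| < r := by
      intro τ hτ
      rw [abs_lt] at ha hb ⊢
      constructor <;> linarith [hτ.1, hτ.2, ha.1, hb.2]
    apply (convex_Icc a b).mul_sub_le_image_sub_of_le_deriv
      (f := fun τ => sys.relEntropy u (𝒮.curve u τ))
      (fun τ hτ => (hder τ (hin τ hτ)).2.2.1.continuousAt.continuousWithinAt)
      (fun τ hτ =>
        (hder τ (hin τ (interior_subset hτ))).2.2.1.differentiableAt.differentiableWithinAt)
      (fun τ hτ => (hder τ (hin τ (interior_subset hτ))).2.2.2) a (left_mem_Icc.mpr hab) b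
      (right_mem_Icc.mpr hab) hab
  have hent' := abs_le.mp hent
  refine ⟨hud, fun s hs => ⟨(hdom s hs).2.1, ?_, ?_⟩⟩
  · refine (hσ s u (hs.trans hrρ₁) (hu.trans hrρ₁)).2.2.trans ?_
    have : 0 ≤ C₆ + 2 * m₁ * C₅ := by positivity
    gcongr
    linarith
  · have hfin : ∀ X : ℝ, 0 ≤ X → C₆ * d ^ 2 + 2 * m₁ * C₅ * d * X - m₁ * m₂ / 8 * X ^ 2 ≤
        (C₁ + C₆ + 2 * m₁ * C₅) * d ^ 2 + (C₁ + C₆ + 2 * m₁ * C₅) * d * X -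
          m₁ * m₂ / 8 * X ^ 2 := by
      intro X hX
      have h1 : 0 ≤ (C₁ + 2 * m₁ * C₅) * d ^ 2 := by positivity
      have h2 : 0 ≤ (C₁ + C₆) * (d * X) := by positivity
      linarith
    refine le_trans ?_ (hfin _ (abs_nonneg _))
    have hpoly : ∀ τ, HasDerivAt (fun τ : ℝ => m₁ * m₂ / 8 * (τ - r₁) ^ 2)
        (m₁ * m₂ / 4 * (τ - r₁)) τ := by
      intro τ
      have := (((hasDerivAt_id τ).sub_const r₁).pow 2).const_mul (m₁ * m₂ / 8)
      refine this.congr_deriv ?_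
      simp only [id_eq]
      norm_num
      ring
    have hlin : ∀ τ, HasDerivAt (fun τ : ℝ => 2 * m₁ * C₅ * d * (τ - r₁)) (2 * m₁ * C₅ * d) τ := by
      intro τ
      simpa using ((hasDerivAt_id τ).sub_const r₁).const_mul (2 * m₁ * C₅ * d)
    rcases le_total r₁ s with h | h
    · have hin : ∀ τ ∈ Icc r₁ s, |τ - r₁| < r := by
        intro τ hτ
        rw [abs_lt] at hs ⊢
        constructor <;> linarith [hτ.1, hτ.2, hs.2]
      have hanti : AntitoneOn (fun τ => sys.movingFlux (𝒮.speed u τ) (𝒮.curve u τ) uR +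
          m₁ * m₂ / 8 * (τ - r₁) ^ 2 - 2 * m₁ * C₅ * d * (τ - r₁)) (Icc r₁ s) := by
        have hD : ∀ τ ∈ Icc r₁ s, HasDerivAt _ _ τ := fun τ hτ =>
          ((hder τ (hin τ hτ)).1.add (hpoly τ)).sub (hlin τ)
        apply antitoneOn_of_deriv_nonpos (convex_Icc r₁ s)
        · exact fun τ hτ => (hD τ hτ).continuousAt.continuousWithinAt
        · exact fun τ hτ =>
            (hD τ (interior_subset hτ)).differentiableAt.differentiableWithinAt
        · intro τ hτ'
          have hτ := interior_subset hτ'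
          have h0 := (hD τ hτ).deriv
          refine h0.trans_le ?_
          obtain ⟨-, ⟨h1, h2⟩, -, -⟩ := hder τ (hin τ hτ)
          have h3 := hgrow r₁ τ hr₁r (hin τ hτ) hτ.1
          set k := -deriv (𝒮.speed u) τ
          set X := sys.relEntropy u (𝒮.curve u τ) - sys.relEntropy u uR
          have h4 : m₂ / 2 * (τ - r₁) ≤ X + C₅ * d := by linarith [hent'.1]
          have h5 : 0 ≤ τ - r₁ := by linarith [hτ.1]
          have h6 : deriv (𝒮.speed u) τ * X = -(k * (X + C₅ * d)) + k * (C₅ * d) := by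
            simp only [k]; ring
          have h7 : m₁ / 2 * (m₂ / 2 * (τ - r₁)) ≤ k * (X + C₅ * d) :=
            mul_le_mul h1 h4 (by positivity) (by linarith)
          have h8 : k * (C₅ * d) ≤ 2 * m₁ * (C₅ * d) := by gcongr
          rw [h6]
          linarith
      have h9 := hanti (left_mem_Icc.mpr h) (right_mem_Icc.mpr h) h
      simp only [sub_self] at h9
      rw [abs_of_nonneg (sub_nonneg.mpr h)]
      linarith
    · have hin : ∀ τ ∈ Icc s r₁, |τ - r₁| < r := by
        intro τ hτ
        rw [abs_lt] at hs ⊢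
        constructor <;> linarith [hτ.1, hτ.2, hs.1]
      have hmono : MonotoneOn (fun τ => sys.movingFlux (𝒮.speed u τ) (𝒮.curve u τ) uR +
          m₁ * m₂ / 8 * (τ - r₁) ^ 2 + 2 * m₁ * C₅ * d * (τ - r₁)) (Icc s r₁) := by
        have hD : ∀ τ ∈ Icc s r₁, HasDerivAt _ _ τ := fun τ hτ =>
          ((hder τ (hin τ hτ)).1.add (hpoly τ)).add (hlin τ)
        apply monotoneOn_of_deriv_nonneg (convex_Icc s r₁)
        · exact fun τ hτ => (hD τ hτ).continuousAt.continuousWithinAt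
        · exact fun τ hτ =>
            (hD τ (interior_subset hτ)).differentiableAt.differentiableWithinAt
        · intro τ hτ'
          have hτ := interior_subset hτ'
          have h0 := (hD τ hτ).deriv
          refine le_of_le_of_eq ?_ h0.symm
          obtain ⟨-, ⟨h1, h2⟩, -, -⟩ := hder τ (hin τ hτ)
          have h3 := hgrow τ r₁ (hin τ hτ) hr₁r hτ.2
          set k := -deriv (𝒮.speed u) τ
          set X := sys.relEntropy u (𝒮.curve u τ) - sys.relEntropy u uR
          have h4 : m₂ / 2 * (r₁ - τ) ≤ C₅ * d - X := by linarith [hent'.2]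
          have h5 : 0 ≤ r₁ - τ := by linarith [hτ.2]
          have h6 : deriv (𝒮.speed u) τ * X = k * (C₅ * d - X) - k * (C₅ * d) := by
            simp only [k]; ring
          have h7 : m₁ / 2 * (m₂ / 2 * (r₁ - τ)) ≤ k * (C₅ * d - X) :=
            mul_le_mul h1 h4 (by positivity) (by linarith)
          have h8 : k * (C₅ * d) ≤ 2 * m₁ * (C₅ * d) := by gcongr
          rw [h6]
          linarith
      have h9 := hmono (left_mem_Icc.mpr h) (right_mem_Icc.mpr h) h
      simp only [sub_self] at h9
      rw [abs_of_nonpos (sub_nonpos.mpr h)]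
      linarith

/-- Away from the parameter of `uR`, the flux relative to `uR` is bounded away from zero. -/
theorem HypH.exists_movingFlux_le_far (H : HypH sys 𝒮 uL) (huL : uL ∈ 𝒮.dom) {r₁ ε : ℝ}
    (hε : 0 < ε) (hεr : ε < r₁) (hr₁ : r₁ + ε ∈ 𝒮.params uL) :
    ∃ κ > 0, ∃ r > 0, ∀ u ∈ 𝒮.dom, dist u uL < r → ∀ s ∈ 𝒮.params u, ε ≤ |s - r₁| →
      sys.movingFlux (𝒮.speed u s) (𝒮.curve u s) (𝒮.curve uL r₁) ≤ -κ := by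
  have F := H.family
  set uR := 𝒮.curve uL r₁ with huR
  have h0 : r₁ ∈ 𝒮.params uL := ShockCurves.mem_params_of_le hr₁ (by linarith) (by linarith)
  have hm : r₁ - ε ∈ 𝒮.params uL := ShockCurves.mem_params_of_le h0 (by linarith) (by linarith)
  have hent := F.strictMonoOn_relEntropy huL
  have hp1 := hent hm h0 (by linarith)
  have hp2 := hent h0 hr₁ (by linarith)
  have hq1 := H.movingFlux_lt_of_lt (w := uR) huL (by linarith) (show r₁ - ε < r₁ by linarith) h0
    le_rfl
  have hq2 := H.movingFlux_lt_of_gt (w := uR) huL (by linarith) (show r₁ < r₁ + ε by linarith) hr₁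
    le_rfl
  rw [← huR, EntropySystem.movingFlux_self] at hq1 hq2
  simp only [← huR] at hp1 hp2
  have hcR : ContinuousAt (fun u => sys.relEntropy u uR) uL :=
    (EntropySystem.hasFDerivAt_relEntropy (F.dom_subset huL) uR).continuousAt
  have hc1 := continuousAt_prodMk_right
    (F.contDiffAt_relEntropy_curve huL hm (by linarith)).continuousAt
  have hc2 := continuousAt_prodMk_right
    (F.contDiffAt_relEntropy_curve huL hr₁ (by linarith)).continuousAt
  have hc3 := continuousAt_prodMk_right (F.continuousAt_movingFlux huL hm (by linarith) uR)
  have hc4 := continuousAt_prodMk_right (F.continuousAt_movingFlux huL hr₁ (by linarith) uR)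
  simp only at hc1 hc2 hc3 hc4
  set κ := min (-sys.movingFlux (𝒮.speed uL (r₁ - ε)) (𝒮.curve uL (r₁ - ε)) uR)
    (-sys.movingFlux (𝒮.speed uL (r₁ + ε)) (𝒮.curve uL (r₁ + ε)) uR) / 2 with hκ
  have hκ0 : 0 < κ := by
    apply half_pos
    apply lt_min <;> linarith
  have hκ1 : sys.movingFlux (𝒮.speed uL (r₁ - ε)) (𝒮.curve uL (r₁ - ε)) uR < -κ := by
    have := min_le_left (-sys.movingFlux (𝒮.speed uL (r₁ - ε)) (𝒮.curve uL (r₁ - ε)) uR)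
      (-sys.movingFlux (𝒮.speed uL (r₁ + ε)) (𝒮.curve uL (r₁ + ε)) uR)
    linarith
  have hκ2 : sys.movingFlux (𝒮.speed uL (r₁ + ε)) (𝒮.curve uL (r₁ + ε)) uR < -κ := by
    have := min_le_right (-sys.movingFlux (𝒮.speed uL (r₁ - ε)) (𝒮.curve uL (r₁ - ε)) uR)
      (-sys.movingFlux (𝒮.speed uL (r₁ + ε)) (𝒮.curve uL (r₁ + ε)) uR)
    linarith
  have hev := (((hc1.eventually_lt hcR hp1).and (hcR.eventually_lt hc2 hp2)).and
    ((hc3.eventually (gt_mem_nhds hκ1)).and (hc4.eventually (gt_mem_nhds hκ2)))).and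
    ((continuousAt_prodMk_right (continuousAt_id (x := (r₁ - ε, uL)))).eventually
      (F.domain_mem_nhds huL hm (by linarith)))
  have hev' := hev.and ((continuousAt_prodMk_right (continuousAt_id (x := (r₁ + ε, uL)))).eventually
      (F.domain_mem_nhds huL hr₁ (by linarith)))
  obtain ⟨r, hr, h⟩ := Metric.eventually_nhds_iff.mp hev'
  refine ⟨κ, hκ0, r, hr, fun u hu hur s hs hsr => ?_⟩
  obtain ⟨⟨⟨⟨h1, h2⟩, h3, h4⟩, h5⟩, h6⟩ := h hur
  rcases le_abs.mp hsr with h7 | h7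
  · rcases (show r₁ + ε ≤ s by linarith).eq_or_lt with h8 | h8
    · rw [← h8]
      exact h4.le
    · exact (H.movingFlux_lt_of_gt hu (by linarith) h8 hs h2.le).le.trans h4.le
  · rcases (show s ≤ r₁ - ε by linarith).eq_or_lt with h8 | h8
    · rw [h8]
      exact h3.le
    · exact (H.movingFlux_lt_of_lt hu hs.1 h8 h5.2 h1.le).le.trans h3.le

end Constants

/-! ### The dissipation estimates -/

section Dissipation

variable {n : ℕ} {sys : EntropySystem n} {𝒮 : ShockCurves n} {uL : State n}

/-- A sublevel set `{relEntropy · v ≤ a b}` meets a compact set in a small neighbourhood of `v`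
once `a` is small. -/
theorem EntropySystem.exists_dist_lt_of_relEntropy_le {K : Set (State n)} (hK : IsCompact K)
    (hKV : K ⊆ sys.V) {v : State n} (hv : v ∈ sys.V) {b δ : ℝ} (hb : 0 < b) (hδ : 0 < δ) :
    ∃ a > 0, ∀ w ∈ K, sys.relEntropy w v ≤ a * b → dist w v < δ := by
  have hc : IsCompact (K \ ball v δ) := hK.diff isOpen_ball
  rcases (K \ ball v δ).eq_empty_or_nonempty with he | hne
  · refine ⟨1, one_pos, fun w hw _ => ?_⟩
    by_contra hd
    exact (he ▸ (⟨hw, fun h => hd (mem_ball.1 h)⟩ : w ∈ K \ ball v δ) : w ∈ (∅ : Set (State n)))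
  · obtain ⟨w₀, hw₀, hmin⟩ := hc.exists_isMinOn hne
      ((sys.continuousOn_relEntropy v).mono (sdiff_subset.trans hKV))
    have hpos : 0 < sys.relEntropy w₀ v :=
      sys.relEntropy_pos hv (hKV hw₀.1) (fun h => hw₀.2 (h ▸ mem_ball_self hδ))
    refine ⟨sys.relEntropy w₀ v / (2 * b), by positivity, fun w hw hle => ?_⟩
    by_contra hd
    have h1 := hmin (⟨hw, fun h => hd (mem_ball.1 h)⟩ : w ∈ K \ ball v δ)
    simp only [mem_ofPred_eq] at h1
    have h2 : sys.relEntropy w₀ v / (2 * b) * b = sys.relEntropy w₀ v / 2 := by field_simp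
    linarith

/-- A quadratic form in the parameter `x` and the distance `d` which is only coercive in `x` is
dominated, after multiplication by a small weight, by a term coercive in `d`. -/
theorem quadratic_dissipation {a κ β C x d y Φ Ψ : ℝ} (ha : 0 < a) (hκ : 0 < κ) (hβ : 0 < β)
    (hC : 0 < C) (haE : a * (C + C ^ 2 / (2 * κ)) ≤ β / 2)
    (hΦ : Φ ≤ C * d ^ 2 + C * d * x - κ * x ^ 2) (hΨ : Ψ ≤ -(β * d ^ 2)) (hy : 0 ≤ y)
    (hyle : y ≤ C * (x + d)) :
    a * Φ + Ψ ≤ -(min (a * κ / 2) (β / 2) / (2 * C ^ 2)) * y ^ 2 := by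
  -- Young's inequality for the mixed term
  have hY : C * d * x ≤ κ / 2 * x ^ 2 + C ^ 2 / (2 * κ) * d ^ 2 := by
    have h : κ / 2 * x ^ 2 + C ^ 2 / (2 * κ) * d ^ 2 - C * d * x
        = (κ * x - C * d) ^ 2 / (2 * κ) := by field_simp; ring
    have : 0 ≤ (κ * x - C * d) ^ 2 / (2 * κ) := by positivity
    linarith
  have h2 : Φ ≤ (C + C ^ 2 / (2 * κ)) * d ^ 2 - κ / 2 * x ^ 2 := by
    rw [add_mul]; linarith
  have h3 := mul_le_mul_of_nonneg_left h2 ha.le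
  have h4 := mul_le_mul_of_nonneg_right haE (sq_nonneg d)
  set μ := min (a * κ / 2) (β / 2) with hμ
  have h5 : μ * x ^ 2 ≤ a * κ / 2 * x ^ 2 :=
    mul_le_mul_of_nonneg_right (min_le_left _ _) (sq_nonneg x)
  have h6 : μ * d ^ 2 ≤ β / 2 * d ^ 2 :=
    mul_le_mul_of_nonneg_right (min_le_right _ _) (sq_nonneg d)
  have hμ0 : 0 < μ := by positivity
  have h7 : y ^ 2 ≤ 2 * C ^ 2 * (x ^ 2 + d ^ 2) := by
    have h : y ^ 2 ≤ (C * (x + d)) ^ 2 := by gcongr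
    have h' : (C * (x + d)) ^ 2 = 2 * C ^ 2 * (x ^ 2 + d ^ 2) - C ^ 2 * (x - d) ^ 2 := by ring
    have : 0 ≤ C ^ 2 * (x - d) ^ 2 := by positivity
    linarith
  have h8 : μ / (2 * C ^ 2) * y ^ 2 ≤ μ * (x ^ 2 + d ^ 2) := by
    calc μ / (2 * C ^ 2) * y ^ 2 ≤ μ / (2 * C ^ 2) * (2 * C ^ 2 * (x ^ 2 + d ^ 2)) :=
          mul_le_mul_of_nonneg_left h7 (by positivity)
      _ = μ * (x ^ 2 + d ^ 2) := by field_simp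
  linarith

/-- Contraction up to shift at shocks: when the left state of a 1-shock is close to `uL` in the
sense of the weighted relative entropies, the dissipation is controlled by the square of the
difference of the speeds. Far from the reference shock along the curve the flux relative to `uR`
is negative; close to it, the entropy of the left state relative to `uL` absorbs the error. -/
theorem HypH.exists_dissipation_shock (H : HypH sys 𝒮 uL) (huL : uL ∈ 𝒮.dom) {r₁ : ℝ}
    (hr₁ : r₁ ∈ 𝒮.params uL) (hr0 : 0 < r₁) {K : Set (State n)} (hK : IsCompact K)
    (hKV : K ⊆ sys.V) (B : ℝ) :
    ∃ a' > 0, ∀ a, 0 < a → a < a' → ∃ c > 0, ∃ g > 0, ∀ u ∈ K,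
      sys.relEntropy u uL ≤ a * sys.relEntropy u (𝒮.curve uL r₁) →
      u ∈ 𝒮.dom ∧ 𝒮.speed uL r₁ + g ≤ sys.speedMin u ∧
      ∀ s ∈ 𝒮.params u, |𝒮.speed u s| ≤ B →
        a * sys.movingFlux (𝒮.speed u s) (𝒮.curve u s) (𝒮.curve uL r₁)
          - sys.movingFlux (𝒮.speed u s) u uL ≤ -c * |𝒮.speed uL r₁ - 𝒮.speed u s| ^ 2 := by
  have F := H.family
  set uR := 𝒮.curve uL r₁ with huR
  set σ₁ := 𝒮.speed uL r₁ with hσ₁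
  have hLV : uL ∈ sys.V := F.dom_subset huL
  obtain ⟨C, hC, κ, hκ, r, hr, hrr₁, hnear⟩ := H.exists_movingFlux_le_near huL hr₁ hr0
  have hp : r₁ + r / 2 ∈ 𝒮.params uL :=
    ((hnear uL (by simpa using hr)).2 (r₁ + r / 2) (by
      rw [add_sub_cancel_left, abs_of_pos (by positivity)]; linarith)).1
  obtain ⟨κ', hκ', r', hr', hfar⟩ := H.exists_movingFlux_le_far huL (half_pos hr)
    (by linarith) hp
  have hm : r₁ - r / 2 ∈ 𝒮.params uL := ShockCurves.mem_params_of_le hr₁ (by linarith) (by linarith)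
  set lam := sys.speedMin uL with hlam
  have hlt : 𝒮.speed uL (r₁ - r / 2) < lam := by
    have := H.strictAntiOn_speed huL (F.zero_mem_params huL) hm (by linarith)
    rwa [H.speed_zero uL huL] at this
  have hσlt : σ₁ < 𝒮.speed uL (r₁ - r / 2) := H.strictAntiOn_speed huL hm hr₁ (by linarith)
  obtain ⟨κ₂, hκ₂, h3κ⟩ : ∃ κ₂ > 0, 3 * κ₂ = lam - 𝒮.speed uL (r₁ - r / 2) :=
    ⟨(lam - 𝒮.speed uL (r₁ - r / 2)) / 3, by linarith, by ring⟩
  obtain ⟨CR, hCR, hCRb⟩ : ∃ CR > 0, ∀ w ∈ K, sys.relEntropy w uR ≤ CR := by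
    obtain ⟨b, hb⟩ := hK.bddAbove_image ((sys.continuousOn_relEntropy uR).mono hKV)
    exact ⟨max b 1, by positivity, fun w hw => (hb (mem_image_of_mem _ hw)).trans (le_max_left _ _)⟩
  obtain ⟨ε, hε, hεκ, hεκ'⟩ : ∃ ε > 0, ε ≤ κ₂ ∧ 4 * (ε * CR) ≤ κ' := by
    refine ⟨min κ₂ (κ' / (4 * CR)), by positivity, min_le_left _ _, ?_⟩
    have h1 : min κ₂ (κ' / (4 * CR)) * CR ≤ κ' / (4 * CR) * CR :=
      mul_le_mul_of_nonneg_right (min_le_right _ _) hCR.le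
    have h2 : κ' / (4 * CR) * CR = κ' / 4 := by field_simp
    linarith
  obtain ⟨cη, hcη, rη, hrη, -, hη⟩ := sys.exists_le_relEntropy hLV
  obtain ⟨rf, hrf, -, hf⟩ := sys.exists_speedMin_mul_relEntropy_le hLV hε
  -- neighbourhoods on which the characteristic speed and the curve speed are under control
  obtain ⟨rl, hrl, hl⟩ := Metric.continuousAt_iff.1
    (H.continuousOn_speedMin.continuousAt (F.isOpen_dom.mem_nhds huL)) ε hε
  obtain ⟨rs, hrs, hs⟩ := Metric.continuousAt_iff.1 (continuousAt_prodMk_right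
    (F.contDiffAt_speed huL hm (by linarith)).continuousAt) κ₂ hκ₂
  simp only [Real.dist_eq] at hl hs
  set δ := min (min (min r r') (min rη rf)) (min rl rs) with hδ
  have hδ0 : 0 < δ := by positivity
  obtain ⟨a₀, ha₀, hclose⟩ := sys.exists_dist_lt_of_relEntropy_le hK hKV hLV hCR hδ0
  set E := C + C ^ 2 / (2 * κ) with hE
  have hE0 : 0 < E := by positivity
  refine ⟨min a₀ (κ₂ * cη / (2 * E)), by positivity, fun a ha haa => ?_⟩
  have haE : a * E ≤ κ₂ * cη / 2 := by
    have h1 := mul_le_mul_of_nonneg_right (haa.le.trans (min_le_right _ _)) hE0.le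
    have h2 : κ₂ * cη / (2 * E) * E = κ₂ * cη / 2 := by field_simp
    linarith
  set c₁ := min (a * κ / 2) (κ₂ * cη / 2) / (2 * C ^ 2) with hc₁
  set c₂ := a * κ' / 2 / ((|σ₁| + |B|) ^ 2 + 1) with hc₂
  have hc₁0 : 0 < c₁ := by positivity
  have hc₂0 : 0 < c₂ := by positivity
  refine ⟨min c₁ c₂, by positivity, 2 * κ₂, by positivity, fun u hu hle => ?_⟩
  have hR := hCRb u hu
  have hd : dist u uL < δ := by
    refine hclose u hu (hle.trans ?_)
    calc a * sys.relEntropy u uR ≤ a * CR := mul_le_mul_of_nonneg_left hR ha.le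
      _ ≤ a₀ * CR := mul_le_mul_of_nonneg_right (haa.le.trans (min_le_left _ _)) hCR.le
  simp only [hδ, lt_min_iff] at hd
  obtain ⟨⟨⟨hdr, hdr'⟩, hdη, hdf⟩, hdl, hds⟩ := hd
  have hud := (hnear u hdr).1
  have hlu := abs_lt.1 (hl hdl)
  have hsu := abs_lt.1 (hs hds)
  have hη1 := hη u hdη
  have hf1 := hf u hdf
  have hE1 : 0 ≤ sys.relEntropy u uL := sys.relEntropy_nonneg hLV (hKV hu)
  refine ⟨hud, by linarith, fun s hsp hB => ?_⟩
  have hσle := H.speed_le hud hsp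
  set σ := 𝒮.speed u s with hσ
  have hmf : -sys.movingFlux σ u uL ≤ (σ - lam + ε) * sys.relEntropy u uL := by
    unfold EntropySystem.movingFlux; nlinarith
  have hsq0 : 0 ≤ |σ₁ - σ| ^ 2 := by positivity
  rcases lt_or_ge |s - r₁| (r / 2) with hsr | hsr
  · obtain ⟨-, hsp1, hmR⟩ := (hnear u hdr).2 s (by linarith)
    have hmu : r₁ - r / 2 ∈ 𝒮.params u :=
      ((hnear u hdr).2 _ (by
        rw [sub_sub_cancel_left, abs_neg, abs_of_pos (by positivity)]; linarith)).1
    have hσ' : σ ≤ 𝒮.speed u (r₁ - r / 2) :=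
      (H.strictAntiOn_speed hud).antitoneOn hmu hsp (by linarith [(abs_lt.1 hsr).1])
    have h1 : -sys.movingFlux σ u uL ≤ -κ₂ * (cη * ‖u - uL‖ ^ 2) := by
      have : (σ - lam + ε) * sys.relEntropy u uL ≤ -κ₂ * sys.relEntropy u uL :=
        mul_le_mul_of_nonneg_right (by linarith) hE1
      have := mul_le_mul_of_nonneg_left hη1 hκ₂.le
      linarith
    have h2 := quadratic_dissipation (Ψ := -sys.movingFlux σ u uL) ha hκ (by positivity) hC
      haE hmR (by rw [mul_assoc, ← neg_mul]; exact h1)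
      (abs_nonneg _) hsp1
    rw [abs_sub_comm σ σ₁] at h2
    have h9 := mul_le_mul_of_nonneg_right (min_le_left c₁ c₂) hsq0
    linarith
  · have hmR := hfar u hud hdr' s hsp hsr
    have h1 : -sys.movingFlux σ u uL ≤ 2 * (a * (ε * CR)) := by
      have h2 : (σ - lam + ε) * sys.relEntropy u uL ≤ (2 * ε) * sys.relEntropy u uL :=
        mul_le_mul_of_nonneg_right (by linarith) hE1
      have h3 : (2 * ε) * sys.relEntropy u uL ≤ (2 * ε) * (a * CR) :=
        mul_le_mul_of_nonneg_left (hle.trans (mul_le_mul_of_nonneg_left hR ha.le)) (by positivity)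
      linarith
    have h2 := mul_le_mul_of_nonneg_left hmR ha.le
    have h3 := mul_le_mul_of_nonneg_left hεκ' ha.le
    have h4 : |σ₁ - σ| ^ 2 ≤ (|σ₁| + |B|) ^ 2 + 1 := by
      have : |σ₁ - σ| ≤ |σ₁| + |B| :=
        (abs_sub _ _).trans (by linarith [le_abs_self B])
      have : |σ₁ - σ| ^ 2 ≤ (|σ₁| + |B|) ^ 2 := by gcongr
      linarith
    have h5 : c₂ * |σ₁ - σ| ^ 2 ≤ a * κ' / 2 := by
      calc c₂ * |σ₁ - σ| ^ 2 ≤ c₂ * ((|σ₁| + |B|) ^ 2 + 1) :=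
            mul_le_mul_of_nonneg_left h4 hc₂0.le
        _ = a * κ' / 2 := by rw [hc₂]; field_simp
    have h9 := mul_le_mul_of_nonneg_right (min_le_right c₁ c₂) hsq0
    linarith

/-- Contraction at states where the weighted relative entropies are comparable, for a shift that
moves to the left with a large speed. -/
theorem EntropySystem.exists_dissipation_fast {uR : State n} {K : Set (State n)} (hK : IsCompact K)
    (hKV : K ⊆ sys.V) {σ₁ a c g B : ℝ} (hc : 0 < c) (hg : 0 < g) (hB : 0 ≤ B)
    (hlam : ∀ u ∈ K, |sys.speedMin u| ≤ B)
    (h : ∀ u ∈ K, sys.relEntropy u uL ≤ a * sys.relEntropy u uR →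
      σ₁ + g ≤ sys.speedMin u ∧
        a * sys.movingFlux (sys.speedMin u) u uR - sys.movingFlux (sys.speedMin u) u uL
          ≤ -c * |σ₁ - sys.speedMin u| ^ 2) :
    ∃ δ > 0, ∃ M : ℝ≥0, B < M ∧ ∃ c' > 0, c' ≤ c ∧ ∀ u ∈ K,
      a * sys.relEntropy u uR - sys.relEntropy u uL ≤ δ →
        a * sys.movingFlux (-M) u uR - sys.movingFlux (-M) u uL ≤ -c' * |σ₁ + M| ^ 2 := by
  set G : State n → ℝ := fun u => a * sys.relEntropy u uR - sys.relEntropy u uL with hG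
  set A : State n → ℝ := fun u => a * sys.relFlux u uR - sys.relFlux u uL with hA
  have hGc : ContinuousOn G K :=
    (continuousOn_const.mul ((sys.continuousOn_relEntropy uR).mono hKV)).sub
      ((sys.continuousOn_relEntropy uL).mono hKV)
  have hAc : ContinuousOn A K :=
    (continuousOn_const.mul ((sys.continuousOn_relFlux uR).mono hKV)).sub
      ((sys.continuousOn_relFlux uL).mono hKV)
  have hid : ∀ (σ : ℝ) u, a * sys.movingFlux σ u uR - sys.movingFlux σ u uL = A u - σ * G u := by
    intro σ u; simp only [EntropySystem.movingFlux, hA, hG]; ring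
  set c₀ := c * g ^ 2 with hc₀
  have hc₀0 : 0 < c₀ := by positivity
  have hpos : ∀ u ∈ K, 0 ≤ G u → A u ≤ B * G u - c₀ := by
    intro u hu hGu
    obtain ⟨h1, h2⟩ := h u hu (by simp only [hG] at hGu; linarith)
    rw [hid] at h2
    have h3 : g ^ 2 ≤ |σ₁ - sys.speedMin u| ^ 2 := by
      rw [sq_abs]; nlinarith
    have h4 := mul_le_mul_of_nonneg_left h3 hc.le
    have h5 := mul_le_mul_of_nonneg_right ((abs_le.1 (hlam u hu)).2) hGu
    linarith
  -- where `A` is not negative, `G` is bounded away from zero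
  obtain ⟨δ₁, hδ₁, hZ⟩ : ∃ δ₁ > 0, ∀ u ∈ K, G u ≤ 0 → -(c₀ / 2) ≤ A u → G u ≤ -δ₁ := by
    have hclosed : IsClosed (K ∩ G ⁻¹' Iic 0) :=
      hGc.preimage_isClosed_of_isClosed hK.isClosed isClosed_Iic
    have hclosed2 : IsClosed ((K ∩ G ⁻¹' Iic 0) ∩ A ⁻¹' Ici (-(c₀ / 2))) :=
      (hAc.mono inter_subset_left).preimage_isClosed_of_isClosed hclosed isClosed_Ici
    have hcpt : IsCompact ((K ∩ G ⁻¹' Iic 0) ∩ A ⁻¹' Ici (-(c₀ / 2))) :=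
      hK.of_isClosed_subset hclosed2 (inter_subset_left.trans inter_subset_left)
    rcases ((K ∩ G ⁻¹' Iic 0) ∩ A ⁻¹' Ici (-(c₀ / 2))).eq_empty_or_nonempty with he | hne
    · refine ⟨1, one_pos, fun u hu h1 h2 => ?_⟩
      exact absurd (he ▸ (⟨⟨hu, h1⟩, h2⟩ : u ∈ (K ∩ G ⁻¹' Iic 0) ∩ A ⁻¹' Ici (-(c₀ / 2))))
        (notMem_empty u)
    · obtain ⟨w, hw, hmax⟩ := hcpt.exists_isMaxOn hne
        (hGc.mono (inter_subset_left.trans inter_subset_left))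
      have hGw : G w < 0 := by
        refine lt_of_le_of_ne hw.1.2 fun h0 => ?_
        have h1 := hpos w hw.1.1 h0.ge
        have h2 : -(c₀ / 2) ≤ A w := hw.2
        rw [h0] at h1
        linarith
      exact ⟨-G w, by linarith, fun u hu h1 h2 => by
        rw [neg_neg]; exact hmax (⟨⟨hu, h1⟩, h2⟩ : u ∈ (K ∩ G ⁻¹' Iic 0) ∩ A ⁻¹' Ici (-(c₀ / 2)))⟩
  obtain ⟨CA, hCA⟩ := hK.bddAbove_image hAc
  set M : ℝ≥0 := ⟨max (B + 1) ((|CA| + c₀) / δ₁), le_max_of_le_left (by linarith)⟩ with hM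
  have hMB : B + 1 ≤ M := le_max_left _ _
  have hMδ : |CA| + c₀ ≤ M * δ₁ := by
    have : (|CA| + c₀) / δ₁ ≤ M := le_max_right _ _
    rwa [div_le_iff₀ hδ₁] at this
  have hBM : 0 < B + M := by linarith
  refine ⟨c₀ / (2 * (B + M)), by positivity, M, by linarith,
    min c (c₀ / 2 / (|σ₁ + M| ^ 2 + 1)), by positivity, min_le_left _ _, fun u hu hle => ?_⟩
  rw [hid]
  have hkey : A u + M * G u ≤ -(c₀ / 2) := by
    rcases le_total 0 (G u) with hGu | hGu
    · have h1 := hpos u hu hGu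
      have h2 : (B + M) * G u ≤ (B + M) * (c₀ / (2 * (B + M))) :=
        mul_le_mul_of_nonneg_left hle (by positivity)
      have h3 : (B + M) * (c₀ / (2 * (B + M))) = c₀ / 2 := by
        have : (B + M : ℝ) ≠ 0 := hBM.ne'
        field_simp
      nlinarith
    · have hM0 : (0 : ℝ) ≤ M := M.2
      by_cases hA' : -(c₀ / 2) ≤ A u
      · have h1 := hZ u hu hGu hA'
        have h2 : A u ≤ |CA| := (hCA (mem_image_of_mem _ hu)).trans (le_abs_self _)
        nlinarith
      · nlinarith
  have h4 : min c (c₀ / 2 / (|σ₁ + M| ^ 2 + 1)) * |σ₁ + M| ^ 2 ≤ c₀ / 2 := by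
    calc _ ≤ c₀ / 2 / (|σ₁ + M| ^ 2 + 1) * (|σ₁ + M| ^ 2 + 1) := by
          gcongr
          · exact min_le_right _ _
          · linarith
      _ = c₀ / 2 := by field_simp
  linarith

end Dissipation

/-! ### Balance laws along Lipschitz curves -/

section Balance

theorem ae_swap_of_ae_ae {P : ℝ × ℝ → Prop} (hP : MeasurableSet {z | P z})
    (h : ∀ᵐ t : ℝ, ∀ᵐ x : ℝ, P (x, t)) : ∀ᵐ z, P z := by
  have h1 : ∀ᵐ w : ℝ × ℝ, P w.swap := by
    have := (Measure.ae_prod_mem_iff_ae_ae_mem (μ := (volume : Measure ℝ))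
      (ν := (volume : Measure ℝ)) (s := {w : ℝ × ℝ | P w.swap}) (hP.preimage measurable_swap)).2 h
    exact this
  have := (Measure.measurePreserving_swap (μ := (volume : Measure ℝ))
    (ν := (volume : Measure ℝ))).quasiMeasurePreserving.ae h1
  exact this

theorem ae_ae_swap_of_ae {P : ℝ × ℝ → Prop} (h : ∀ᵐ z, P z) :
    ∀ᵐ t : ℝ, ∀ᵐ x : ℝ, P (x, t) := by
  have := (Measure.measurePreserving_swap (μ := (volume : Measure ℝ))
    (ν := (volume : Measure ℝ))).quasiMeasurePreserving.ae h
  exact Measure.ae_ae_of_ae_prod this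

/-- A bounded function is nonnegative almost everywhere in an open set if its integrals against
the nonnegative Lipschitz functions with compact support there are nonnegative. -/
theorem ae_nonneg_of_integral_mul_nonneg {I : Set ℝ} (hI : IsOpen I) {g : ℝ → ℝ}
    (hg : Measurable g) {C : ℝ} (hC : ∀ t, |g t| ≤ C)
    (h : ∀ χ : ℝ → ℝ, (∃ L, LipschitzWith L χ) → HasCompactSupport χ → tsupport χ ⊆ I →
      (∀ t, 0 ≤ χ t) → (∀ t, χ t ≤ 1) → 0 ≤ ∫ t, χ t * g t) :
    ∀ᵐ t, t ∈ I → 0 ≤ g t := by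
  by_contra hne
  have hpos : volume (I ∩ {t | g t < 0}) ≠ 0 := by
    intro h0
    apply hne
    rw [ae_iff]
    convert h0 using 2
    ext t
    simp
  obtain ⟨A, hA, hAc, hA0⟩ := (hI.measurableSet.inter
    (hg measurableSet_Iio : MeasurableSet {t | g t < 0})).exists_lt_isCompact
      (pos_iff_ne_zero.2 hpos)
  obtain ⟨δ, hδ, hδI⟩ := hAc.exists_cthickening_subset_open hI (hA.trans inter_subset_left)
  have hδn : ∀ n : ℕ, 0 < δ / ((n : ℝ) + 1) := fun n => by positivity
  have hsupp : ∀ n, tsupport (fun t => (thickenedIndicator (hδn n) A t : ℝ)) ⊆ cthickening δ A := by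
    intro n
    apply closure_minimal _ isClosed_cthickening
    intro t ht
    by_contra hc
    apply ht
    have : t ∉ thickening (δ / ((n : ℝ) + 1)) A := fun h' => hc
      (thickening_subset_cthickening_of_le
        (div_le_self hδ.le (by linarith [n.cast_nonneg (α := ℝ)])) A h')
    simp [thickenedIndicator_zero (hδn n) A this]
  have hcc : IsCompact (cthickening δ A) := hAc.cthickening
  have hnn : ∀ n, 0 ≤ ∫ t, (thickenedIndicator (hδn n) A t : ℝ) * g t := by
    intro n
    refine h _ ⟨_, (lipschitzWith_thickenedIndicator (hδn n) A)⟩ ?_ ((hsupp n).trans hδI)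
      (fun t => NNReal.coe_nonneg _) (fun t => ?_)
    · exact hcc.of_isClosed_subset (isClosed_tsupport _) (hsupp n)
    · exact_mod_cast thickenedIndicator_le_one (hδn n) A t
  have hlim : Tendsto (fun n => ∫ t, (thickenedIndicator (hδn n) A t : ℝ) * g t) atTop
      (𝓝 (∫ t, A.indicator (fun _ => (1 : ℝ)) t * g t)) := by
    refine tendsto_integral_of_dominated_convergence ((cthickening δ A).indicator fun _ => C)
      (fun n => ?_) ?_ (fun n => ?_) ?_
    · exact (((NNReal.continuous_coe.comp (thickenedIndicator (hδn n) A).continuous).measurable).mul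
        hg).aestronglyMeasurable
    · exact (integrable_indicator_iff isClosed_cthickening.measurableSet).2
        (integrableOn_const hcc.measure_lt_top.ne)
    · refine Eventually.of_forall fun t => ?_
      by_cases ht : t ∈ cthickening δ A
      · rw [indicator_of_mem ht, norm_mul, Real.norm_eq_abs, Real.norm_eq_abs, NNReal.abs_eq]
        have h1 : (thickenedIndicator (hδn n) A t : ℝ) ≤ 1 :=
          by exact_mod_cast thickenedIndicator_le_one (hδn n) A t
        have := mul_le_mul h1 (hC t) (abs_nonneg _) zero_le_one
        linarith
      · have : (thickenedIndicator (hδn n) A t : ℝ) = 0 := by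
          by_contra h0
          exact ht (hsupp n (subset_tsupport _ h0))
        rw [indicator_of_notMem ht, this]
        simp
    · refine Eventually.of_forall fun t => ?_
      have h1 := thickenedIndicator_tendsto_indicator_closure hδn
        ((tendsto_const_nhds (x := δ)).div_atTop
          (tendsto_natCast_atTop_atTop.atTop_add (tendsto_const_nhds (x := (1 : ℝ))))) A
      rw [hAc.isClosed.closure_eq] at h1
      have h2 := (NNReal.continuous_coe.tendsto _).comp ((tendsto_pi_nhds.1 h1) t)
      have h3 : ((A.indicator (fun _ => (1 : ℝ≥0)) t : ℝ≥0) : ℝ) =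
          A.indicator (fun _ => (1 : ℝ)) t := by
        by_cases ht : t ∈ A <;> simp [ht]
      rw [← h3]
      exact h2.mul_const _
  have h0 : 0 ≤ ∫ t, A.indicator (fun _ => (1 : ℝ)) t * g t := ge_of_tendsto' hlim hnn
  have heq : (fun t => A.indicator (fun _ => (1 : ℝ)) t * g t) = A.indicator g := by
    ext t; by_cases ht : t ∈ A <;> simp [ht]
  rw [heq, integral_indicator hAc.measurableSet] at h0
  have hint : IntegrableOn g A := Measure.integrableOn_of_bounded (M := C) hAc.measure_lt_top.ne
    hg.aestronglyMeasurable (Eventually.of_forall hC)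
  have h1 : 0 < ∫ t in A, -g t := by
    rw [setIntegral_pos_iff_support_of_nonneg_ae]
    · have : Function.support (fun t => -g t) ∩ A = A := by
        apply inter_eq_right.2
        intro t ht
        have : g t < 0 := (hA ht).2
        simp only [Function.mem_support]
        linarith
      rw [this]; exact hA0
    · filter_upwards [ae_restrict_mem hAc.measurableSet] with t ht
      have : g t < 0 := (hA ht).2
      simp only [Pi.zero_apply]
      linarith
    · exact hint.neg
  rw [integral_neg] at h1
  linarith

/-- The tent function of height `1` and half-width `1 / k`. -/
noncomputable def tent (k : ℝ) (y : ℝ) : ℝ := max 0 (1 - k * |y|)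

/-- The slope of the tent function. -/
noncomputable def tentSlope (k : ℝ) (y : ℝ) : ℝ :=
  (Ioo (-(1 / k)) 0).indicator (fun _ => k) y - (Ioo 0 (1 / k)).indicator (fun _ => k) y

theorem tent_nonneg (k y : ℝ) : 0 ≤ tent k y := le_max_left _ _

theorem tent_le_one {k : ℝ} (hk : 0 < k) (y : ℝ) : tent k y ≤ 1 :=
  max_le zero_le_one (by have := mul_nonneg hk.le (abs_nonneg y); linarith)

theorem tent_eq_zero {k : ℝ} (hk : 0 < k) {y : ℝ} (hy : 1 / k < |y|) : tent k y = 0 := by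
  rw [div_lt_iff₀ hk] at hy
  exact max_eq_left (by linarith)

theorem tentSlope_eq_zero {k : ℝ} {y : ℝ} (hy : 1 / k < |y|) : tentSlope k y = 0 := by
  have h1 : y ∉ Ioo (-(1 / k)) 0 := fun h => by
    rw [abs_of_neg h.2] at hy; linarith [h.1]
  have h2 : y ∉ Ioo 0 (1 / k) := fun h => by
    rw [abs_of_pos h.1] at hy; linarith [h.2]
  simp only [tentSlope, indicator_of_notMem h1, indicator_of_notMem h2, sub_zero]

theorem lipschitzWith_tent (k : ℝ≥0) : LipschitzWith k (tent k) := by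
  have h1 : LipschitzWith k (fun y : ℝ => 1 - k * |y|) := by
    refine LipschitzWith.of_dist_le_mul fun x y => ?_
    rw [Real.dist_eq, Real.dist_eq]
    have : (1 - k * |x|) - (1 - k * |y|) = k * (|y| - |x|) := by ring
    rw [this, abs_mul, NNReal.abs_eq, abs_sub_comm x y]
    exact mul_le_mul_of_nonneg_left (abs_abs_sub_abs_le _ _) k.2
  exact h1.const_max 0

theorem hasDerivAt_tent {k : ℝ} (hk : 0 < k) {y : ℝ} (h0 : y ≠ 0) (h1 : |y| ≠ 1 / k) :
    HasDerivAt (tent k) (tentSlope k y) y := by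
  rcases lt_or_gt_of_ne h1 with h1 | h1
  · have hk1 : k * |y| < 1 := by rw [lt_div_iff₀ hk] at h1; linarith
    rcases lt_or_gt_of_ne h0 with h0 | h0
    · have hs : tentSlope k y = k := by
        rw [abs_of_neg h0] at h1
        have hm : y ∈ Ioo (-(1 / k)) 0 := ⟨by linarith, h0⟩
        have hm' : y ∉ Ioo 0 (1 / k) := fun h => by linarith [h.1]
        simp only [tentSlope, indicator_of_mem hm, indicator_of_notMem hm', sub_zero]
      rw [hs]
      have h2 : HasDerivAt (fun y : ℝ => 1 + k * y) k y := by
        simpa using ((hasDerivAt_id y).const_mul k).const_add 1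
      refine h2.congr_of_eventuallyEq ?_
      have hc : ContinuousAt (fun y : ℝ => k * |y|) y := by fun_prop
      filter_upwards [hc.eventually_lt continuousAt_const hk1, Iio_mem_nhds h0] with z hz hz0
      simp only [mem_Iio] at hz0
      rw [abs_of_neg hz0] at hz
      rw [tent, abs_of_neg hz0, max_eq_right (by linarith)]
      ring
    · have hs : tentSlope k y = -k := by
        rw [abs_of_pos h0] at h1
        have hm : y ∈ Ioo 0 (1 / k) := ⟨h0, h1⟩
        have hm' : y ∉ Ioo (-(1 / k)) 0 := fun h => by linarith [h.2]
        simp only [tentSlope, indicator_of_mem hm, indicator_of_notMem hm', zero_sub]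
      rw [hs]
      have h2 : HasDerivAt (fun y : ℝ => 1 - k * y) (-k) y := by
        simpa using ((hasDerivAt_id y).const_mul k).const_sub 1
      refine h2.congr_of_eventuallyEq ?_
      have hc : ContinuousAt (fun y : ℝ => k * |y|) y := by fun_prop
      filter_upwards [hc.eventually_lt continuousAt_const hk1, Ioi_mem_nhds h0] with z hz hz0
      simp only [mem_Ioi] at hz0
      rw [abs_of_pos hz0] at hz
      rw [tent, abs_of_pos hz0, max_eq_right (by linarith)]
  · rw [tentSlope_eq_zero h1]
    refine (hasDerivAt_const y (0 : ℝ)).congr_of_eventuallyEq ?_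
    filter_upwards [continuousAt_const.eventually_lt continuous_abs.continuousAt h1] with z hz
    exact tent_eq_zero hk hz

theorem measurable_tentSlope (k : ℝ) : Measurable (tentSlope k) :=
  (measurable_const.indicator measurableSet_Ioo).sub (measurable_const.indicator measurableSet_Ioo)

theorem abs_tentSlope_le {k : ℝ} (hk : 0 < k) (y : ℝ) : |tentSlope k y| ≤ k := by
  unfold tentSlope
  by_cases h1 : y ∈ Ioo (-(1 / k)) 0
  · have h2 : y ∉ Ioo 0 (1 / k) := fun h => by linarith [h1.2, h.1]
    simp only [indicator_of_mem h1, indicator_of_notMem h2, sub_zero, abs_of_pos hk, le_refl]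
  · by_cases h2 : y ∈ Ioo 0 (1 / k)
    · simp only [indicator_of_mem h2, indicator_of_notMem h1, zero_sub, abs_neg, abs_of_pos hk,
        le_refl]
    · simp only [indicator_of_notMem h2, indicator_of_notMem h1, sub_zero, abs_zero, hk.le]

theorem abs_mul_setIntegral_sub_le {J : Set ℝ} {k : ℝ} (hk : 0 < k)
    (hv : volume J = ENNReal.ofReal (1 / k)) {w : ℝ → ℝ} (hw : IntegrableOn w J) {c ε : ℝ}
    (h : ∀ᵐ y, y ∈ J → |w y - c| ≤ ε) : |k * (∫ y in J, w y) - c| ≤ ε := by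
  have hfin : volume J < ⊤ := by rw [hv]; exact ENNReal.ofReal_lt_top
  have hr : volume.real J = 1 / k := by
    rw [Measure.real, hv, ENNReal.toReal_ofReal (by positivity)]
  have h1 : ∫ y in J, (w y - c) = (∫ y in J, w y) - c / k := by
    rw [integral_sub hw (integrableOn_const hfin.ne), setIntegral_const, hr, smul_eq_mul]
    ring
  have h2 : ‖∫ y in J, (w y - c)‖ ≤ ε * volume.real J :=
    norm_setIntegral_le_of_norm_le_const_ae' hfin h
  rw [h1, hr, Real.norm_eq_abs] at h2
  have h3 : k * (∫ y in J, w y) - c = k * ((∫ y in J, w y) - c / k) := by field_simp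
  rw [h3, abs_mul, abs_of_pos hk]
  calc k * _ ≤ k * (ε * (1 / k)) := mul_le_mul_of_nonneg_left h2 hk.le
    _ = ε := by field_simp

theorem integral_tentSlope_mul {k : ℝ} {w : ℝ → ℝ}
    (hw : ∀ J : Set ℝ, volume J < ⊤ → IntegrableOn w J) :
    ∫ y, tentSlope k y * w y =
      k * (∫ y in Ioo (-(1 / k)) 0, w y) - k * (∫ y in Ioo 0 (1 / k), w y) := by
  have h : ∀ J : Set ℝ, MeasurableSet J → volume J < ⊤ →
      Integrable (fun y => J.indicator (fun _ => k) y * w y) ∧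
      ∫ y, J.indicator (fun _ => k) y * w y = k * ∫ y in J, w y := by
    intro J hJ hv
    have : (fun y => J.indicator (fun _ => k) y * w y) = J.indicator (fun y => k * w y) := by
      ext y; by_cases hy : y ∈ J <;> simp [hy]
    rw [this, integrable_indicator_iff hJ, integral_indicator hJ, integral_const_mul]
    exact ⟨(hw J hv).const_mul k, rfl⟩
  have hL := h (Ioo (-(1 / k)) 0) measurableSet_Ioo measure_Ioo_lt_top
  have hR := h (Ioo 0 (1 / k)) measurableSet_Ioo measure_Ioo_lt_top
  simp only [tentSlope, sub_mul]
  rw [integral_sub hL.1 hR.1, hL.2, hR.2]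

end Balance

section FluxBalance

/-- `c` is the essential limit of `E(x + y, t)` as `y` tends to `0` within the sets `J r`, `r ↓ 0`;
the sets of interest are one-sided intervals. -/
def HasEssLim (J : ℝ → Set ℝ) (E : ℝ × ℝ → ℝ) (x t c : ℝ) : Prop :=
  ∀ ε : ℝ, 0 < ε → ∃ r : ℝ, 0 < r ∧ ∀ᵐ y, y ∈ J r → |E (x + y, t) - c| ≤ ε

/-- The test function concentrating on the graph of `h`. -/
noncomputable def graphTest (χ h : ℝ → ℝ) (k : ℝ) (z : ℝ × ℝ) : ℝ := χ z.2 * tent k (z.1 - h z.2)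

variable {χ h : ℝ → ℝ} {L L' : ℝ≥0}

theorem lipschitzWith_graphTest (hχ : LipschitzWith L' χ) (h0 : ∀ t, 0 ≤ χ t) (h1 : ∀ t, χ t ≤ 1)
    (hh : LipschitzWith L h) {k : ℝ≥0} (hk : 0 < k) :
    LipschitzWith (L' + k * (1 + L)) (graphTest χ h k) := by
  refine LipschitzWith.of_dist_le_mul fun z w => ?_
  have hχd := hχ.dist_le_mul z.2 w.2
  have htd := (lipschitzWith_tent k).dist_le_mul (z.1 - h z.2) (w.1 - h w.2)
  have hhd := hh.dist_le_mul z.2 w.2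
  have hz1 : dist z.1 w.1 ≤ dist z w := le_max_left _ _
  have hz2 : dist z.2 w.2 ≤ dist z w := le_max_right _ _
  have hd : dist (z.1 - h z.2) (w.1 - h w.2) ≤ (1 + L) * dist z w := by
    refine (dist_sub_sub_le _ _ _ _).trans ?_
    have := mul_le_mul_of_nonneg_left hz2 L.coe_nonneg
    linarith
  have ht0 := tent_nonneg k (z.1 - h z.2)
  have ht1 := tent_le_one (k := k) (by exact_mod_cast hk) (z.1 - h z.2)
  have hA : dist (χ z.2) (χ w.2) ≤ L' * dist z w :=
    hχd.trans (mul_le_mul_of_nonneg_left hz2 L'.2)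
  have hB : dist (tent k (z.1 - h z.2)) (tent k (w.1 - h w.2)) ≤ k * (1 + L) * dist z w := by
    refine htd.trans ?_
    rw [mul_assoc]
    exact mul_le_mul_of_nonneg_left hd k.2
  rw [Real.dist_eq] at hA hB ⊢
  have hid : graphTest χ h k z - graphTest χ h k w = (χ z.2 - χ w.2) * tent k (z.1 - h z.2)
      + χ w.2 * (tent k (z.1 - h z.2) - tent k (w.1 - h w.2)) := by
    simp only [graphTest]; ring
  rw [hid]
  have h3 : |(χ z.2 - χ w.2) * tent k (z.1 - h z.2)| ≤ |χ z.2 - χ w.2| := by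
    rw [abs_mul, abs_of_nonneg ht0]
    exact mul_le_of_le_one_right (abs_nonneg _) ht1
  have h4 : |χ w.2 * (tent k (z.1 - h z.2) - tent k (w.1 - h w.2))|
      ≤ |tent k (z.1 - h z.2) - tent k (w.1 - h w.2)| := by
    rw [abs_mul, abs_of_nonneg (h0 _)]
    exact mul_le_of_le_one_left (abs_nonneg _) (h1 _)
  have := abs_add_le ((χ z.2 - χ w.2) * tent k (z.1 - h z.2))
    (χ w.2 * (tent k (z.1 - h z.2) - tent k (w.1 - h w.2)))
  push_cast
  linarith

/-- The points at distance at most `1 / k` from the graph of `h`, in the `x`-direction, at the times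
of `S`. -/
def graphTube (S : Set ℝ) (h : ℝ → ℝ) (k : ℝ) : Set (ℝ × ℝ) :=
  (fun p : ℝ × ℝ => (h p.2 + p.1, p.2)) '' (Icc (-(1 / k)) (1 / k) ×ˢ S)

theorem mem_graphTube {S : Set ℝ} {k : ℝ} {z : ℝ × ℝ} (hz : z.2 ∈ S) (hy : |z.1 - h z.2| ≤ 1 / k) :
    z ∈ graphTube S h k :=
  ⟨(z.1 - h z.2, z.2), ⟨abs_le.1 hy, hz⟩, by ext <;> simp⟩

theorem isCompact_graphTube {S : Set ℝ} (hS : IsCompact S) (hh : Continuous h) (k : ℝ) :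
    IsCompact (graphTube S h k) :=
  (isCompact_Icc.prod hS).image (by fun_prop)

theorem tsupport_graphTest_subset (hχ : HasCompactSupport χ) (hh : Continuous h) {k : ℝ}
    (hk : 0 < k) : tsupport (graphTest χ h k) ⊆ graphTube (tsupport χ) h k := by
  refine closure_minimal (fun z hz => ?_) (isCompact_graphTube hχ hh k).isClosed
  have hz' := mul_ne_zero_iff.1 (hz : graphTest χ h k z ≠ 0)
  refine mem_graphTube (subset_tsupport _ hz'.1) ?_
  by_contra! hc
  exact hz'.2 (tent_eq_zero hk hc)

/-- The derivatives of the test function `graphTest χ h k`, almost everywhere. -/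
theorem ae_graphTest_deriv (hχ : LipschitzWith L' χ) (hh : LipschitzWith L h) {k : ℝ}
    (hk : 0 < k) : ∀ᵐ z : ℝ × ℝ,
      dt (graphTest χ h k) z = deriv χ z.2 * tent k (z.1 - h z.2)
        - χ z.2 * (tentSlope k (z.1 - h z.2) * deriv h z.2) ∧
      dx (graphTest χ h k) z = χ z.2 * tentSlope k (z.1 - h z.2) := by
  have hmeas : MeasurableSet {z : ℝ × ℝ | DifferentiableAt ℝ χ z.2 ∧ DifferentiableAt ℝ h z.2 ∧
      z.1 - h z.2 ≠ 0 ∧ |z.1 - h z.2| ≠ 1 / k} := by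
    have hc : Measurable fun z : ℝ × ℝ => z.1 - h z.2 := by
      have := hh.continuous.measurable
      fun_prop
    have hc' : Measurable fun z : ℝ × ℝ => |z.1 - h z.2| := continuous_abs.measurable.comp hc
    exact ((measurableSet_of_differentiableAt ℝ χ).preimage measurable_snd).inter
      (((measurableSet_of_differentiableAt ℝ h).preimage measurable_snd).inter
        ((hc (measurableSet_singleton 0)).compl.inter
          (hc' (measurableSet_singleton (1 / k))).compl))
  have hgood := ae_swap_of_ae_ae hmeas (by
    filter_upwards [hχ.ae_differentiableAt_real, hh.ae_differentiableAt_real] with t h1 h2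
    have hfin : ({h t, h t + 1 / k, h t - 1 / k} : Set ℝ).Finite := by simp
    filter_upwards [hfin.countable.ae_notMem volume] with x hx
    simp only [mem_insert_iff, mem_singleton_iff, not_or] at hx
    refine ⟨h1, h2, sub_ne_zero.2 hx.1, fun h3 => ?_⟩
    rcases abs_eq (by positivity : (0 : ℝ) ≤ 1 / k) |>.1 h3 with h4 | h4
    · exact hx.2.1 (by linarith)
    · exact hx.2.2 (by linarith))
  filter_upwards [hgood] with z ⟨h1, h2, h3, h4⟩
  have ht := hasDerivAt_tent hk h3 h4
  constructor
  · have h5 : HasDerivAt (fun t => tent k (z.1 - h t)) (tentSlope k (z.1 - h z.2) * (-deriv h z.2))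
        z.2 := HasDerivAt.comp (h₂ := tent k) (h := fun t => z.1 - h t) z.2 ht
        (h2.hasDerivAt.const_sub z.1)
    have h6 := (h1.hasDerivAt.mul h5).deriv
    simp only [dt, graphTest]
    refine Eq.trans h6 ?_
    ring
  · have h5 : HasDerivAt (fun x => tent k (x - h z.2)) (tentSlope k (z.1 - h z.2)) z.1 := by
      have := HasDerivAt.comp (h₂ := tent k) (h := fun x => x - h z.2) z.1 ht
        ((hasDerivAt_id z.1).sub_const (h z.2))
      rwa [mul_one] at this
    exact (h5.const_mul (χ z.2)).deriv

variable {I : Set ℝ} {E Q : ℝ × ℝ → ℝ} {C : ℝ}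

/-- The flux through the graph of `h`, averaged over a layer of width `1 / k`. -/
noncomputable def layerFlux (E Q : ℝ × ℝ → ℝ) (h : ℝ → ℝ) (k t : ℝ) : ℝ :=
  ∫ y, tentSlope k y * (Q (h t + y, t) - deriv h t * E (h t + y, t))

theorem measurable_layer_integrand (hE : Measurable E) (hQ : Measurable Q)
    (hh : LipschitzWith L h) : Measurable fun z : ℝ × ℝ =>
      Q (h z.2 + z.1, z.2) - deriv h z.2 * E (h z.2 + z.1, z.2) := by
  have h1 : Measurable fun z : ℝ × ℝ => (h z.2 + z.1, z.2) := by
    have := hh.continuous.measurable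
    fun_prop
  exact (hQ.comp h1).sub (((measurable_deriv h).comp measurable_snd).mul (hE.comp h1))

theorem abs_layer_integrand_le (hEC : ∀ z, |E z| ≤ C) (hQC : ∀ z, |Q z| ≤ C)
    (hh : LipschitzWith L h) (y t : ℝ) :
    |Q (h t + y, t) - deriv h t * E (h t + y, t)| ≤ (1 + L) * C := by
  have h1 := hh.abs_deriv_le t
  have h2 := abs_sub (Q (h t + y, t)) (deriv h t * E (h t + y, t))
  rw [abs_mul] at h2
  have h3 := mul_le_mul h1 (hEC (h t + y, t)) (abs_nonneg _) L.2
  linarith [hQC (h t + y, t)]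

theorem integrableOn_layer (hE : Measurable E) (hQ : Measurable Q) (hEC : ∀ z, |E z| ≤ C)
    (hQC : ∀ z, |Q z| ≤ C) (hh : LipschitzWith L h) (t : ℝ) {J : Set ℝ} (hJ : volume J < ⊤) :
    IntegrableOn (fun y => Q (h t + y, t) - deriv h t * E (h t + y, t)) J :=
  Measure.integrableOn_of_bounded (M := (1 + L) * C) hJ.ne
    ((measurable_layer_integrand hE hQ hh).comp
      (measurable_id.prodMk measurable_const)).aestronglyMeasurable
    (Eventually.of_forall fun y => abs_layer_integrand_le hEC hQC hh y t)

theorem measurable_layerFlux (hE : Measurable E) (hQ : Measurable Q) (hh : LipschitzWith L h)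
    (k : ℝ) : Measurable (layerFlux E Q h k) := by
  have h1 : Measurable fun z : ℝ × ℝ => tentSlope k z.2 *
      (Q (h z.1 + z.2, z.1) - deriv h z.1 * E (h z.1 + z.2, z.1)) :=
    ((measurable_tentSlope k).comp measurable_snd).mul
      ((measurable_layer_integrand hE hQ hh).comp measurable_swap)
  exact (h1.stronglyMeasurable.integral_prod_right (ν := volume)).measurable

theorem volume_left_layer {k : ℝ} : volume (Ioo (-(1 / k)) 0) = ENNReal.ofReal (1 / k) := by
  simp

theorem volume_right_layer {k : ℝ} : volume (Ioo 0 (1 / k)) = ENNReal.ofReal (1 / k) := by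
  simp

theorem abs_layerFlux_le (hE : Measurable E) (hQ : Measurable Q) (hEC : ∀ z, |E z| ≤ C)
    (hQC : ∀ z, |Q z| ≤ C) (hh : LipschitzWith L h) {k : ℝ} (hk : 0 < k) (t : ℝ) :
    |layerFlux E Q h k t| ≤ 2 * ((1 + L) * C) := by
  have hint := fun (J : Set ℝ) (hJ : volume J < ⊤) => integrableOn_layer hE hQ hEC hQC hh t hJ
  have hb : ∀ J : Set ℝ, ∀ᵐ y, y ∈ J →
      |(Q (h t + y, t) - deriv h t * E (h t + y, t)) - 0| ≤ (1 + L) * C := fun J =>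
    Eventually.of_forall fun y _ => by
      rw [sub_zero]; exact abs_layer_integrand_le hEC hQC hh y t
  rw [layerFlux, integral_tentSlope_mul hint]
  have h1 := abs_mul_setIntegral_sub_le hk volume_left_layer (hint _ measure_Ioo_lt_top) (hb _)
  have h2 := abs_mul_setIntegral_sub_le hk volume_right_layer (hint _ measure_Ioo_lt_top) (hb _)
  rw [sub_zero] at h1 h2
  rw [abs_le] at h1 h2 ⊢
  constructor <;> linarith

theorem tendsto_layerFlux (hE : Measurable E) (hQ : Measurable Q) (hEC : ∀ z, |E z| ≤ C)
    (hQC : ∀ z, |Q z| ≤ C) (hh : LipschitzWith L h) {t Ep Em Qp Qm : ℝ}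
    (hEp : HasEssLim (fun r => Ioo 0 r) E (h t) t Ep)
    (hEm : HasEssLim (fun r => Ioo (-r) 0) E (h t) t Em)
    (hQp : HasEssLim (fun r => Ioo 0 r) Q (h t) t Qp)
    (hQm : HasEssLim (fun r => Ioo (-r) 0) Q (h t) t Qm) :
    Tendsto (fun j : ℕ => layerFlux E Q h ((j : ℝ) + 1) t) atTop
      (𝓝 (deriv h t * (Ep - Em) - (Qp - Qm))) := by
  have hint := fun (J : Set ℝ) (hJ : volume J < ⊤) => integrableOn_layer hE hQ hEC hQC hh t hJ
  have hcomb : ∀ {a b c d : ℝ} {ε : ℝ}, |a - c| ≤ ε → |b - d| ≤ ε →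
      |(a - deriv h t * b) - (c - deriv h t * d)| ≤ (1 + L) * ε := by
    intro a b c d ε h1 h2
    have : (a - deriv h t * b) - (c - deriv h t * d) = (a - c) - deriv h t * (b - d) := by ring
    rw [this]
    have h3 := abs_sub (a - c) (deriv h t * (b - d))
    rw [abs_mul] at h3
    have h4 := mul_le_mul (hh.abs_deriv_le t) h2 (abs_nonneg _) L.2
    linarith
  rw [Metric.tendsto_atTop]
  intro ε' hε'
  obtain ⟨ε, hε, hεε⟩ : ∃ ε > 0, 2 * ((1 + L) * ε) < ε' := by
    refine ⟨ε' / (4 * (1 + L)), by positivity, ?_⟩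
    have : 2 * ((1 + L) * (ε' / (4 * (1 + L)))) = ε' / 2 := by
      have : (1 + L : ℝ) ≠ 0 := by positivity
      field_simp; ring
    linarith
  obtain ⟨r1, hr1, h1⟩ := hEp ε hε
  obtain ⟨r2, hr2, h2⟩ := hEm ε hε
  obtain ⟨r3, hr3, h3⟩ := hQp ε hε
  obtain ⟨r4, hr4, h4⟩ := hQm ε hε
  set r := min (min r1 r2) (min r3 r4) with hr
  have hr0 : 0 < r := by positivity
  obtain ⟨N, hN⟩ := exists_nat_one_div_lt hr0
  refine ⟨N, fun j hj => ?_⟩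
  have hk : (0 : ℝ) < (j : ℝ) + 1 := by positivity
  have hkr : 1 / ((j : ℝ) + 1) < r := by
    refine lt_of_le_of_lt (one_div_le_one_div_of_le (by positivity) ?_) hN
    have : (N : ℝ) ≤ j := by exact_mod_cast hj
    linarith
  simp only [hr, lt_min_iff] at hkr
  obtain ⟨⟨hk1, hk2⟩, hk3, hk4⟩ := hkr
  rw [layerFlux, integral_tentSlope_mul hint, Real.dist_eq]
  have hl := abs_mul_setIntegral_sub_le hk volume_left_layer (hint _ measure_Ioo_lt_top)
    (c := Qm - deriv h t * Em) (ε := (1 + L) * ε) (by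
      filter_upwards [h2, h4] with y h2 h4 hy
      exact hcomb (h4 ⟨by linarith [hy.1], hy.2⟩) (h2 ⟨by linarith [hy.1], hy.2⟩))
  have hrr := abs_mul_setIntegral_sub_le hk volume_right_layer (hint _ measure_Ioo_lt_top)
    (c := Qp - deriv h t * Ep) (ε := (1 + L) * ε) (by
      filter_upwards [h1, h3] with y h1 h3 hy
      exact hcomb (h3 ⟨hy.1, by linarith [hy.2]⟩) (h1 ⟨hy.1, by linarith [hy.2]⟩))
  refine lt_of_le_of_lt ?_ hεε
  rw [abs_le] at hl hrr ⊢
  constructor <;> linarith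

theorem integrable_of_abs_le_of_support {X : Type*} [MeasurableSpace X] {μ : Measure X}
    {F : X → ℝ} (hF : Measurable F) {W : Set X} (hW : μ W < ⊤) {B : ℝ} (hB : ∀ z, |F z| ≤ B)
    (h0 : ∀ z, z ∉ W → F z = 0) : Integrable F μ := by
  have hsub : Function.support F ⊆ W := fun z hz => by
    by_contra hc
    exact hz (h0 z hc)
  exact (integrableOn_iff_integrable_of_support_subset hsub).1
    (Measure.integrableOn_of_bounded hW.ne hF.aestronglyMeasurable (Eventually.of_forall hB))

theorem deriv_eq_zero_of_notMem_tsupport {t : ℝ} (ht : t ∉ tsupport χ) : deriv χ t = 0 := by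
  by_contra h0
  exact ht (support_deriv_subset h0)

theorem eq_zero_of_notMem_tsupport {t : ℝ} (ht : t ∉ tsupport χ) : χ t = 0 := by
  by_contra h0
  exact ht (subset_tsupport _ h0)

/-- The distributional form of the balance law, tested against `graphTest χ h k`. -/
theorem integral_graphTest (hE : Measurable E) (hQ : Measurable Q) (hEC : ∀ z, |E z| ≤ C)
    (hQC : ∀ z, |Q z| ≤ C) (hχ : LipschitzWith L' χ) (hχc : HasCompactSupport χ)
    (hχ0 : ∀ t, 0 ≤ χ t) (hχ1 : ∀ t, χ t ≤ 1) (hh : LipschitzWith L h) {k : ℝ} (hk : 0 < k) :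
    ∫ z, (dt (graphTest χ h k) z * E z + dx (graphTest χ h k) z * Q z) =
      ∫ t, (deriv χ t * (∫ y, tent k y * E (h t + y, t)) + χ t * layerFlux E Q h k t) := by
  have hC : 0 ≤ C := (abs_nonneg _).trans (hEC 0)
  set F : ℝ × ℝ → ℝ := fun z =>
    (deriv χ z.2 * tent k (z.1 - h z.2) - χ z.2 * (tentSlope k (z.1 - h z.2) * deriv h z.2)) * E z
      + χ z.2 * tentSlope k (z.1 - h z.2) * Q z with hF
  have h1 : ∫ z, (dt (graphTest χ h k) z * E z + dx (graphTest χ h k) z * Q z) = ∫ z, F z := by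
    apply integral_congr_ae
    filter_upwards [ae_graphTest_deriv hχ hh hk] with z ⟨h1, h2⟩
    rw [h1, h2]
  have htent : Measurable (tent k) := by unfold tent; fun_prop
  have hFm : Measurable F := by
    have hc : Measurable fun z : ℝ × ℝ => z.1 - h z.2 := by
      have := hh.continuous.measurable
      fun_prop
    have e1 : Measurable fun z : ℝ × ℝ => deriv χ z.2 := (measurable_deriv χ).comp measurable_snd
    have e2 : Measurable fun z : ℝ × ℝ => deriv h z.2 := (measurable_deriv h).comp measurable_snd
    have e3 : Measurable fun z : ℝ × ℝ => χ z.2 := hχ.continuous.measurable.comp measurable_snd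
    have e4 : Measurable fun z : ℝ × ℝ => tent k (z.1 - h z.2) := htent.comp hc
    have e5 : Measurable fun z : ℝ × ℝ => tentSlope k (z.1 - h z.2) :=
      (measurable_tentSlope k).comp hc
    exact (((e1.mul e4).sub (e3.mul (e5.mul e2))).mul hE).add ((e3.mul e5).mul hQ)
  have hFb : ∀ z, |F z| ≤ (L' + k * L) * C + k * C := by
    intro z
    have b1 := hχ.abs_deriv_le z.2
    have b2 := hh.abs_deriv_le z.2
    have b3 : |χ z.2| ≤ 1 := by rw [abs_of_nonneg (hχ0 _)]; exact hχ1 _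
    have b4 : |tent k (z.1 - h z.2)| ≤ 1 := by
      rw [abs_of_nonneg (tent_nonneg _ _)]; exact tent_le_one hk _
    have b5 := abs_tentSlope_le hk (z.1 - h z.2)
    calc |F z| ≤ (|deriv χ z.2| * |tent k (z.1 - h z.2)|
          + |χ z.2| * (|tentSlope k (z.1 - h z.2)| * |deriv h z.2|)) * |E z|
          + |χ z.2| * |tentSlope k (z.1 - h z.2)| * |Q z| := by
          refine (abs_add_le _ _).trans ?_
          rw [abs_mul, abs_mul (χ z.2 * _), abs_mul (χ z.2) (tentSlope _ _)]
          gcongr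
          refine (abs_sub _ _).trans ?_
          rw [abs_mul, abs_mul, abs_mul]
      _ ≤ (L' * 1 + 1 * (k * L)) * C + 1 * k * C := by
          gcongr
          · exact hEC z
          · exact hQC z
      _ = _ := by ring
  have hFi : Integrable F := by
    refine integrable_of_abs_le_of_support hFm
      (isCompact_graphTube hχc hh.continuous k).measure_lt_top hFb fun z hz => ?_
    by_cases hz2 : z.2 ∈ tsupport χ
    · have : 1 / k < |z.1 - h z.2| := by
        by_contra! hc
        exact hz (mem_graphTube hz2 hc)
      simp only [hF, tent_eq_zero hk this, tentSlope_eq_zero this]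
      ring
    · simp only [hF, deriv_eq_zero_of_notMem_tsupport hz2, eq_zero_of_notMem_tsupport hz2]
      ring
  rw [h1]
  have h2 : ∫ z, F z = ∫ t, ∫ x, F (x, t) := integral_prod_symm F hFi
  rw [h2]
  refine integral_congr_ae (Eventually.of_forall fun t => ?_)
  have h3 : ∫ x, F (x, t) = ∫ y, F (h t + y, t) :=
    (integral_add_left_eq_self (fun x => F (x, t)) (h t)).symm
  have hEy : Measurable fun y => E (h t + y, t) := hE.comp (by fun_prop)
  have i1 : Integrable fun y => tent k y * E (h t + y, t) := by
    refine integrable_of_abs_le_of_support (htent.mul hEy)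
      (measure_Icc_lt_top (a := -(1 / k)) (b := 1 / k)) (B := C) (fun y => ?_) (fun y hy => ?_)
    · rw [abs_mul, abs_of_nonneg (tent_nonneg _ _)]
      exact (mul_le_of_le_one_left (abs_nonneg _) (tent_le_one hk y)).trans (hEC _)
    · have : 1 / k < |y| := by
        by_contra! hc
        exact hy (abs_le.1 hc)
      rw [tent_eq_zero hk this, zero_mul]
  have i2 : Integrable fun y => tentSlope k y *
      (Q (h t + y, t) - deriv h t * E (h t + y, t)) := by
    refine integrable_of_abs_le_of_support ((measurable_tentSlope k).mul
      ((measurable_layer_integrand hE hQ hh).comp (measurable_id.prodMk measurable_const)))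
      (measure_Icc_lt_top (a := -(1 / k)) (b := 1 / k)) (B := k * ((1 + L) * C))
      (fun y => ?_) (fun y hy => ?_)
    · rw [abs_mul]
      exact mul_le_mul (abs_tentSlope_le hk y) (abs_layer_integrand_le hEC hQC hh y t)
        (abs_nonneg _) hk.le
    · have : 1 / k < |y| := by
        by_contra! hc
        exact hy (abs_le.1 hc)
      rw [tentSlope_eq_zero this, zero_mul]
  simp only
  rw [h3, layerFlux, ← integral_const_mul, ← integral_const_mul,
    ← integral_add (i1.const_mul _) (i2.const_mul _)]
  refine integral_congr_ae (Eventually.of_forall fun y => ?_)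
  simp only [hF, add_sub_cancel_left]
  ring

/-- A weak inequality `∂ₜ E + ∂ₓ Q ≤ 0` yields a Rankine-Hugoniot inequality for the one-sided
limits along Lipschitz curves. -/
theorem flux_le_of_weak_le (hI : IsOpen I) (hE : Measurable E) (hQ : Measurable Q)
    (hEC : ∀ z, |E z| ≤ C) (hQC : ∀ z, |Q z| ≤ C) (hh : LipschitzWith L h)
    (hbal : ∀ φ : ℝ × ℝ → ℝ, (∃ L, LipschitzWith L φ) → HasCompactSupport φ →
      (∀ z ∈ tsupport φ, z.2 ∈ I) → (∀ z, 0 ≤ φ z) → 0 ≤ ∫ z, (dt φ z * E z + dx φ z * Q z))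
    {Ep Em Qp Qm : ℝ → ℝ}
    (hEp : ∀ᵐ t, t ∈ I → HasEssLim (fun r => Ioo 0 r) E (h t) t (Ep t))
    (hEm : ∀ᵐ t, t ∈ I → HasEssLim (fun r => Ioo (-r) 0) E (h t) t (Em t))
    (hQp : ∀ᵐ t, t ∈ I → HasEssLim (fun r => Ioo 0 r) Q (h t) t (Qp t))
    (hQm : ∀ᵐ t, t ∈ I → HasEssLim (fun r => Ioo (-r) 0) Q (h t) t (Qm t)) :
    ∀ᵐ t, t ∈ I → Qp t - Qm t ≤ deriv h t * (Ep t - Em t) := by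
  have hC : 0 ≤ C := (abs_nonneg _).trans (hEC 0)
  set B := 2 * ((1 + L) * C) with hB
  have hB0 : 0 ≤ B := by positivity
  -- the limit of the layer fluxes, clipped in order to have it bounded everywhere
  set g : ℝ → ℝ := fun t =>
    max (-B) (min B (limsup (fun j : ℕ => layerFlux E Q h ((j : ℝ) + 1) t) atTop)) with hg
  have hlim : ∀ᵐ t, t ∈ I → Tendsto (fun j : ℕ => layerFlux E Q h ((j : ℝ) + 1) t) atTop (𝓝 (g t))
      ∧ g t = deriv h t * (Ep t - Em t) - (Qp t - Qm t) := by
    filter_upwards [hEp, hEm, hQp, hQm] with t h1 h2 h3 h4 ht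
    have hl := tendsto_layerFlux hE hQ hEC hQC hh (h1 ht) (h2 ht) (h3 ht) (h4 ht)
    have hb : |deriv h t * (Ep t - Em t) - (Qp t - Qm t)| ≤ B :=
      le_of_tendsto' hl.abs fun j => abs_layerFlux_le hE hQ hEC hQC hh (by positivity) t
    have hgt : g t = deriv h t * (Ep t - Em t) - (Qp t - Qm t) := by
      simp only [hg]
      rw [hl.limsup_eq, min_eq_right (abs_le.1 hb).2, max_eq_right (abs_le.1 hb).1]
    exact ⟨hgt ▸ hl, hgt⟩
  have hgm : Measurable g := measurable_const.max (measurable_const.min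
    (Measurable.limsup fun j => measurable_layerFlux hE hQ hh _))
  have hgb : ∀ t, |g t| ≤ B := fun t =>
    abs_le.2 ⟨le_max_left _ _, max_le (by linarith) (min_le_left _ _)⟩
  have hnn := ae_nonneg_of_integral_mul_nonneg hI hgm hgb fun χ hχL hχc hχI hχ0 hχ1 => by
    obtain ⟨L', hχ⟩ := hχL
    have hnonneg : ∀ j : ℕ, 0 ≤ ∫ t, (deriv χ t * (∫ y, tent ((j : ℝ) + 1) y * E (h t + y, t))
        + χ t * layerFlux E Q h ((j : ℝ) + 1) t) := by
      intro j
      have hk : (0 : ℝ) < (j : ℝ) + 1 := by positivity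
      rw [← integral_graphTest hE hQ hEC hQC hχ hχc hχ0 hχ1 hh hk]
      have hl := lipschitzWith_graphTest (k := (j : ℝ≥0) + 1) hχ hχ0 hχ1 hh (by positivity)
      rw [NNReal.coe_add, NNReal.coe_natCast, NNReal.coe_one] at hl
      refine hbal _ ⟨_, hl⟩ ?_ ?_ ?_
      · exact (isCompact_graphTube hχc hh.continuous _).of_isClosed_subset (isClosed_tsupport _)
          (tsupport_graphTest_subset hχc hh.continuous hk)
      · intro z hz
        obtain ⟨p, hp, rfl⟩ := tsupport_graphTest_subset hχc hh.continuous hk hz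
        exact hχI hp.2
      · exact fun z => mul_nonneg (hχ0 _) (tent_nonneg _ _)
    have hA : ∀ (j : ℕ) t, |∫ y, tent ((j : ℝ) + 1) y * E (h t + y, t)| ≤
        C * (2 / ((j : ℝ) + 1)) := by
      intro j t
      have hk : (0 : ℝ) < (j : ℝ) + 1 := by positivity
      have h1 : ∫ y, tent ((j : ℝ) + 1) y * E (h t + y, t) =
          ∫ y in Icc (-(1 / ((j : ℝ) + 1))) (1 / ((j : ℝ) + 1)),
            tent ((j : ℝ) + 1) y * E (h t + y, t) := by
        symm
        apply setIntegral_eq_integral_of_forall_compl_eq_zero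
        intro y hy
        have : 1 / ((j : ℝ) + 1) < |y| := by
          by_contra! hc
          exact hy (abs_le.1 hc)
        rw [tent_eq_zero hk this, zero_mul]
      rw [h1]
      have h2 := norm_setIntegral_le_of_norm_le_const (μ := volume)
        (f := fun y => tent ((j : ℝ) + 1) y * E (h t + y, t)) (C := C)
        (measure_Icc_lt_top (a := -(1 / ((j : ℝ) + 1))) (b := 1 / ((j : ℝ) + 1))) (fun y _ => by
          rw [norm_mul, Real.norm_eq_abs, Real.norm_eq_abs, abs_of_nonneg (tent_nonneg _ _)]
          exact (mul_le_of_le_one_left (abs_nonneg _) (tent_le_one hk y)).trans (hEC _))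
      rw [Real.volume_real_Icc_of_le (by have : 0 ≤ 1 / ((j : ℝ) + 1) := by positivity
                                         linarith)] at h2
      refine h2.trans (le_of_eq ?_)
      ring
    have hAm : ∀ j : ℕ, Measurable fun t => ∫ y, tent ((j : ℝ) + 1) y * E (h t + y, t) := by
      intro j
      have h1 : Measurable fun z : ℝ × ℝ => tent ((j : ℝ) + 1) z.2 * E (h z.1 + z.2, z.1) := by
        have e1 : Measurable (tent ((j : ℝ) + 1)) := by unfold tent; fun_prop
        have e2 : Measurable fun z : ℝ × ℝ => (h z.1 + z.2, z.1) := by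
          have := hh.continuous.measurable
          fun_prop
        exact (e1.comp measurable_snd).mul (hE.comp e2)
      exact (h1.stronglyMeasurable.integral_prod_right (ν := volume)).measurable
    refine ge_of_tendsto' (b := 0) (tendsto_integral_of_dominated_convergence
      ((tsupport χ).indicator fun _ => L' * (C * 2) + B) (fun j => ?_) ?_ (fun j => ?_) ?_) hnonneg
    · exact (((measurable_deriv χ).mul (hAm j)).add (hχ.continuous.measurable.mul
        (measurable_layerFlux hE hQ hh _))).aestronglyMeasurable
    · exact (integrable_indicator_iff (isClosed_tsupport χ).measurableSet).2
        (integrableOn_const (IsCompact.measure_lt_top hχc).ne)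
    · refine Eventually.of_forall fun t => ?_
      by_cases ht : t ∈ tsupport χ
      · rw [indicator_of_mem ht, Real.norm_eq_abs]
        refine (abs_add_le _ _).trans ?_
        rw [abs_mul, abs_mul]
        have h1 := hχ.abs_deriv_le t
        have h2 : |∫ y, tent ((j : ℝ) + 1) y * E (h t + y, t)| ≤ C * 2 :=
          (hA j t).trans (mul_le_mul_of_nonneg_left
            (div_le_self (by norm_num) (by linarith [j.cast_nonneg (α := ℝ)])) hC)
        have h3 : |χ t| ≤ 1 := by rw [abs_of_nonneg (hχ0 t)]; exact hχ1 t
        have h4 : |layerFlux E Q h ((j : ℝ) + 1) t| ≤ B :=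
          abs_layerFlux_le hE hQ hEC hQC hh (by positivity) t
        have h5 := mul_le_mul h1 h2 (abs_nonneg _) L'.2
        have h6 := mul_le_mul h3 h4 (abs_nonneg _) zero_le_one
        linarith
      · rw [indicator_of_notMem ht, deriv_eq_zero_of_notMem_tsupport ht,
          eq_zero_of_notMem_tsupport ht]
        simp
    · filter_upwards [hlim] with t ht
      by_cases htI : t ∈ tsupport χ
      · have hA0 : Tendsto (fun j : ℕ => ∫ y, tent ((j : ℝ) + 1) y * E (h t + y, t)) atTop
            (𝓝 0) := by
          apply squeeze_zero_norm (fun j => hA j t)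
          have h1 := (tendsto_const_nhds (x := (2 : ℝ))).div_atTop
            (tendsto_natCast_atTop_atTop.atTop_add (tendsto_const_nhds (x := (1 : ℝ))))
          simpa using h1.const_mul C
        have := (hA0.const_mul (deriv χ t)).add ((ht (hχI htI)).1.const_mul (χ t))
        simpa using this
      · rw [eq_zero_of_notMem_tsupport htI]
        simp [deriv_eq_zero_of_notMem_tsupport htI]
  filter_upwards [hnn, hlim] with t h1 h2 ht
  have h3 := h1 ht
  rw [(h2 ht).2] at h3
  linarith

end FluxBalance

/-! ### Traces of entropic weak solutions -/

section Traces

/-- The open time interval `(0, T)`. -/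
def openTimes (T : EReal) : Set ℝ := {t | 0 < t ∧ (t : EReal) < T}

variable {T : EReal}

theorem isOpen_openTimes : IsOpen (openTimes T) :=
  isOpen_Ioi.inter (isOpen_Iio.preimage continuous_coe_real_ereal)

theorem openTimes_subset_timeSet : openTimes T ⊆ timeSet T := fun _ ht => ⟨ht.1.le, ht.2⟩

theorem measurableSet_timeSet : MeasurableSet (timeSet T) :=
  measurableSet_Ici.inter (isOpen_Iio.preimage continuous_coe_real_ereal).measurableSet

theorem measurableSet_strip : MeasurableSet (strip T) :=
  measurableSet_timeSet.preimage measurable_snd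

theorem ae_timeSet_of_ae_openTimes {P : ℝ → Prop} (h : ∀ᵐ t, t ∈ openTimes T → P t) :
    ∀ᵐ t ∂(volume.restrict (timeSet T)), P t := by
  rw [ae_restrict_iff' measurableSet_timeSet]
  filter_upwards [h, (countable_singleton (0 : ℝ)).ae_notMem volume] with t ht h0 htT
  exact ht ⟨lt_of_le_of_ne htT.1 (Ne.symm h0), htT.2⟩

theorem ae_openTimes_of_forall_Ioo {P : ℝ → Prop}
    (h : ∀ t₀ : ℝ, 0 < t₀ → (t₀ : EReal) < T → ∀ᵐ t, t ∈ Ioo 0 t₀ → P t) :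
    ∀ᵐ t, t ∈ openTimes T → P t := by
  have h1 : ∀ᵐ t : ℝ, ∀ q : ℚ, 0 < (q : ℝ) → (((q : ℝ) : ℝ) : EReal) < T →
      t ∈ Ioo 0 (q : ℝ) → P t := by
    rw [ae_all_iff]
    intro q
    by_cases h0 : 0 < (q : ℝ) ∧ (((q : ℝ) : ℝ) : EReal) < T
    · filter_upwards [h q h0.1 h0.2] with t ht _ _ using ht
    · exact Eventually.of_forall fun t h1 h2 => absurd ⟨h1, h2⟩ h0
  filter_upwards [h1] with t ht htT
  obtain ⟨q, hq1, hq2⟩ := EReal.exists_rat_btwn_of_lt htT.2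
  have hq : t < (q : ℝ) := by exact_mod_cast hq1
  exact ht q (htT.1.trans hq) hq2 ⟨htT.1, hq⟩

variable {n : ℕ} {u ub : ℝ × ℝ → State n}

theorem exists_measurable_modification {K : Set (State n)} (hK : IsCompact K) (hT : 0 < T)
    (hm : AEStronglyMeasurable u (volume.restrict (strip T)))
    (huK : ∀ᵐ p ∂(volume.restrict (strip T)), u p ∈ K) :
    ∃ ub : ℝ × ℝ → State n, Measurable ub ∧ (∀ z, ub z ∈ K) ∧
      ∀ᵐ p ∂(volume.restrict (strip T)), u p = ub p := by
  obtain ⟨k₀, hk₀⟩ : K.Nonempty := by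
    by_contra hne
    rw [not_nonempty_iff_eq_empty] at hne
    have h0 : volume (strip T) = 0 := by
      have : ∀ᵐ p ∂(volume.restrict (strip T)), False := by
        filter_upwards [huK] with p hp
        rw [hne] at hp; exact hp
      rw [ae_restrict_iff' measurableSet_strip, ae_iff] at this
      simpa using this
    obtain ⟨q, hq1, hq2⟩ := EReal.exists_rat_btwn_of_lt hT
    have hq : 0 < (q : ℝ) := by exact_mod_cast hq1
    have hsub : (Ioo 0 1 ×ˢ Ioo 0 (q : ℝ) : Set (ℝ × ℝ)) ⊆ strip T := fun p hp =>
      ⟨hp.2.1.le, lt_trans (by exact_mod_cast hp.2.2) hq2⟩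
    have h1 : volume (Ioo 0 1 ×ˢ Ioo 0 (q : ℝ) : Set (ℝ × ℝ)) = 0 := measure_mono_null hsub h0
    have h2 : IsOpen (Ioo 0 1 ×ˢ Ioo 0 (q : ℝ) : Set (ℝ × ℝ)) := isOpen_Ioo.prod isOpen_Ioo
    replace h1 := (h2.measure_eq_zero_iff volume).1 h1
    have : ((1 / 2, (q : ℝ) / 2) : ℝ × ℝ) ∈ (Ioo 0 1 ×ˢ Ioo 0 (q : ℝ) : Set (ℝ × ℝ)) :=
      ⟨⟨by norm_num, by norm_num⟩, by linarith, by linarith⟩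
    rw [h1] at this
    exact this
  classical
  have hgm := hm.stronglyMeasurable_mk.measurable
  refine ⟨fun z => if hm.mk u z ∈ K then hm.mk u z else k₀,
    Measurable.ite (hgm hK.isClosed.measurableSet) hgm measurable_const, fun z => ?_, ?_⟩
  · dsimp only
    split_ifs with h
    exacts [h, hk₀]
  · filter_upwards [huK, hm.ae_eq_mk] with z hz he
    rw [← he, if_pos hz]

theorem ae_ae_eq_of_ae_strip (hub : ∀ᵐ p ∂(volume.restrict (strip T)), u p = ub p) :
    ∀ᵐ t, t ∈ timeSet T → ∀ x, ∀ᵐ y, u (x + y, t) = ub (x + y, t) := by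
  rw [ae_restrict_iff' measurableSet_strip] at hub
  filter_upwards [ae_ae_swap_of_ae hub] with t ht htT x
  have h1 : ∀ᵐ y, u (y, t) = ub (y, t) := by
    filter_upwards [ht] with y hy using hy htT
  exact (measurePreserving_add_left volume x).quasiMeasurePreserving.ae h1

/-- The strong trace property, which is an integral condition in time, implies the existence of
essential limits at almost every time. -/
theorem ae_essLim_of_tendsto_lintegral (hubm : Measurable ub)
    (hub : ∀ᵐ p ∂(volume.restrict (strip T)), u p = ub p) {h : ℝ → ℝ} (hh : Measurable h)
    {J : ℕ → Set ℝ} (hJ : ∀ k, MeasurableSet (J k)) {v : ℝ → State n}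
    (hv : AEStronglyMeasurable v (volume.restrict (timeSet T)))
    (hlim : ∀ t₀ : ℝ, 0 < t₀ → (t₀ : EReal) < T →
      Tendsto (fun k : ℕ => ∫⁻ t in Ioo 0 t₀,
        essSup (fun y => ‖u (h t + y, t) - v t‖ₑ) (volume.restrict (J k))) atTop (𝓝 0)) :
    ∀ᵐ t, t ∈ openTimes T → ∀ ε : ℝ, 0 < ε →
      ∃ k, ∀ᵐ y, y ∈ J k → dist (ub (h t + y, t)) (v t) ≤ ε := by
  set w := hv.mk v with hw
  have hwm : Measurable w := hv.stronglyMeasurable_mk.measurable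
  have hvw : ∀ᵐ t, t ∈ timeSet T → v t = w t := by
    have := hv.ae_eq_mk
    rwa [EventuallyEq, ae_restrict_iff' measurableSet_timeSet] at this
  set b : ℕ → ℝ → ℝ≥0∞ := fun k t =>
    essSup (fun y => ‖ub (h t + y, t) - w t‖ₑ) (volume.restrict (J k)) with hb
  have hbm : ∀ k, Measurable (b k) := by
    intro k
    refine measurable_of_Iic fun c => ?_
    have hA : MeasurableSet {z : ℝ × ℝ | z.2 ∈ J k → ‖ub (h z.1 + z.2, z.1) - w z.1‖ₑ ≤ c} := by
      have h1 : Measurable fun z : ℝ × ℝ => ‖ub (h z.1 + z.2, z.1) - w z.1‖ₑ :=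
        ((hubm.comp (by fun_prop)).sub (hwm.comp measurable_fst)).enorm
      have : {z : ℝ × ℝ | z.2 ∈ J k → ‖ub (h z.1 + z.2, z.1) - w z.1‖ₑ ≤ c} =
          {z : ℝ × ℝ | z.2 ∈ J k}ᶜ ∪ {z | ‖ub (h z.1 + z.2, z.1) - w z.1‖ₑ ≤ c} := by
        ext z; simp [imp_iff_not_or]
      rw [this]
      exact ((hJ k).preimage measurable_snd).compl.union (h1 measurableSet_Iic)
    convert measurableSet_ae_section hA using 1
    ext t
    have h3 : b k t ≤ c ↔ ∀ᵐ y ∂(volume.restrict (J k)), ‖ub (h t + y, t) - w t‖ₑ ≤ c :=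
      ⟨fun hle => (ENNReal.ae_le_essSup _).mono fun y hy => hy.trans hle,
        fun hae => essSup_le_of_ae_le c hae⟩
    rw [ae_restrict_iff' (hJ k)] at h3
    exact h3
  have hbeq : ∀ᵐ t, t ∈ openTimes T → v t = w t ∧ ∀ k, b k t =
      essSup (fun y => ‖u (h t + y, t) - v t‖ₑ) (volume.restrict (J k)) := by
    filter_upwards [hvw, ae_ae_eq_of_ae_strip hub] with t h1 h2 ht
    have ht' := openTimes_subset_timeSet ht
    refine ⟨h1 ht', fun k => essSup_congr_ae (ae_restrict_of_ae ?_)⟩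
    filter_upwards [h2 ht' (h t)] with y hy
    rw [hy, h1 ht']
  apply ae_openTimes_of_forall_Ioo
  intro t₀ ht₀ ht₀T
  have hsub : Ioo 0 t₀ ⊆ openTimes T := fun t ht =>
    ⟨ht.1, lt_trans (by exact_mod_cast ht.2) ht₀T⟩
  have hlim' : Tendsto (fun k => ∫⁻ t in Ioo 0 t₀, b k t) atTop (𝓝 0) := by
    refine (hlim t₀ ht₀ ht₀T).congr fun k => ?_
    apply lintegral_congr_ae
    rw [EventuallyEq, ae_restrict_iff' measurableSet_Ioo]
    filter_upwards [hbeq] with t ht htI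
    exact ((ht (hsub htI)).2 k).symm
  have hfat : ∫⁻ t in Ioo 0 t₀, liminf (fun k => b k t) atTop = 0 := by
    have := lintegral_liminf_le (μ := volume.restrict (Ioo 0 t₀)) (u := atTop) hbm
    rw [hlim'.liminf_eq] at this
    exact le_antisymm this bot_le
  rw [lintegral_eq_zero_iff (Measurable.liminf hbm), EventuallyEq,
    ae_restrict_iff' measurableSet_Ioo] at hfat
  filter_upwards [hfat, hbeq] with t h1 h2 ht ε hε
  have h3 : liminf (fun k => b k t) atTop < ENNReal.ofReal ε := by
    rw [h1 ht]; simpa using hε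
  obtain ⟨k, hk⟩ := (frequently_lt_of_liminf_lt (by isBoundedDefault) h3).exists
  refine ⟨k, ?_⟩
  have h4 := ENNReal.ae_le_essSup (μ := volume.restrict (J k)) fun y => ‖ub (h t + y, t) - w t‖ₑ
  rw [ae_restrict_iff' (hJ k)] at h4
  filter_upwards [h4] with y hy hyJ
  have h5 := (hy hyJ).trans hk.le
  rw [(h2 (hsub ht)).1, dist_eq_norm]
  rw [← ofReal_norm] at h5
  exact (ENNReal.ofReal_le_ofReal_iff hε.le).1 h5

theorem IsRightTrace.ae_essRightLim (hubm : Measurable ub)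
    (hub : ∀ᵐ p ∂(volume.restrict (strip T)), u p = ub p) {h : ℝ → ℝ} (hh : Measurable h)
    {v : ℝ → State n} (hv : IsRightTrace T u h v) :
    ∀ᵐ t, t ∈ openTimes T → EssRightLim ub (h t) t (v t) := by
  filter_upwards [ae_essLim_of_tendsto_lintegral hubm hub hh
    (J := fun k => Ioo 0 (1 / ((k : ℝ) + 1))) (fun _ => measurableSet_Ioo) hv.1 hv.2]
    with t ht htT ε hε
  obtain ⟨k, hk⟩ := ht htT ε hε
  exact ⟨_, by positivity, hk⟩

theorem IsLeftTrace.ae_essLeftLim (hubm : Measurable ub)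
    (hub : ∀ᵐ p ∂(volume.restrict (strip T)), u p = ub p) {h : ℝ → ℝ} (hh : Measurable h)
    {v : ℝ → State n} (hv : IsLeftTrace T u h v) :
    ∀ᵐ t, t ∈ openTimes T → EssLeftLim ub (h t) t (v t) := by
  filter_upwards [ae_essLim_of_tendsto_lintegral hubm hub hh
    (J := fun k => Ioo (-(1 / ((k : ℝ) + 1))) 0) (fun _ => measurableSet_Ioo) hv.1 hv.2]
    with t ht htT ε hε
  obtain ⟨k, hk⟩ := ht htT ε hε
  exact ⟨_, by positivity, hk⟩

theorem EssLeftLim.mem_of_isClosed {x t : ℝ} {p : State n} {C : Set (State n)}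
    (hp : EssLeftLim u x t p) (hC : IsClosed C) (h : ∀ z, u z ∈ C) : p ∈ C :=
  (essLeftLim_iff_reflect.1 hp).mem_of_isClosed hC one_pos (Eventually.of_forall fun _ _ => h _)

theorem hasEssLim_comp {J : ℝ → Set ℝ} {K : Set (State n)} {φ : State n → ℝ}
    (hφ : ContinuousOn φ K) (huK : ∀ z, u z ∈ K) {x t : ℝ} {p : State n} (hp : p ∈ K)
    (h : ∀ ε : ℝ, 0 < ε → ∃ r : ℝ, 0 < r ∧ ∀ᵐ y, y ∈ J r → dist (u (x + y, t)) p ≤ ε) :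
    HasEssLim J (fun z => φ (u z)) x t (φ p) := by
  intro ε hε
  obtain ⟨δ, hδ, hc⟩ := Metric.continuousOn_iff.1 hφ p hp ε hε
  obtain ⟨r, hr, hy⟩ := h (δ / 2) (by positivity)
  refine ⟨r, hr, ?_⟩
  filter_upwards [hy] with y hy hyJ
  have := hc _ (huK _) (lt_of_le_of_lt (hy hyJ) (by linarith))
  rw [Real.dist_eq] at this
  exact this.le

theorem measurable_comp_of_continuousOn {K : Set (State n)} {φ : State n → ℝ}
    (hφ : ContinuousOn φ K) (hum : Measurable u) (huK : ∀ z, u z ∈ K) :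
    Measurable fun z => φ (u z) :=
  (continuousOn_iff_continuous_domRestrict.1 hφ).measurable.comp (hum.subtype_mk (h := huK))

end Traces

section RankineHugoniot

variable {T : EReal} {n : ℕ}

theorem dt_eq_zero_of_notMem_tsupport {φ : ℝ × ℝ → ℝ} {z : ℝ × ℝ} (hz : z ∉ tsupport φ) :
    dt φ z = 0 := by
  have h : φ =ᶠ[𝓝 z] 0 := notMem_tsupport_iff_eventuallyEq.1 hz
  have hc : ContinuousAt (fun t : ℝ => (z.1, t)) z.2 := by fun_prop
  have h1 : (fun t => φ (z.1, t)) =ᶠ[𝓝 z.2] fun _ => 0 := hc.eventually h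
  rw [dt, h1.deriv_eq, deriv_const]

theorem dx_eq_zero_of_notMem_tsupport {φ : ℝ × ℝ → ℝ} {z : ℝ × ℝ} (hz : z ∉ tsupport φ) :
    dx φ z = 0 := by
  have h : φ =ᶠ[𝓝 z] 0 := notMem_tsupport_iff_eventuallyEq.1 hz
  have hc : ContinuousAt (fun x : ℝ => (x, z.2)) z.1 := by fun_prop
  have h1 : (fun x => φ (x, z.2)) =ᶠ[𝓝 z.1] fun _ => 0 := hc.eventually h
  rw [dx, h1.deriv_eq, deriv_const]

theorem deriv_smul_const_of_real {g : ℝ → ℝ} (e : State n) (t : ℝ) :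
    deriv (fun s => g s • e) t = deriv g t • e := by
  by_cases hg : DifferentiableAt ℝ g t
  · exact deriv_smul_const hg e
  · rw [deriv_zero_of_not_differentiableAt hg, zero_smul]
    by_cases he : e = 0
    · simp [he]
    · apply deriv_zero_of_not_differentiableAt
      intro hd
      apply hg
      have h1 : DifferentiableAt ℝ (fun s => inner ℝ e (g s • e) / inner ℝ e e) t :=
        ((differentiableAt_const e).inner ℝ hd).div_const _
      have h2 : (fun s => inner ℝ e (g s • e) / inner ℝ e e) = g := by
        ext s
        rw [real_inner_smul_right, mul_div_cancel_right₀ _ (inner_self_ne_zero.2 he)]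
      rwa [h2] at h1

theorem isTestFunction_of_openTimes {φ : ℝ × ℝ → ℝ} (h1 : ∃ L, LipschitzWith L φ)
    (h2 : HasCompactSupport φ) (h3 : ∀ z ∈ tsupport φ, z.2 ∈ openTimes T) :
    IsTestFunction T φ := ⟨h1, h2, fun z hz => (h3 z hz).2⟩

theorem IsTestFunction.smul_const {φ : ℝ × ℝ → ℝ} (hφ : IsTestFunction T φ) (e : State n) :
    IsTestFunction T fun z => φ z • e := by
  obtain ⟨⟨L, hL⟩, h2, h3⟩ := hφ
  have hsub : tsupport (fun z => φ z • e) ⊆ tsupport φ :=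
    closure_mono fun z hz h0 => hz (by simp [h0])
  refine ⟨⟨L * ‖e‖₊, LipschitzWith.of_dist_le_mul fun z w => ?_⟩, h2.smul_right,
    fun p hp => h3 p (hsub hp)⟩
  rw [dist_eq_norm, ← sub_smul, norm_smul, NNReal.coe_mul, coe_nnnorm]
  have := hL.dist_le_mul z w
  rw [dist_eq_norm] at this
  nlinarith [norm_nonneg e]

variable {u ub : ℝ × ℝ → State n}

/-- Integrals over the strip against a test function supported in positive times. -/
theorem integral_strip_eq (hub : ∀ᵐ p ∂(volume.restrict (strip T)), u p = ub p)
    {φ : ℝ × ℝ → ℝ} (hφ : ∀ z ∈ tsupport φ, z.2 ∈ openTimes T) (α β : State n → ℝ) :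
    ∫ p in strip T, (dt φ p * α (u p) + dx φ p * β (u p)) =
      ∫ z, (dt φ z * α (ub z) + dx φ z * β (ub z)) := by
  have h1 : ∫ p in strip T, (dt φ p * α (u p) + dx φ p * β (u p)) =
      ∫ p in strip T, (dt φ p * α (ub p) + dx φ p * β (ub p)) := by
    apply integral_congr_ae
    filter_upwards [hub] with p hp
    rw [hp]
  rw [h1]
  apply setIntegral_eq_integral_of_forall_compl_eq_zero
  intro z hz
  have hz' : z ∉ tsupport φ := fun h => hz (openTimes_subset_timeSet (hφ z h))
  rw [dt_eq_zero_of_notMem_tsupport hz', dx_eq_zero_of_notMem_tsupport hz']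
  ring

theorem eq_zero_at_initial_time {φ : ℝ × ℝ → ℝ} (hφ : ∀ z ∈ tsupport φ, z.2 ∈ openTimes T)
    (x : ℝ) : φ (x, 0) = 0 := by
  by_contra h0
  exact lt_irrefl _ (hφ _ (subset_tsupport _ h0)).1

variable {sys : EntropySystem n} {K : Set (State n)} {u₀ : ℝ → State n}

/-- The one-sided limits of an entropic weak solution along a Lipschitz curve satisfy the
Rankine-Hugoniot condition and the entropy inequality. -/
theorem isEntropicDiscontinuity_of_traces (hK : IsCompact K) (hKV : K ⊆ sys.V)
    (hsol : IsWeakSolution sys T u₀ u) (hent : IsEntropic sys T u₀ u)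
    (hubm : Measurable ub) (hubK : ∀ z, ub z ∈ K)
    (hub : ∀ᵐ p ∂(volume.restrict (strip T)), u p = ub p) {L : ℝ≥0} {h : ℝ → ℝ}
    (hh : LipschitzWith L h) {p m : ℝ → State n}
    (hp : ∀ᵐ t, t ∈ openTimes T → EssRightLim ub (h t) t (p t))
    (hm : ∀ᵐ t, t ∈ openTimes T → EssLeftLim ub (h t) t (m t)) :
    ∀ᵐ t, t ∈ openTimes T → p t ∈ K ∧ m t ∈ K ∧
      (p t ≠ m t → sys.IsEntropicDiscontinuity (m t) (p t) (deriv h t)) := by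
  have hpK : ∀ᵐ t, t ∈ openTimes T → p t ∈ K := by
    filter_upwards [hp] with t ht htT
    exact (ht htT).mem_of_isClosed hK.isClosed one_pos (Eventually.of_forall fun _ _ => hubK _)
  have hmK : ∀ᵐ t, t ∈ openTimes T → m t ∈ K := by
    filter_upwards [hm] with t ht htT
    exact (ht htT).mem_of_isClosed hK.isClosed hubK
  have main : ∀ α β : State n → ℝ, ContinuousOn α K → ContinuousOn β K →
      (∀ φ : ℝ × ℝ → ℝ, IsTestFunction T φ → (∀ z ∈ tsupport φ, z.2 ∈ openTimes T) →
        (∀ z, 0 ≤ φ z) → 0 ≤ ∫ p in strip T, (dt φ p * α (u p) + dx φ p * β (u p))) →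
      ∀ᵐ t, t ∈ openTimes T → β (p t) - β (m t) ≤ deriv h t * (α (p t) - α (m t)) := by
    intro α β hα hβ hbal
    obtain ⟨C₁, hC₁⟩ := hK.exists_bound_of_continuousOn hα
    obtain ⟨C₂, hC₂⟩ := hK.exists_bound_of_continuousOn hβ
    refine flux_le_of_weak_le (E := fun z => α (ub z)) (Q := fun z => β (ub z))
      (C := max C₁ C₂) (Ep := fun t => α (p t)) (Em := fun t => α (m t))
      (Qp := fun t => β (p t)) (Qm := fun t => β (m t)) isOpen_openTimes
      (measurable_comp_of_continuousOn hα hubm hubK)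
      (measurable_comp_of_continuousOn hβ hubm hubK)
      (fun z => (hC₁ _ (hubK z)).trans (le_max_left _ _))
      (fun z => (hC₂ _ (hubK z)).trans (le_max_right _ _)) hh ?_ ?_ ?_ ?_ ?_
    · intro φ h1 h2 h3 h4
      rw [← integral_strip_eq hub h3 α β]
      exact hbal φ (isTestFunction_of_openTimes h1 h2 h3) h3 h4
    · filter_upwards [hp, hpK] with t h1 h2 ht using hasEssLim_comp hα hubK (h2 ht) (h1 ht)
    · filter_upwards [hm, hmK] with t h1 h2 ht using hasEssLim_comp hα hubK (h2 ht) (h1 ht)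
    · filter_upwards [hp, hpK] with t h1 h2 ht using hasEssLim_comp hβ hubK (h2 ht) (h1 ht)
    · filter_upwards [hm, hmK] with t h1 h2 ht using hasEssLim_comp hβ hubK (h2 ht) (h1 ht)
  have hq := main sys.η sys.q (sys.contDiffOn_η.continuousOn.mono hKV)
    (sys.contDiffOn_q.continuousOn.mono hKV) fun φ hφ h3 h4 => by
      have h5 := hent φ hφ h4
      simpa [eq_zero_at_initial_time h3] using h5
  have hf : ∀ᵐ t, ∀ e : Fin n × Bool, t ∈ openTimes T →
      inner ℝ (EuclideanSpace.single e.1 (if e.2 then (1 : ℝ) else -1)) (sys.f (p t)) -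
        inner ℝ (EuclideanSpace.single e.1 (if e.2 then (1 : ℝ) else -1)) (sys.f (m t)) ≤
      deriv h t * (inner ℝ (EuclideanSpace.single e.1 (if e.2 then (1 : ℝ) else -1)) (p t) -
        inner ℝ (EuclideanSpace.single e.1 (if e.2 then (1 : ℝ) else -1)) (m t)) := by
    rw [ae_all_iff]
    intro e
    set w : State n := EuclideanSpace.single e.1 (if e.2 then (1 : ℝ) else -1) with hw
    refine main (fun v => inner ℝ w v) (fun v => inner ℝ w (sys.f v))
      (by fun_prop) (continuousOn_const.inner (𝕜 := ℝ) (sys.contDiffOn_f.continuousOn.mono hKV))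
      fun φ hφ h3 h4 => ?_
    have h5 := hsol.weak _ (hφ.smul_const w)
    simp only [eq_zero_at_initial_time h3, zero_smul, inner_zero_left, integral_zero,
      add_zero] at h5
    refine le_of_eq (h5.symm.trans ?_)
    congr 1
    ext z
    simp only [dt, dx, deriv_smul_const_of_real, real_inner_smul_left]
  filter_upwards [hpK, hmK, hq, hf] with t h1 h2 h3 h4 ht
  refine ⟨h1 ht, h2 ht, fun hne => ⟨hKV (h2 ht), hKV (h1 ht), hne.symm, ?_, h3 ht⟩⟩
  ext i
  have h5 := h4 (i, true) ht
  have h6 := h4 (i, false) ht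
  simp only [EuclideanSpace.inner_single_left, if_true, Bool.false_eq_true, if_false, map_one,
    map_neg, one_mul, neg_mul] at h5 h6
  simp only [PiLp.sub_apply, PiLp.smul_apply, smul_eq_mul]
  linarith

end RankineHugoniot

/-! ### Shifts for a single family -/

section Shift

variable {n : ℕ} {sys : EntropySystem n} {𝒮 : ShockCurves n} {uL uR : State n} {K : Set (State n)}

/-- The dissipation estimates on which the construction of a shift relies, with constant `c`: for
shocks of the family with left state in the region where the entropy relative to `uL` is at most
`a` times the one relative to `uR` (including the degenerate shock of strength zero), and for the
speed `-M` at the states which are not deep inside this region. -/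
def Dissipates (sys : EntropySystem n) (𝒮 : ShockCurves n) (K : Set (State n)) (uL uR : State n)
    (σ a c : ℝ) : Prop :=
  ∃ δ > 0, ∃ M : ℝ≥0, (∀ w ∈ K, |sys.speedMin w| < M) ∧
    (∀ u ∈ K, sys.relEntropy u uL ≤ a * sys.relEntropy u uR → u ∈ 𝒮.dom ∧
      ∀ s ∈ 𝒮.params u, 𝒮.curve u s ∈ K → sys.speedMin (𝒮.curve u s) ≤ 𝒮.speed u s →
        a * sys.movingFlux (𝒮.speed u s) (𝒮.curve u s) uR - sys.movingFlux (𝒮.speed u s) u uL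
          ≤ -c * |σ - 𝒮.speed u s| ^ 2) ∧
    ∀ u ∈ K, a * sys.relEntropy u uR - sys.relEntropy u uL ≤ δ →
      a * sys.movingFlux (-M) u uR - sys.movingFlux (-M) u uL ≤ -c * |σ + M| ^ 2

theorem HypH.exists_dissipates (H : HypH sys 𝒮 uL) (huL : uL ∈ 𝒮.dom) {r₁ : ℝ}
    (hr₁ : r₁ ∈ 𝒮.params uL) (hr0 : 0 < r₁) (hK : IsCompact K) (hKV : K ⊆ sys.V)
    (hgap : ∀ v ∈ sys.V, sys.speedMin v < sys.speedMax v) :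
    ∃ a' > 0, ∀ a, 0 < a → a < a' → ∃ c > 0,
      Dissipates sys 𝒮 K uL (𝒮.curve uL r₁) (𝒮.speed uL r₁) a c := by
  obtain ⟨B, hB, hBK⟩ := EntropySystem.exists_abs_charSpeed_le hK hKV
  have hlam : ∀ u ∈ K, |sys.speedMin u| ≤ B := fun u hu => EntropySystem.abs_speedMin_le
    (EntropySystem.charSpeeds_nonempty (hgap u (hKV hu))) (hBK u hu)
  obtain ⟨a', ha', h⟩ := H.exists_dissipation_shock huL hr₁ hr0 hK hKV B
  refine ⟨a', ha', fun a ha haa => ?_⟩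
  obtain ⟨c, hc, g, hg, hshock⟩ := h a ha haa
  obtain ⟨δ, hδ, M, hM, c', hc', hcc, hfast⟩ := EntropySystem.exists_dissipation_fast
    (sys := sys) (uL := uL) (uR := 𝒮.curve uL r₁) (a := a) (σ₁ := 𝒮.speed uL r₁) hK hKV hc hg
    hB.le hlam (fun u hu hle => by
      obtain ⟨h1, h2, h3⟩ := hshock u hu hle
      have h4 := h3 0 (H.family.zero_mem_params h1)
      rw [H.speed_zero u h1, H.family.curve_zero u h1] at h4
      exact ⟨h2, h4 (hlam u hu)⟩)
  refine ⟨c', hc', δ, hδ, M, fun w hw => (hlam w hw).trans_lt hM, fun u hu hle => ?_, hfast⟩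
  obtain ⟨h1, -, h3⟩ := hshock u hu hle
  refine ⟨h1, fun s hs hsK hspeed => ?_⟩
  have h4 : |𝒮.speed u s| ≤ B := abs_le.2
    ⟨(abs_le.1 (hlam _ hsK)).1.trans hspeed,
      (H.speed_le h1 hs).trans (abs_le.1 (hlam u hu)).2⟩
  have h5 := mul_le_mul_of_nonneg_right hcc (sq_nonneg |𝒮.speed uL r₁ - 𝒮.speed u s|)
  linarith [h3 s hs h4]

/-- The threshold and the constants as functions of the shock and its family of curves. They do not
involve the parameter of the shock, which is determined by its end states. -/
theorem exists_dissipation_constants (sys : EntropySystem n) (hK : IsCompact K) (hKV : K ⊆ sys.V)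
    (hgap : ∀ v ∈ sys.V, sys.speedMin v < sys.speedMax v) :
    ∃ (as : ShockCurves n → State n → State n → ℝ) (c : ShockCurves n → State n → State n → ℝ → ℝ),
      (∀ 𝒮 uL uR, 0 < as 𝒮 uL uR) ∧ (∀ 𝒮 uL uR a, 0 < c 𝒮 uL uR a) ∧
      ∀ 𝒮 uL uR σ r, HypH sys 𝒮 uL → 𝒮.IsShockAt uL uR σ r → 0 < r →
        ∀ a, 0 < a → a < as 𝒮 uL uR → Dissipates sys 𝒮 K uL uR σ a (c 𝒮 uL uR a) := by
  have h : ∀ (𝒮 : ShockCurves n) (uL uR : State n), ∃ (a' : ℝ) (c : ℝ → ℝ), 0 < a' ∧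
      (∀ a, 0 < c a) ∧ ∀ σ r, HypH sys 𝒮 uL → 𝒮.IsShockAt uL uR σ r → 0 < r →
        ∀ a, 0 < a → a < a' → Dissipates sys 𝒮 K uL uR σ a (c a) := by
    intro 𝒮 uL uR
    by_cases hex : ∃ σ r, HypH sys 𝒮 uL ∧ 𝒮.IsShockAt uL uR σ r ∧ 0 < r
    · obtain ⟨σ, r, H, hs, hr⟩ := hex
      obtain ⟨a', ha', hD⟩ := H.exists_dissipates hs.1 hs.2.1 hr hK hKV hgap
      rw [hs.2.2.1, hs.2.2.2] at hD
      have hD' : ∀ a, ∃ c > 0, 0 < a → a < a' → Dissipates sys 𝒮 K uL uR σ a c := by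
        intro a
        by_cases ha : 0 < a ∧ a < a'
        · obtain ⟨c, hc, hc'⟩ := hD a ha.1 ha.2
          exact ⟨c, hc, fun _ _ => hc'⟩
        · exact ⟨1, one_pos, fun h1 h2 => absurd ⟨h1, h2⟩ ha⟩
      choose c hc hcD using hD'
      refine ⟨a', c, ha', hc, fun σ' r' _ hs' _ a h1 h2 => ?_⟩
      rw [← (H.family.isShockAt_unique hs hs').2]
      exact hcD a h1 h2
    · exact ⟨1, fun _ => 1, one_pos, fun _ => one_pos,
        fun σ r H hs hr => absurd ⟨σ, r, H, hs, hr⟩ hex⟩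
  choose as c has hc hD using h
  exact ⟨as, c, has, hc, fun 𝒮 uL uR σ r H hs hr a h1 h2 => hD 𝒮 uL uR σ r H hs hr a h1 h2⟩

/-- The solution has one-sided limits along Lipschitz curves, at almost every time in `I`, and they
form entropic discontinuities. -/
def HasEntropicTraces (sys : EntropySystem n) (K : Set (State n)) (I : Set ℝ)
    (u : ℝ × ℝ → State n) : Prop :=
  ∀ (L : ℝ≥0) (h : ℝ → ℝ), LipschitzWith L h → ∀ᵐ t, t ∈ I → ∃ p ∈ K, ∃ m ∈ K,
    EssRightLim u (h t) t p ∧ EssLeftLim u (h t) t m ∧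
      (p ≠ m → sys.IsEntropicDiscontinuity m p (deriv h t))

/-- The shift of a 1-shock, to the left of a barrier which moves faster than the first
characteristic speed. -/
theorem HypH.exists_shift (H : HypH sys 𝒮 uL) {σ a c : ℝ} (hD : Dissipates sys 𝒮 K uL uR σ a c)
    (hK : IsCompact K) (hKV : K ⊆ sys.V) {I : Set ℝ} (hI : IsOpen I) (hI0 : ∀ t ∈ I, 0 < t)
    (hId : ∀ t ∈ I, Ioo 0 t ⊆ I) {u : ℝ × ℝ → State n} (hu : Measurable u) (huK : ∀ z, u z ∈ K)
    (htr : HasEntropicTraces sys K I u) {L : ℝ≥0} {b : ℝ → ℝ} (hb : LipschitzWith L b)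
    (hb0 : 0 ≤ b 0) (hbl : ∀ᵐ t, t ∈ I → ∃ p ∈ K, EssRightLim u (b t) t p ∧
      sys.speedMin p < deriv b t) :
    ∃ (M : ℝ≥0) (h : ℝ → ℝ), LipschitzWith M h ∧ h 0 = 0 ∧ (∀ t ∈ I, h t ≤ b t) ∧
      ∀ᵐ t, t ∈ I → ∃ p ∈ K, ∃ m ∈ K, EssRightLim u (h t) t p ∧ EssLeftLim u (h t) t m ∧
        a * (sys.relFlux p uR - deriv h t * sys.relEntropy p uR) - sys.relFlux m uL
          + deriv h t * sys.relEntropy m uL ≤ -c * |σ - deriv h t| ^ 2 ∧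
        ((∀ v ∈ K, deriv h t < sys.speedMin v) ∨
          (𝒮.IsShock m p (deriv h t) ∧ sys.relEntropy m uL ≤ a * sys.relEntropy m uR)) ∧
        deriv h t ≤ sys.speedMin m := by
  obtain ⟨δ, hδ, M, hM, hshock, hfast⟩ := hD
  set D : ShiftData n :=
    { K := K
      isCompact_K := hK
      G := fun w => a * sys.relEntropy w uR - sys.relEntropy w uL
      lam := sys.speedMin
      continuousOn_G := (continuousOn_const.mul ((sys.continuousOn_relEntropy uR).mono hKV)).sub
        ((sys.continuousOn_relEntropy uL).mono hKV)
      continuousOn_lam := H.continuousOn_speedMin.mono fun w hw =>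
        (hshock w hw.1 (sub_nonneg.1 hw.2)).1
      M := M
      abs_lam_lt := hM
      δ := δ
      δ_pos := hδ
      u := u
      measurable_u := hu
      u_mem := huK
      I := I
      isOpen_I := hI
      I_pos := hI0
      I_down := hId
      disc := sys.IsEntropicDiscontinuity
      lam_lt_of_disc := H.speed_gt
      traces := htr } with hDdef
  obtain ⟨h, hh, h0, hle, hgood⟩ := D.exists_good_path hb hb0
    (by
      filter_upwards [hbl] with t ht htI
      obtain ⟨p, hp, -, hlt⟩ := ht htI
      exact (abs_lt.1 (hM p hp)).1.trans hlt)
    (by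
      filter_upwards [hbl] with t ht htI p _ hr _
      obtain ⟨p', -, hr', hlt⟩ := ht htI
      rw [hr.unique hr']
      exact hlt)
  refine ⟨M, h, hh, h0, hle, ?_⟩
  filter_upwards [hgood] with t ht htI
  obtain ⟨p, hp, m, hm, hr, hl, hcase⟩ := ht htI
  refine ⟨p, hp, m, hm, hr, hl, ?_⟩
  set v := deriv h t with hv
  have hid : ∀ x y : State n, a * (sys.relFlux x uR - v * sys.relEntropy x uR) - sys.relFlux y uL
      + v * sys.relEntropy y uL = a * sys.movingFlux v x uR - sys.movingFlux v y uL := by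
    intro x y; simp only [EntropySystem.movingFlux]; ring
  rw [hid]
  rcases hcase with ⟨hne, hdisc, hG, hvle⟩ | ⟨rfl, hG, hvv⟩ | ⟨rfl, hG, hvv⟩
  · have hGm : sys.relEntropy m uL ≤ a * sys.relEntropy m uR := sub_nonneg.1 hG
    obtain ⟨hmd, hest⟩ := hshock m hm hGm
    obtain ⟨s, hs, hsp⟩ := H.separated m p v hmd hdisc hvle
    have hspeed : 𝒮.speed m s = v := by
      have h1 := H.family.rankineHugoniot m hmd s hs
      rw [hsp, hdisc.2.2.2.1] at h1
      exact (smul_left_injective ℝ (sub_ne_zero.2 hne) h1).symm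
    have h2 := hest s hs (hsp.symm ▸ hp) (by rw [hsp, hspeed]; exact (H.speed_gt m p v hdisc).le)
    rw [hsp, hspeed] at h2
    exact ⟨h2, Or.inr ⟨⟨s, hmd, hs, hsp, hspeed⟩, hGm⟩, hvle⟩
  · have hGp : sys.relEntropy p uL ≤ a * sys.relEntropy p uR := sub_nonneg.1 hG
    obtain ⟨hpd, hest⟩ := hshock p hp hGp
    have h0p := H.family.zero_mem_params hpd
    have hs0 : 𝒮.speed p 0 = v := (H.speed_zero p hpd).trans hvv.symm
    have hc0 := H.family.curve_zero p hpd
    have h2 := hest 0 h0p (hc0.symm ▸ hp) (by rw [hc0, hs0]; exact hvv.ge)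
    rw [hc0, hs0] at h2
    exact ⟨h2, Or.inr ⟨⟨0, hpd, h0p, hc0, hs0⟩, hGp⟩, hvv.le⟩
  · have hlt : ∀ w ∈ K, v < sys.speedMin w := fun w hw => hvv.trans_lt (abs_lt.1 (hM w hw)).1
    have h2 := hfast p hp hG
    have hvM : v = -(M : ℝ) := hvv
    rw [hvM, sub_neg_eq_add]
    exact ⟨h2, Or.inl (hvM ▸ hlt), hvM ▸ (hlt p hp).le⟩

end Shift

/-! ### Reflection of the space variable -/

section Reflection

variable {n : ℕ}

/-- The system satisfied by `u(-x, t)`: both fluxes change sign. -/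
def EntropySystem.reflect (sys : EntropySystem n) : EntropySystem n where
  V := sys.V
  f := fun u => -sys.f u
  η := sys.η
  q := fun u => -sys.q u
  isOpen_V := sys.isOpen_V
  convex_V := sys.convex_V
  contDiffOn_f := sys.contDiffOn_f.neg
  contDiffOn_η := sys.contDiffOn_η
  contDiffOn_q := sys.contDiffOn_q.neg
  hessian_pos := sys.hessian_pos
  compat := fun u hu w => by
    rw [fderiv_fun_neg, fderiv_fun_neg]
    simp [sys.compat u hu w]

/-- The shock curves of the reflected system. -/
def ShockCurves.reflect (𝒮 : ShockCurves n) : ShockCurves n where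
  dom := 𝒮.dom
  len := 𝒮.len
  curve := 𝒮.curve
  speed := fun u s => -𝒮.speed u s

variable {sys : EntropySystem n} {𝒮 : ShockCurves n}

theorem EntropySystem.charSpeeds_reflect (u : State n) :
    sys.reflect.charSpeeds u = -sys.charSpeeds u := by
  ext μ
  have h1 : (fderiv ℝ sys.reflect.f u).toLinearMap = -(fderiv ℝ sys.f u).toLinearMap := by
    have : fderiv ℝ sys.reflect.f u = -fderiv ℝ sys.f u := fderiv_fun_neg
    rw [this]; rfl
  simp only [charSpeeds, Set.mem_neg, mem_ofPred_eq, h1, Module.End.hasEigenvalue_iff,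
    Submodule.ne_bot_iff, Module.End.mem_eigenspace_iff]
  refine exists_congr fun x => and_congr_left fun _ => ?_
  rw [LinearMap.neg_apply, neg_smul, neg_eq_iff_eq_neg]

theorem EntropySystem.speedMin_reflect (u : State n) :
    sys.reflect.speedMin u = -sys.speedMax u := by
  rw [speedMin, speedMax, charSpeeds_reflect, Real.sInf_def, neg_neg]

theorem EntropySystem.speedMax_reflect (u : State n) :
    sys.reflect.speedMax u = -sys.speedMin u := by
  rw [speedMin, speedMax, charSpeeds_reflect, Real.sInf_def, neg_neg]

theorem EntropySystem.relFlux_reflect (u v : State n) :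
    sys.reflect.relFlux u v = -sys.relFlux u v := by
  have h : ∀ a b : State n, -a - -b = -(a - b) := fun a b => by abel
  simp only [relFlux, reflect, h, map_neg]
  ring

theorem EntropySystem.isEntropicDiscontinuity_reflect {uL uR : State n} {σ : ℝ} :
    sys.reflect.IsEntropicDiscontinuity uL uR σ ↔ sys.IsEntropicDiscontinuity uR uL (-σ) := by
  have h1 : -sys.f uR - -sys.f uL = σ • (uR - uL) ↔ sys.f uL - sys.f uR = -σ • (uL - uR) := by
    have e1 : -sys.f uR - -sys.f uL = sys.f uL - sys.f uR := by abel
    have e2 : -σ • (uL - uR) = σ • (uR - uL) := by rw [neg_smul, ← smul_neg, neg_sub]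
    rw [e1, e2]
  have h2 : -sys.q uR - -sys.q uL ≤ σ * (sys.η uR - sys.η uL) ↔
      sys.q uL - sys.q uR ≤ -σ * (sys.η uL - sys.η uR) := by
    constructor <;> intro h <;> linarith
  constructor
  · rintro ⟨hL, hR, hne, hRH, he⟩
    exact ⟨hR, hL, hne.symm, h1.1 hRH, h2.1 he⟩
  · rintro ⟨hR, hL, hne, hRH, he⟩
    exact ⟨hL, hR, hne.symm, h1.2 hRH, h2.2 he⟩

theorem IsShockFamily.reflect {v : State n} (F : IsShockFamily sys 𝒮 v) :
    IsShockFamily sys.reflect 𝒮.reflect v where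
  dom_eq := F.dom_eq
  len_pos := F.len_pos
  mapsTo := F.mapsTo
  curve_zero := F.curve_zero
  arcLength := F.arcLength
  rankineHugoniot := fun u hu s hs => by
    have h := F.rankineHugoniot u hu s hs
    change -sys.f (𝒮.curve u s) - -sys.f u = (-𝒮.speed u s) • (𝒮.curve u s - u)
    rw [neg_smul, ← h]
    abel
  len_lipschitz := F.len_lipschitz
  contDiffOn_curve := F.contDiffOn_curve
  contDiffOn_speed := F.contDiffOn_speed.neg
  strengthens := F.strengthens
  noWrap := F.noWrap

theorem HypHStar.reflect {v : State n} (H : HypHStar sys 𝒮 v) :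
    HypH sys.reflect 𝒮.reflect v where
  family := H.family.reflect
  speed_zero := fun u hu => by
    rw [EntropySystem.speedMin_reflect, ← H.speed_zero u hu]
    rfl
  liu := fun u hu s hs hs0 => by
    have h : deriv (𝒮.reflect.speed u) s = -deriv (𝒮.speed u) s := deriv.fun_neg
    rw [h]
    linarith [H.liu u hu s hs hs0]
  speed_gt := fun uL uR σ hd => by
    rw [EntropySystem.speedMin_reflect]
    linarith [H.speed_lt _ _ _ (EntropySystem.isEntropicDiscontinuity_reflect.1 hd)]
  separated := fun uL uR σ hu hd hσ => by
    rw [EntropySystem.speedMin_reflect] at hσ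
    exact H.separated _ _ _ hu (EntropySystem.isEntropicDiscontinuity_reflect.1 hd) (by linarith)

theorem ShockCurves.isShockAt_reflect {u v : State n} {σ r : ℝ} :
    𝒮.reflect.IsShockAt u v σ r ↔ 𝒮.IsShockAt u v (-σ) r := by
  have h : -𝒮.speed u r = σ ↔ 𝒮.speed u r = -σ := neg_eq_iff_eq_neg
  exact and_congr Iff.rfl (and_congr Iff.rfl (and_congr Iff.rfl h))

theorem essRightLim_reflect {u : ℝ × ℝ → State n} {x t : ℝ} {p : State n} :
    EssRightLim (fun z => u (-z.1, z.2)) x t p ↔ EssLeftLim u (-x) t p := by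
  rw [essLeftLim_iff_reflect, neg_neg]

theorem essLeftLim_reflect {u : ℝ × ℝ → State n} {x t : ℝ} {p : State n} :
    EssLeftLim (fun z => u (-z.1, z.2)) x t p ↔ EssRightLim u (-x) t p := by
  rw [essLeftLim_iff_reflect]
  simp only [neg_neg]

theorem HasEntropicTraces.reflect {K : Set (State n)} {I : Set ℝ} {u : ℝ × ℝ → State n}
    (htr : HasEntropicTraces sys K I u) :
    HasEntropicTraces sys.reflect K I fun z => u (-z.1, z.2) := by
  intro L h hh
  filter_upwards [htr L (fun t => -h t) hh.neg] with t ht htI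
  obtain ⟨p, hp, m, hm, hr, hl, hd⟩ := ht htI
  refine ⟨m, hm, p, hp, essRightLim_reflect.2 hl, essLeftLim_reflect.2 hr, fun hne => ?_⟩
  rw [EntropySystem.isEntropicDiscontinuity_reflect]
  have h1 : deriv (fun t => -h t) t = -deriv h t := deriv.fun_neg
  rw [← h1]
  exact hd hne.symm

end Reflection

theorem mainTheorem2 {n : ℕ} (sys : EntropySystem n)
    (hgap : ∀ v ∈ sys.V, sys.speedMin v < sys.speedMax v)
    (K : Set (State n)) (hK : IsCompact K) (hKV : K ⊆ sys.V) :
    -- the thresholds and constants, as functions of what they may depend on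
    ∃ (a₁s aₙs : ShockCurves n → State n → State n → ℝ)
      (c₁ cₙ : ShockCurves n → State n → State n → ℝ → ℝ → ℝ),
      (∀ 𝒮 uL uR, 0 < a₁s 𝒮 uL uR ∧ 0 < aₙs 𝒮 uL uR) ∧
      (∀ 𝒮 uL uR ρ a, 0 < c₁ 𝒮 uL uR ρ a ∧ 0 < cₙ 𝒮 uL uR ρ a) ∧
      ∀ (𝒮₁ 𝒮ₙ : ShockCurves n) (uL₁ uR₁ uLₙ uRₙ : State n) (σ₁ σₙ r₁ rₙ ρ : ℝ),
        HypH sys 𝒮₁ uL₁ → HypHStar sys 𝒮ₙ uRₙ →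
        𝒮₁.IsShockAt uL₁ uR₁ σ₁ r₁ → 𝒮ₙ.IsShockAt uRₙ uLₙ σₙ rₙ →
        0 < ρ → ρ < r₁ → ρ < rₙ →
        ∀ a₁ aₙ : ℝ, 0 < a₁ → a₁ < a₁s 𝒮₁ uL₁ uR₁ → 0 < aₙ → aₙ < aₙs 𝒮ₙ uLₙ uRₙ →
        ∀ (T : EReal) (u₀ : ℝ → State n) (u : ℝ × ℝ → State n), 0 < T →
          IsWeakSolution sys T u₀ u → IsEntropic sys T u₀ u → HasStrongTraces T u →
          (∀ᵐ p ∂(volume.restrict (strip T)), u p ∈ K) →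
          ∃ h₁ hₙ : ℝ → ℝ,
            (∃ L : ℝ≥0, LipschitzOnWith L h₁ (timeSet T)) ∧
            (∃ L : ℝ≥0, LipschitzOnWith L hₙ (timeSet T)) ∧
            h₁ 0 = 0 ∧ hₙ 0 = 0 ∧
            (∀ t ∈ timeSet T, h₁ t ≤ hₙ t) ∧
            -- along the 1-shift
            (∀ up um : ℝ → State n, IsRightTrace T u h₁ up → IsLeftTrace T u h₁ um →
              ∀ᵐ t ∂(volume.restrict (timeSet T)),
                a₁ * (sys.relFlux (up t) uR₁ - deriv h₁ t * sys.relEntropy (up t) uR₁)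
                    - sys.relFlux (um t) uL₁ + deriv h₁ t * sys.relEntropy (um t) uL₁
                  ≤ -(c₁ 𝒮₁ uL₁ uR₁ ρ a₁) * |σ₁ - deriv h₁ t| ^ 2 ∧
                ((∀ v ∈ K, deriv h₁ t < sys.speedMin v) ∨
                  (𝒮₁.IsShock (um t) (up t) (deriv h₁ t) ∧
                    sys.relEntropy (um t) uL₁ ≤ a₁ * sys.relEntropy (um t) uR₁))) ∧
            -- along the n-shift
            (∀ up um : ℝ → State n, IsRightTrace T u hₙ up → IsLeftTrace T u hₙ um →
              ∀ᵐ t ∂(volume.restrict (timeSet T)),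
                1 / aₙ * (sys.relFlux (up t) uRₙ - deriv hₙ t * sys.relEntropy (up t) uRₙ)
                    - sys.relFlux (um t) uLₙ + deriv hₙ t * sys.relEntropy (um t) uLₙ
                  ≤ -(cₙ 𝒮ₙ uLₙ uRₙ ρ aₙ) * |σₙ - deriv hₙ t| ^ 2 ∧
                ((∀ v ∈ K, sys.speedMax v < deriv hₙ t) ∨
                  (𝒮ₙ.IsShock (up t) (um t) (deriv hₙ t) ∧
                    sys.relEntropy (up t) uRₙ ≤ aₙ * sys.relEntropy (up t) uLₙ))) := by
  have hgap' : ∀ v ∈ sys.reflect.V, sys.reflect.speedMin v < sys.reflect.speedMax v := by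
    intro v hv
    rw [EntropySystem.speedMin_reflect, EntropySystem.speedMax_reflect]
    exact neg_lt_neg (hgap v hv)
  obtain ⟨a₁s, c₁, ha₁s, hc₁, hD₁⟩ := exists_dissipation_constants sys hK hKV hgap
  obtain ⟨aₙs, cₙ, haₙs, hcₙ, hDₙ⟩ := exists_dissipation_constants sys.reflect hK hKV hgap'
  -- the dissipation along the n-shift is that of the reflected problem, divided by `aₙ`
  refine ⟨a₁s, fun 𝒮 uL uR => aₙs 𝒮.reflect uR uL, fun 𝒮 uL uR _ a => c₁ 𝒮 uL uR a,
    fun 𝒮 uL uR _ a => cₙ 𝒮.reflect uR uL a * if 0 < a then 1 / a else 1,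
    fun 𝒮 uL uR => ⟨ha₁s _ _ _, haₙs _ _ _⟩, fun 𝒮 uL uR ρ a => ⟨hc₁ _ _ _ _, ?_⟩, ?_⟩
  · have := hcₙ 𝒮.reflect uR uL a
    dsimp only
    split_ifs <;> positivity
  intro 𝒮₁ 𝒮ₙ uL₁ uR₁ uLₙ uRₙ σ₁ σₙ r₁ rₙ ρ H₁ Hₙ hs₁ hsₙ hρ hρ₁ hρₙ a₁ aₙ ha₁ ha₁' haₙ haₙ'
    T u₀ u hT hsol hent htr huK
  obtain ⟨ub, hubm, hubK, hub⟩ := exists_measurable_modification hK hT hsol.meas huK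
  have hright : ∀ {L : ℝ≥0} {h : ℝ → ℝ} {v : ℝ → State n}, LipschitzWith L h →
      IsRightTrace T u h v → ∀ᵐ t, t ∈ openTimes T → EssRightLim ub (h t) t (v t) :=
    fun hh hv => hv.ae_essRightLim hubm hub hh.continuous.measurable
  have hleft : ∀ {L : ℝ≥0} {h : ℝ → ℝ} {v : ℝ → State n}, LipschitzWith L h →
      IsLeftTrace T u h v → ∀ᵐ t, t ∈ openTimes T → EssLeftLim ub (h t) t (v t) :=
    fun hh hv => hv.ae_essLeftLim hubm hub hh.continuous.measurable
  have htraces : HasEntropicTraces sys K (openTimes T) ub := by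
    intro L h hh
    obtain ⟨up, um, hup, hum⟩ := htr h ⟨L, hh.lipschitzOnWith⟩
    filter_upwards [hright hh hup, hleft hh hum, isEntropicDiscontinuity_of_traces hK hKV hsol hent
      hubm hubK hub hh (hright hh hup) (hleft hh hum)] with t h1 h2 h3 ht
    obtain ⟨h4, h5, h6⟩ := h3 ht
    exact ⟨up t, h4, um t, h5, h1 ht, h2 ht, h6⟩
  obtain ⟨B, hB, hBK⟩ := EntropySystem.exists_abs_charSpeed_le (sys := sys.reflect) hK hKV
  have hlam : ∀ w ∈ K, |sys.reflect.speedMin w| ≤ B := fun w hw =>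
    EntropySystem.abs_speedMin_le (EntropySystem.charSpeeds_nonempty (hgap' w (hKV hw))) (hBK w hw)
  have hI0 : ∀ t ∈ openTimes T, 0 < t := fun t ht => ht.1
  have hId : ∀ t ∈ openTimes T, Ioo 0 t ⊆ openTimes T := fun t ht s hs =>
    ⟨hs.1, lt_trans (by exact_mod_cast hs.2) ht.2⟩
  -- in the reflected problem, a straight line with large slope serves as the barrier
  have hline : LipschitzWith (Real.toNNReal (B + 1)) fun t : ℝ => (B + 1) * t := by
    refine LipschitzWith.of_dist_le_mul fun s t => ?_
    rw [Real.dist_eq, Real.dist_eq, ← mul_sub, abs_mul, abs_of_pos (by linarith : 0 < B + 1),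
      Real.coe_toNNReal _ (by linarith)]
  obtain ⟨Mₙ, k, hk, hk0, -, hgoodₙ⟩ := Hₙ.reflect.exists_shift
    (hDₙ 𝒮ₙ.reflect uRₙ uLₙ (-σₙ) rₙ Hₙ.reflect
      (ShockCurves.isShockAt_reflect.2 (by rwa [neg_neg])) (hρ.trans hρₙ) aₙ haₙ haₙ')
    hK hKV isOpen_openTimes hI0 hId (u := fun z => ub (-z.1, z.2))
    (hubm.comp (by fun_prop)) (fun z => hubK _) htraces.reflect hline (by simp) (by
      filter_upwards [htraces.reflect _ _ hline] with t ht htI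
      obtain ⟨p, hp, m, -, hr, -⟩ := ht htI
      have hd : deriv (fun t : ℝ => (B + 1) * t) t = B + 1 := by
        simp
      exact ⟨p, hp, hr, by rw [hd]; linarith [(abs_le.1 (hlam p hp)).2]⟩)
  have hkn : LipschitzWith Mₙ fun t => -k t := hk.neg
  have hdk : ∀ t, deriv (fun t => -k t) t = -deriv k t := fun t => deriv.fun_neg
  -- the n-shift moves at least as fast as the n-th characteristic speed of its right trace
  obtain ⟨M₁, h, hh, hh0, hle, hgood₁⟩ := H₁.exists_shift
    (hD₁ 𝒮₁ uL₁ uR₁ σ₁ r₁ H₁ hs₁ (hρ.trans hρ₁) a₁ ha₁ ha₁')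
    hK hKV isOpen_openTimes hI0 hId hubm hubK htraces hkn (by simp [hk0]) (by
      filter_upwards [hgoodₙ] with t ht htI
      obtain ⟨p, -, m, hm, -, hl, -, -, hspeed⟩ := ht htI
      refine ⟨m, hm, essLeftLim_reflect.1 hl, ?_⟩
      rw [EntropySystem.speedMin_reflect] at hspeed
      rw [hdk]
      linarith [hgap m (hKV hm)])
  refine ⟨h, fun t => -k t, ⟨M₁, hh.lipschitzOnWith⟩, ⟨Mₙ, hkn.lipschitzOnWith⟩, hh0,
    by simp [hk0], fun t ht => ?_, fun up um hup hum => ?_, fun up um hup hum => ?_⟩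
  · rcases ht.1.eq_or_lt with h0 | h0
    · simp [← h0, hh0, hk0]
    · exact hle t ⟨h0, ht.2⟩
  · apply ae_timeSet_of_ae_openTimes
    filter_upwards [hgood₁, hright hh hup, hleft hh hum] with t h1 h2 h3 ht
    obtain ⟨p, -, m, -, hr, hl, hest, hdich, -⟩ := h1 ht
    rw [(h2 ht).unique hr, (h3 ht).unique hl]
    exact ⟨hest, hdich⟩
  · apply ae_timeSet_of_ae_openTimes
    filter_upwards [hgoodₙ, hright hkn hup, hleft hkn hum] with t h1 h2 h3 ht
    obtain ⟨p, -, m, -, hr, hl, hest, hdich, -⟩ := h1 ht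
    rw [(h2 ht).unique (essLeftLim_reflect.1 hl), (h3 ht).unique (essRightLim_reflect.1 hr), hdk]
    constructor
    · rw [if_pos haₙ]
      simp only [EntropySystem.relFlux_reflect] at hest
      change aₙ * (-sys.relFlux p uLₙ - deriv k t * sys.relEntropy p uLₙ) - -sys.relFlux m uRₙ
        + deriv k t * sys.relEntropy m uRₙ ≤ _ at hest
      have habs : |σₙ - -deriv k t| = |-σₙ - deriv k t| := by
        rw [← abs_neg]; congr 1; ring
      rw [habs]
      have h4 := mul_le_mul_of_nonneg_left hest (one_div_pos.2 haₙ).le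
      have h5 : 1 / aₙ * (aₙ * (-sys.relFlux p uLₙ - deriv k t * sys.relEntropy p uLₙ)
          - -sys.relFlux m uRₙ + deriv k t * sys.relEntropy m uRₙ) =
          1 / aₙ * (sys.relFlux m uRₙ - -deriv k t * sys.relEntropy m uRₙ) - sys.relFlux p uLₙ
            + -deriv k t * sys.relEntropy p uLₙ := by
        field_simp
        ring
      rw [h5] at h4
      refine h4.trans (le_of_eq ?_)
      ring
    · rcases hdich with hfast | ⟨⟨r, hsh⟩, hent'⟩
      · refine Or.inl fun v hv => ?_
        have := hfast v hv
        rw [EntropySystem.speedMin_reflect] at this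
        linarith
      · exact Or.inr ⟨⟨r, ShockCurves.isShockAt_reflect.1 hsh⟩, hent'⟩
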